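/- All graphs are finite, simple and connected, and $W_p(G)$ denotes the Wiener polarity index, the number of unordered pairs $\{u,v\}$ of vertices of $G$ with $d_G(u,v)=3$. A \emph{benzenoid graph} is a 2-connected plane graph in which the boundary of every inner face is a 6-cycle, every 6-cycle is the boundary of some inner face, any two distinct 6-cycles are either disjoint or have exactly one common edge, and no three 6-cycles share a common edge. It is \emph{catacondensed} if no vertex is shared by three inner faces. Two faces are adjacent if they have an edge in common. A \emph{phenylene} is a graph obtained from a catacondensed benzenoid graph with at least two inner faces by adding a quadrilateral (a face bounded by a 4-cycle) between every two adjacent inner faces. The \emph{hexagons} of a catacondensed benzenoid graph or of a phenylene are its inner faces bounded by a 6-cycle. A hexagon is \emph{branched} if it is adjacent to exactly three other inner faces; it is \emph{angular} if it is adjacent to exactly two other inner faces and its two vertices of degree two are adjacent. A catacondensed benzenoid graph or a phenylene is a \emph{linear chain} if it has no angular and no branched hexagons. \textbf{Proposition.} (a) For every $h\ge 1$ there is, up to isomorphism, exactly one catacondensed benzenoid graph with $h$ hexagons that is a linear chain; denote it by $L_h$. If $G$ is a catacondensed benzenoid graph with exactly $h$ hexagons, then $W_p(G)\ge W_p(L_h)$,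 and equality holds if and only if $G\cong L_h$. (b) For every $h\ge 2$ there is, up to isomorphism, exactly one phenylene with $h$ hexagons that is a linear chain; denote it by $L_h$. If $G$ is a phenylene with exactly $h$ hexagons, then $W_p(G)\ge W_p(L_h)$, and equality holds if and only if $G\cong L_h$. -/

import Mathlib

/-! Plane graphs are described by rotation systems of genus zero with a marked outer face
(every plane embedding of a finite connected graph is of this form, up to homeomorphism). -/

/-- The Wiener polarity index: the number of unordered pairs of vertices at distance three. -/
noncomputable def wienerPolarity {V : Type*} (G : SimpleGraph V) : ℕ :=
  {p : Sym2 V | ∃ u v, p = s(u, v) ∧ G.dist u v = 3}.ncard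

/-- `C` is the edge set of a cycle of length `k` in `G`. -/
def IsCycleEdges {V : Type*} (G : SimpleGraph V) (k : ℕ) (C : Set (Sym2 V)) : Prop :=
  ∃ (v : V) (w : G.Walk v v), w.IsCycle ∧ w.length = k ∧ C = {e | e ∈ w.edges}

/-- The vertices covered by a set of edges. -/
def vertsOf {V : Type*} (C : Set (Sym2 V)) : Set V :=
  {v | ∃ e ∈ C, v ∈ e}

/-- 2-connectedness: at least three vertices, connected, and still connected after the removal
of any one vertex. -/
def IsTwoConnected {V : Type*} (G : SimpleGraph V) : Prop :=
  3 ≤ Nat.card V ∧ G.Connected ∧ ∀ v : V, (G.induce {v}ᶜ).Connected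

/-- The face permutation of a permutation `rot` of the darts: a dart from `u` to `v` is followed
by the dart that comes after its reversal in the rotation at `v`. -/
def facePerm {V : Type*} {G : SimpleGraph V} (rot : Equiv.Perm G.Dart) : Equiv.Perm G.Dart :=
  (SimpleGraph.Dart.symm_involutive (G := G)).toPerm.trans rot

/-- A plane embedding of a finite connected graph with at least one edge, as a combinatorial map:
`rot` turns the darts (directed edges) leaving each vertex cyclically, the faces are the orbits of
the face permutation, Euler's formula `|V| - |E| + |F| = 2` says that the surface is a sphere, and
the face containing the dart `outer` is the outer (unbounded) one. -/
structure PlaneEmbedding {V : Type*} (G : SimpleGraph V) where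
  rot : Equiv.Perm G.Dart
  rot_fst : ∀ d : G.Dart, (rot d).fst = d.fst
  rot_cyclic : ∀ d e : G.Dart, d.fst = e.fst → rot.SameCycle d e
  connected : G.Connected
  euler : Nat.card V + Nat.card (Quotient (Equiv.Perm.SameCycle.setoid (facePerm rot))) =
    Nat.card G.edgeSet + 2
  outer : G.Dart

namespace PlaneEmbedding

/-- The set of edges on the boundary of the face to which the dart `d` belongs. -/
def boundary {V : Type*} {G : SimpleGraph V} (P : PlaneEmbedding G) (d : G.Dart) :
    Set (Sym2 V) :=
  {e | ∃ d' : G.Dart, (facePerm P.rot).SameCycle d d' ∧ d'.edge = e}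

/-- The boundaries of the inner faces, that is, of all faces but the outer one. -/
def innerFaces {V : Type*} {G : SimpleGraph V} (P : PlaneEmbedding G) : Set (Set (Sym2 V)) :=
  {C | ∃ d : G.Dart, ¬ (facePerm P.rot).SameCycle P.outer d ∧ C = P.boundary d}

/-- Benzenoid graphs: 2-connected plane graphs in which the boundary of every inner face is a
6-cycle, every 6-cycle is the boundary of an inner face, two 6-cycles are disjoint or have exactly
one common edge, and no three 6-cycles share a common edge. -/
structure IsBenzenoid {V : Type*} {G : SimpleGraph V} (P : PlaneEmbedding G) : Prop where
  twoConnected : IsTwoConnected G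
  face_hexagon : ∀ C ∈ P.innerFaces, IsCycleEdges G 6 C
  hexagon_face : ∀ C, IsCycleEdges G 6 C → C ∈ P.innerFaces
  pair : ∀ C D, IsCycleEdges G 6 C → IsCycleEdges G 6 D → C ≠ D →
    Disjoint (vertsOf C) (vertsOf D) ∨ (C ∩ D).ncard = 1
  triple : ∀ C₁ C₂ C₃, IsCycleEdges G 6 C₁ → IsCycleEdges G 6 C₂ → IsCycleEdges G 6 C₃ →
    C₁ ≠ C₂ → C₁ ≠ C₃ → C₂ ≠ C₃ → C₁ ∩ C₂ ∩ C₃ = ∅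

end PlaneEmbedding

/-- `G`, with `F` as the set of boundaries of its inner faces, is a catacondensed benzenoid graph:
a benzenoid graph without internal vertices, i.e. no vertex is shared by three hexagons. -/
def IsCatacondensed {V : Type*} (G : SimpleGraph V) (F : Set (Set (Sym2 V))) : Prop :=
  ∃ P : PlaneEmbedding G, P.IsBenzenoid ∧ F = P.innerFaces ∧
    ¬ ∃ v, ∃ C₁ ∈ F, ∃ C₂ ∈ F, ∃ C₃ ∈ F, C₁ ≠ C₂ ∧ C₁ ≠ C₃ ∧ C₂ ≠ C₃ ∧
      v ∈ vertsOf C₁ ∧ v ∈ vertsOf C₂ ∧ v ∈ vertsOf C₃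

/-- The hexagons: the inner faces whose boundary is a 6-cycle. -/
def hexagons {V : Type*} (G : SimpleGraph V) (F : Set (Set (Sym2 V))) : Set (Set (Sym2 V)) :=
  {C ∈ F | IsCycleEdges G 6 C}

/-- The inner faces other than `C` that have an edge in common with `C`. -/
def adjacentFaces {V : Type*} (F : Set (Set (Sym2 V))) (C : Set (Sym2 V)) :
    Set (Set (Sym2 V)) :=
  {D ∈ F | D ≠ C ∧ (C ∩ D).Nonempty}

/-- A branched hexagon is adjacent to exactly three other inner faces. -/
def IsBranched {V : Type*} (F : Set (Set (Sym2 V))) (C : Set (Sym2 V)) : Prop :=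
  (adjacentFaces F C).ncard = 3

/-- An angular hexagon is adjacent to exactly two other inner faces, and its vertices of degree two
are adjacent. -/
def IsAngular {V : Type*} (G : SimpleGraph V) (F : Set (Set (Sym2 V))) (C : Set (Sym2 V)) :
    Prop :=
  (adjacentFaces F C).ncard = 2 ∧ ∃ u ∈ vertsOf C, ∃ v ∈ vertsOf C,
    (G.neighborSet u).ncard = 2 ∧ (G.neighborSet v).ncard = 2 ∧ G.Adj u v

/-- A linear chain has neither angular nor branched hexagons. -/
def HasLinearHexagons {V : Type*} (G : SimpleGraph V) (F : Set (Set (Sym2 V))) : Prop :=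
  ∀ C ∈ hexagons G F, ¬ IsAngular G F C ∧ ¬ IsBranched F C

/-- The pairs (vertex, hexagon containing it): the vertices after the hexagons in `F` have been
pulled apart. -/
abbrev PhenyleneVertex {V : Type*} (F : Set (Set (Sym2 V))) : Type _ :=
  {p : V × Set (Sym2 V) // p.2 ∈ F ∧ p.1 ∈ vertsOf p.2}

/-- The graph obtained by adding a quadrilateral between any two adjacent hexagons in `F`: every
hexagon keeps its edges, and when two hexagons share an edge, the two copies of each end of that
edge are joined. -/
def phenyleneGraph {V : Type*} (F : Set (Set (Sym2 V))) : SimpleGraph (PhenyleneVertex F) where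
  Adj x y :=
    (x.1.2 = y.1.2 ∧ x.1.1 ≠ y.1.1 ∧ s(x.1.1, y.1.1) ∈ x.1.2) ∨
    (x.1.1 = y.1.1 ∧ x.1.2 ≠ y.1.2 ∧ ∃ e ∈ x.1.2 ∩ y.1.2, x.1.1 ∈ e)
  symm := by
    constructor
    rintro x y (⟨h₁, h₂, h₃⟩ | ⟨h₁, h₂, e, he, hx⟩)
    · exact Or.inl ⟨h₁.symm, h₂.symm, by rw [← h₁, Sym2.eq_swap]; exact h₃⟩
    · exact Or.inr ⟨h₁.symm, h₂.symm, e, ⟨he.2, he.1⟩, h₁ ▸ hx⟩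
  loopless := by
    constructor
    rintro x (⟨_, h, _⟩ | ⟨_, h, _⟩) <;> exact h rfl

/-- The boundary of the hexagon `C` after pulling apart. -/
def phenyleneHexagon {V : Type*} (F : Set (Set (Sym2 V))) (C : Set (Sym2 V)) :
    Set (Sym2 (PhenyleneVertex F)) :=
  {e ∈ (phenyleneGraph F).edgeSet | ∀ x ∈ e, x.1.2 = C}

/-- The boundary of the quadrilateral between the adjacent hexagons `C` and `D`. -/
def phenyleneQuadrilateral {V : Type*} (F : Set (Set (Sym2 V))) (C D : Set (Sym2 V)) :
    Set (Sym2 (PhenyleneVertex F)) :=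
  {e ∈ (phenyleneGraph F).edgeSet |
    ∀ x ∈ e, (x.1.2 = C ∨ x.1.2 = D) ∧ x.1.1 ∈ vertsOf (C ∩ D)}

/-- The inner faces of `phenyleneGraph F`: the hexagons and the quadrilaterals. -/
def phenyleneFaces {V : Type*} (F : Set (Set (Sym2 V))) :
    Set (Set (Sym2 (PhenyleneVertex F))) :=
  {B | ∃ C ∈ F, B = phenyleneHexagon F C} ∪
  {B | ∃ C ∈ F, ∃ D ∈ F, C ≠ D ∧ (C ∩ D).Nonempty ∧ B = phenyleneQuadrilateral F C D}

/-- `G`, with `F` as the set of boundaries of its inner faces, is a phenylene: up to isomorphism it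
arises from a catacondensed benzenoid graph with at least two hexagons (its hexagonal squeeze) by
adding quadrilaterals between all pairs of adjacent hexagons. -/
def IsPhenylene {V : Type*} (G : SimpleGraph V) (F : Set (Set (Sym2 V))) : Prop :=
  ∃ (n : ℕ) (B : SimpleGraph (Fin n)) (F₀ : Set (Set (Sym2 (Fin n)))),
    IsCatacondensed B F₀ ∧ 2 ≤ (hexagons B F₀).ncard ∧
    ∃ φ : phenyleneGraph F₀ ≃g G, F = (fun C => Sym2.map φ '' C) '' phenyleneFaces F₀

/-! Both inequalities come from exact formulas. A catacondensed benzenoid graph with `h` hexagons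
arises from one hexagon by attaching the others one at a time along an edge `xy` whose ends have
degree two so far. Benzenoids and phenylenes are bipartite, so the pairs at distance three are the
nonadjacent pairs joined by a walk of length three; attaching a hexagon destroys no such pair, and
the number of new ones depends only on the degrees of the other neighbors `u` of `x` and `v` of `y`.
It is 9, plus one for each of `u`, `v` that already lies on a further hexagon. If `k` denotes the
total of these extra units, the kinks, then the index is `9 h - 6 + k`. For a phenylene a square and
then a hexagon are attached, and the index is `13 h - 10 + k` (`ncard_polarityPairs_hexGraph`,
`ncard_polarityPairs_phenGraph`).

A kink makes some hexagon angular or branched (`kinks_eq_zero`), so a linear chain has `k = 0` and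
is minimal. Conversely `k = 0` forces every hexagon to be attached at the end of a ladder
(`HexSeq.exists_isLadder`), so the graph is determined by `h`; this settles equality and uniqueness.
A phenylene inherits this from its hexagonal squeeze, whose faces are exactly the 6-cycles of the
graph.

The construction by attachment has to be extracted from a rotation system of genus zero. The role of
the Jordan curve theorem is played by homology mod 2: by Euler's formula every 1-cycle bounds a
2-chain of faces (`exists_faceBoundary_eq`). With 2-connectedness this shows that a nonempty set of
inner faces closed under adjacency touches every edge (`mem_or_mem_of_closed`), so the inner faces
can be listed with each one adjacent to a former one. Such a list covers at most `4 h + 2` vertices,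
while counting darts and Euler's formula give at least `4 h + 2`. Equality therefore holds at each
step: a new hexagon meets the former ones in the two ends of a single edge only
(`FaceSeq.exists_hexSeq`).

Existence is shown by an explicit rotation system on the vertices `0, …, 4 h + 1`, numbered along
the boundary; pulling its hexagons apart gives the phenylene. -/

open SimpleGraph

/-! ### Hexagons given by their cyclic sequence of vertices -/

/-- The edges of the closed hexagon `c 0, …, c 5`. -/
def hexEdges {V : Type*} (c : Fin 6 → V) : Set (Sym2 V) :=
  Set.range fun i => s(c i, c (i + 1))

theorem vertsOf_hexEdges {V : Type*} (c : Fin 6 → V) : vertsOf (hexEdges c) = Set.range c := by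
  ext v
  constructor
  · rintro ⟨_, ⟨i, rfl⟩, hv⟩
    rcases Sym2.mem_iff.1 hv with rfl | rfl
    exacts [⟨i, rfl⟩, ⟨i + 1, rfl⟩]
  · rintro ⟨i, rfl⟩
    exact ⟨_, ⟨i, rfl⟩, Sym2.mem_mk_left _ _⟩

theorem isCycleEdges_hexEdges {V : Type*} {G : SimpleGraph V} {c : Fin 6 → V}
    (hc : Function.Injective c) (hG : ∀ i, G.Adj (c i) (c (i + 1))) :
    IsCycleEdges G 6 (hexEdges c) := by
  have hne : ∀ i j : Fin 6, i ≠ j → c i ≠ c j := fun i j h => hc.ne h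
  refine ⟨c 0, .cons (hG 0) (.cons (hG 1) (.cons (hG 2) (.cons (hG 3) (.cons (hG 4)
    (.cons (hG 5) .nil))))), ?_, rfl, ?_⟩
  · simp only [Walk.cons_isCycle_iff, Walk.cons_isPath_iff, Walk.edges_cons, Walk.support_cons,
      Walk.edges_nil, Walk.support_nil, List.mem_cons, List.not_mem_nil, or_false, Sym2.eq_iff,
      hc.eq_iff]
    simp
  · ext e
    simp only [hexEdges, Set.mem_range, Set.mem_ofPred_eq, Walk.edges_cons, Walk.edges_nil,
      List.mem_cons, List.not_mem_nil, or_false]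
    constructor
    · rintro ⟨i, rfl⟩
      fin_cases i <;> simp
    · rintro (h | h | h | h | h | h)
      exacts [⟨0, h.symm⟩, ⟨1, h.symm⟩, ⟨2, h.symm⟩, ⟨3, h.symm⟩, ⟨4, h.symm⟩, ⟨5, h.symm⟩]

theorem IsCycleEdges.exists_hexEdges {V : Type*} {G : SimpleGraph V} {C : Set (Sym2 V)}
    (h : IsCycleEdges G 6 C) : ∃ c : Fin 6 → V, Function.Injective c ∧
      (∀ i, G.Adj (c i) (c (i + 1))) ∧ C = hexEdges c := by
  obtain ⟨v, w, hw, hl, rfl⟩ := h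
  match w, hw, hl with
  | .cons (v := b) h0 (.cons (v := c) h1 (.cons (v := d) h2 (.cons (v := e) h3
      (.cons (v := f) h4 (.cons h5 .nil))))), hw, hl =>
    simp only [Walk.cons_isCycle_iff, Walk.cons_isPath_iff, Walk.edges_cons, Walk.support_cons,
      Walk.edges_nil, Walk.support_nil, List.mem_cons, List.not_mem_nil, or_false] at hw
    refine ⟨![v, b, c, d, e, f], ?_, ?_, ?_⟩
    · intro i j hij
      fin_cases i <;> fin_cases j <;> simp_all
    · intro i
      fin_cases i <;> simpa
    · ext x
      simp only [hexEdges, Set.mem_range, Set.mem_ofPred_eq, Walk.edges_cons, Walk.edges_nil,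
        List.mem_cons, List.not_mem_nil, or_false]
      constructor
      · rintro (h | h | h | h | h | h)
        exacts [⟨0, h.symm⟩, ⟨1, h.symm⟩, ⟨2, h.symm⟩, ⟨3, h.symm⟩, ⟨4, h.symm⟩, ⟨5, h.symm⟩]
      · rintro ⟨i, rfl⟩
        fin_cases i <;> simp

/-! ### Homology of a combinatorial map of genus zero -/

namespace PlaneEmbedding

variable {V : Type*} {G : SimpleGraph V}

/-- The faces of a plane embedding. -/
abbrev Face (P : PlaneEmbedding G) : Type _ :=
  Quotient (Equiv.Perm.SameCycle.setoid (facePerm P.rot))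

/-- The face to the side of a dart. -/
def face (P : PlaneEmbedding G) (d : G.Dart) : P.Face := Quotient.mk _ d

theorem face_eq_iff (P : PlaneEmbedding G) {d e : G.Dart} :
    P.face d = P.face e ↔ (facePerm P.rot).SameCycle d e := Quotient.eq

theorem facePerm_apply (P : PlaneEmbedding G) (d : G.Dart) :
    facePerm P.rot d = P.rot d.symm := rfl

theorem facePerm_fst (P : PlaneEmbedding G) (d : G.Dart) : (facePerm P.rot d).fst = d.snd := by
  rw [facePerm_apply, P.rot_fst]; rfl

theorem face_facePerm (P : PlaneEmbedding G) (d : G.Dart) :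
    P.face (facePerm P.rot d) = P.face d := by
  rw [face_eq_iff, Equiv.Perm.sameCycle_apply_left]

/-- `rot d` follows `d.symm` on its face. So turning at a vertex passes from one side of an edge to
the other. -/
theorem face_rot (P : PlaneEmbedding G) (d : G.Dart) : P.face (P.rot d) = P.face d.symm := by
  rw [← face_facePerm P d.symm, facePerm_apply, Dart.symm_symm]

theorem exists_face_eq (P : PlaneEmbedding G) (f : P.Face) : ∃ d, P.face d = f :=
  Quotient.exists_rep f

/-- A function on faces that agrees on the two sides of each edge is constant. -/
theorem eq_of_forall_symm (P : PlaneEmbedding G) {α : Type*} (a : P.Face → α)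
    (ha : ∀ d : G.Dart, a (P.face d) = a (P.face d.symm)) (f g : P.Face) : a f = a g := by
  -- Consecutive darts of the rotation bound the two sides of one edge, so `a` is constant on the
  -- darts at a vertex; connectedness then spreads the value over the whole graph.
  have hrot : ∀ d e : G.Dart, P.rot.SameCycle d e → a (P.face d) = a (P.face e) := by
    have h1 : ∀ d, a (P.face (P.rot d)) = a (P.face d) := fun d => by rw [face_rot, ← ha]
    rintro d e ⟨i, rfl⟩
    induction i using Int.induction_on with
    | zero => rfl
    | succ n ih => rw [ih, add_comm, zpow_add, zpow_one, Equiv.Perm.mul_apply, h1]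
    | pred n ih =>
      rw [ih, ← h1 ((P.rot ^ (-(n : ℤ) - 1)) d), ← Equiv.Perm.mul_apply, ← zpow_one_add]
      congr 4; ring
  have hv : ∀ d e : G.Dart, d.fst = e.fst → a (P.face d) = a (P.face e) :=
    fun d e h => hrot d e (P.rot_cyclic d e h)
  have key : ∀ u v : V, G.Walk u v → ∀ d e : G.Dart, d.fst = u → e.fst = v →
      a (P.face d) = a (P.face e) := by
    intro u v w
    induction w with
    | nil => intro d e hd he; exact hv d e (hd.trans he.symm)
    | cons h p ih =>
      intro d e hd he
      rw [hv d ⟨(_, _), h⟩ hd, ha]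
      exact ih _ _ rfl he
  obtain ⟨d, rfl⟩ := P.exists_face_eq f
  obtain ⟨e, rfl⟩ := P.exists_face_eq g
  obtain ⟨w⟩ := P.connected.preconnected d.fst e.fst
  exact key _ _ w d e rfl rfl

section Homology

open scoped Classical in
/-- The boundary of a 1-chain with coefficients in `ZMod 2`. -/
noncomputable def edgeBoundary (G : SimpleGraph V) [Fintype V] [Fintype G.edgeSet] :
    (G.edgeSet → ZMod 2) →ₗ[ZMod 2] (V → ZMod 2) where
  toFun z v := ∑ e : G.edgeSet, if v ∈ (e : Sym2 V) then z e else 0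
  map_add' z w := by
    ext v
    simp only [Pi.add_apply, ← Finset.sum_add_distrib]
    exact Finset.sum_congr rfl fun e _ => by split_ifs <;> simp
  map_smul' r z := by
    ext v
    simp [Finset.mul_sum]

open scoped Classical in
/-- The boundary of a 2-chain with coefficients in `ZMod 2`. -/
noncomputable def faceBoundary (P : PlaneEmbedding G) [Fintype G.Dart] :
    (P.Face → ZMod 2) →ₗ[ZMod 2] (G.edgeSet → ZMod 2) where
  toFun a e := ∑ d : G.Dart, if d.edge = (e : Sym2 V) then a (P.face d) else 0
  map_add' z w := by
    ext v
    simp only [Pi.add_apply, ← Finset.sum_add_distrib]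
    exact Finset.sum_congr rfl fun e _ => by split_ifs <;> simp
  map_smul' r z := by
    ext v
    simp [Finset.mul_sum]

theorem faceBoundary_apply (P : PlaneEmbedding G) [Fintype G.Dart] (a : P.Face → ZMod 2)
    (d : G.Dart) :
    P.faceBoundary a ⟨d.edge, d.edge_mem⟩ = a (P.face d) + a (P.face d.symm) := by
  classical
  have hne : d ≠ d.symm := d.symm_ne.symm
  change (∑ d' : G.Dart, if d'.edge = d.edge then a (P.face d') else 0) = _
  rw [← Finset.sum_filter, ← Finset.sum_pair (f := fun d => a (P.face d)) hne]
  refine Finset.sum_congr ?_ fun _ _ => rfl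
  ext d'
  simp [dart_edge_eq_iff]

/-- The face permutation matches the darts ending at a vertex with those starting there and keeps
the face, so every face is counted twice, which is zero mod 2. -/
theorem edgeBoundary_faceBoundary (P : PlaneEmbedding G) [Fintype V] [Fintype G.edgeSet]
    [Fintype G.Dart] (a : P.Face → ZMod 2) : edgeBoundary G (P.faceBoundary a) = 0 := by
  classical
  ext v
  change (∑ e : G.edgeSet, if v ∈ (e : Sym2 V) then
    (∑ d : G.Dart, if d.edge = (e : Sym2 V) then a (P.face d) else 0) else 0) = 0
  have h1 : ∀ e : G.edgeSet, (if v ∈ (e : Sym2 V) then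
      (∑ d : G.Dart, if d.edge = (e : Sym2 V) then a (P.face d) else 0) else 0) =
      ∑ d : G.Dart, if d.edge = (e : Sym2 V) then (if v ∈ d.edge then a (P.face d) else 0)
        else 0 := by
    intro e
    split_ifs with h
    · refine Finset.sum_congr rfl fun d _ => ?_
      split_ifs with h2 h3 <;> simp_all
    · refine (Finset.sum_eq_zero fun d _ => ?_).symm
      split_ifs with h2 h3 <;> simp_all
  simp_rw [h1]
  rw [Finset.sum_comm]
  have h2 : ∀ d : G.Dart, (∑ e : G.edgeSet, if d.edge = (e : Sym2 V) then
      (if v ∈ d.edge then a (P.face d) else 0) else 0) =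
      (if d.fst = v then a (P.face d) else 0) + (if d.snd = v then a (P.face d) else 0) := by
    intro d
    rw [Finset.sum_eq_single ⟨d.edge, d.edge_mem⟩]
    · have := d.fst_ne_snd
      have hm : v ∈ d.edge ↔ v = d.fst ∨ v = d.snd := by
        rw [Dart.edge]; exact Sym2.mem_iff
      simp only [if_true, hm]
      by_cases h : d.fst = v
      · subst h; simp [this.symm]
      · by_cases h' : d.snd = v
        · subst h'; simp [h]
        · simp [h, h', Ne.symm h, Ne.symm h']
    · intro e _ he
      rw [if_neg]
      rintro h; exact he (Subtype.ext h.symm)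
    · simp
  simp_rw [h2]
  rw [Finset.sum_add_distrib]
  have h3 : (∑ d : G.Dart, if d.fst = v then a (P.face d) else 0) =
      ∑ d : G.Dart, if d.snd = v then a (P.face d) else 0 := by
    rw [← Equiv.sum_comp (facePerm P.rot)]
    refine Finset.sum_congr rfl fun d _ => ?_
    rw [facePerm_fst, face_facePerm]
  rw [h3]
  exact CharTwo.add_self_eq_zero _

open scoped Classical in
theorem edgeBoundary_single [Fintype V] [Fintype G.edgeSet] {u v : V} (huv : G.Adj u v) :
    edgeBoundary G (Pi.single ⟨s(u, v), huv⟩ 1) = Pi.single u 1 + Pi.single v 1 := by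
  ext w
  change (∑ e : G.edgeSet, if w ∈ (e : Sym2 V) then
    (Pi.single (⟨s(u, v), huv⟩ : G.edgeSet) 1 : G.edgeSet → ZMod 2) e else 0) = _
  rw [Finset.sum_eq_single ⟨s(u, v), huv⟩]
  · have := huv.ne
    by_cases h : w = u
    · subst h; simp [this]
    · by_cases h' : w = v
      · subst h'; simp [h]
      · simp [h, h']
  · intro e _ he; simp [he]
  · simp

-- Modulo the image of the boundary, the unit vectors at the two ends of an edge agree.
-- Connectedness thus leaves a quotient of dimension at most one.
open scoped Classical in
theorem finrank_range_edgeBoundary (hG : G.Connected) [Fintype V] [Fintype G.edgeSet] :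
    Fintype.card V ≤ Module.finrank (ZMod 2) (LinearMap.range (edgeBoundary G)) + 1 := by
  obtain ⟨v₀⟩ := hG.nonempty
  set R := LinearMap.range (edgeBoundary G) with hR
  let L : Submodule (ZMod 2) (V → ZMod 2) := Submodule.span (ZMod 2) {Pi.single v₀ 1}
  have hadj : ∀ u v, G.Adj u v → (Pi.single u 1 + Pi.single v 1 : V → ZMod 2) ∈ R :=
    fun u v huv => ⟨_, edgeBoundary_single huv⟩
  have htop : R ⊔ L = ⊤ := by
    have hs : ∀ v, (Pi.single v 1 : V → ZMod 2) ∈ R ⊔ L := by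
      have : ∀ u v, G.Walk u v → (Pi.single v 1 : V → ZMod 2) ∈ R ⊔ L →
          (Pi.single u 1 : V → ZMod 2) ∈ R ⊔ L := by
        intro u v w
        induction w with
        | nil => exact id
        | cons h p ih =>
          intro hv
          have := (R ⊔ L).sub_mem (Submodule.mem_sup_left (hadj _ _ h)) (ih hv)
          simpa using this
      intro v
      obtain ⟨w⟩ := hG.preconnected v v₀
      exact this _ _ w (Submodule.mem_sup_right (Submodule.mem_span_singleton_self _))
    rw [eq_top_iff]
    intro f _
    rw [← Finset.univ_sum_single f]
    refine Submodule.sum_mem _ fun i _ => ?_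
    have : (Pi.single i (f i) : V → ZMod 2) = f i • Pi.single i 1 := by
      rw [← Pi.single_smul]; simp
    rw [this]
    exact Submodule.smul_mem _ _ (hs i)
  have h1 := Submodule.finrank_add_le_finrank_add_finrank R L
  rw [htop, finrank_top, Module.finrank_fintype_fun_eq_card] at h1
  have h2 : Module.finrank (ZMod 2) L ≤ 1 := (finrank_span_le_card _).trans (by simp)
  omega

/-- In genus zero every 1-cycle is the boundary of a 2-chain. -/
theorem exists_faceBoundary_eq (P : PlaneEmbedding G) [Fintype V] [Fintype G.edgeSet]
    [Fintype G.Dart] (z : G.edgeSet → ZMod 2) (hz : edgeBoundary G z = 0) :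
    ∃ a, P.faceBoundary a = z := by
  classical
  have hfin : Finite P.Face := inferInstance
  have : Fintype P.Face := Fintype.ofFinite _
  have h1 := LinearMap.finrank_range_add_finrank_ker P.faceBoundary
  have h2 := LinearMap.finrank_range_add_finrank_ker (edgeBoundary G)
  rw [Module.finrank_fintype_fun_eq_card] at h1 h2
  have h3 := finrank_range_edgeBoundary P.connected
  -- A 2-chain without boundary takes the same value on both sides of each edge, hence is constant.
  have h4 : Module.finrank (ZMod 2) (LinearMap.ker P.faceBoundary) ≤ 1 := by
    have : LinearMap.ker P.faceBoundary ≤ Submodule.span (ZMod 2) {fun _ => 1} := by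
      intro a ha
      rw [Submodule.mem_span_singleton]
      refine ⟨a (P.face P.outer), ?_⟩
      ext f
      have := P.eq_of_forall_symm a (fun d => by
        have h := congrFun (LinearMap.mem_ker.1 ha) ⟨d.edge, d.edge_mem⟩
        rw [faceBoundary_apply] at h
        exact CharTwo.add_eq_zero.1 h) f (P.face P.outer)
      simp [this]
    exact (Submodule.finrank_mono this).trans ((finrank_span_le_card _).trans (by simp))
  have h5 := P.euler
  rw [Nat.card_eq_fintype_card, Nat.card_eq_fintype_card, Nat.card_eq_fintype_card] at h5
  have hle : LinearMap.range P.faceBoundary ≤ LinearMap.ker (edgeBoundary G) := by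
    rintro _ ⟨a, rfl⟩
    exact P.edgeBoundary_faceBoundary a
  -- The boundaries have dimension at least `|F| - 1` and the cycles at most `|E| - |V| + 1`;
  -- Euler's formula says that these numbers agree.
  have heq := Submodule.eq_of_le_of_finrank_le hle (by
    have : Fintype.card P.Face = Fintype.card (Quotient (Equiv.Perm.SameCycle.setoid (facePerm P.rot))) := rfl
    omega)
  have : z ∈ LinearMap.range P.faceBoundary := by rw [heq]; exact hz
  exact this

end Homology

end PlaneEmbedding

/-! ### Consequences of 2-connectedness -/

namespace PlaneEmbedding

variable {V : Type*} {G : SimpleGraph V}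

-- The chain is a walk in the graph without `v`, taken mod 2. Repeated edges cancel, so no path has
-- to be chosen.
open scoped Classical in
theorem exists_chain_avoiding [Fintype V] [Fintype G.edgeSet] {v : V}
    (hv : (G.induce {v}ᶜ).Connected) {u w : V} (hu : u ≠ v) (hw : w ≠ v) :
    ∃ z : G.edgeSet → ZMod 2, (∀ e : G.edgeSet, v ∈ (e : Sym2 V) → z e = 0) ∧
      edgeBoundary G z = Pi.single u 1 + Pi.single w 1 := by
  have key : ∀ a b : ({v}ᶜ : Set V), (G.induce {v}ᶜ).Walk a b →
      ∃ z : G.edgeSet → ZMod 2, (∀ e : G.edgeSet, v ∈ (e : Sym2 V) → z e = 0) ∧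
      edgeBoundary G z = Pi.single a.1 1 + Pi.single b.1 1 := by
    intro a b p
    induction p with
    | nil =>
      refine ⟨0, fun _ _ => rfl, ?_⟩
      rw [map_zero]; exact (funext fun _ => CharTwo.add_self_eq_zero (R := ZMod 2) _).symm
    | @cons a b c h p ih =>
      obtain ⟨z, hz, hz'⟩ := ih
      have hab : G.Adj a.1 b.1 := h
      refine ⟨Pi.single ⟨s(a.1, b.1), hab⟩ 1 + z, fun e he => ?_, ?_⟩
      · rw [Pi.add_apply, hz e he, Pi.single_eq_of_ne, add_zero]
        rintro rfl
        rcases Sym2.mem_iff.1 he with h | h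
        exacts [a.2 h.symm, b.2 h.symm]
      · rw [map_add, hz', edgeBoundary_single hab]
        have h2 : (Pi.single b.1 1 + Pi.single b.1 1 : V → ZMod 2) = 0 :=
          funext fun _ => CharTwo.add_self_eq_zero _
        rw [add_assoc, ← add_assoc (Pi.single b.1 1), h2, zero_add]
  obtain ⟨p⟩ := hv.preconnected ⟨u, hu⟩ ⟨w, hw⟩
  exact key _ _ p

theorem dart_edge_eq_iff_of_fst {d e : G.Dart} (h : d.fst = e.fst) : d.edge = e.edge ↔ d = e := by
  rw [dart_edge_eq_iff]
  refine ⟨?_, Or.inl⟩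
  rintro (h' | rfl)
  · exact h'
  · exact absurd h e.snd_ne_fst

theorem exists_dart_of_mem_edge {v : V} {e : Sym2 V} (he : e ∈ G.edgeSet) (hv : v ∈ e) :
    ∃ d : G.Dart, d.fst = v ∧ d.edge = e := by
  obtain ⟨w, rfl⟩ := Sym2.mem_iff_exists.1 hv
  exact ⟨⟨(v, w), he⟩, rfl, rfl⟩

/-- Two edges at `v` lie on a common cycle, which bounds a 2-chain. -/
theorem exists_faces_separating (P : PlaneEmbedding G) [Finite V] {d e : G.Dart}
    (hde : d.fst = e.fst) (hne : d ≠ e) (hv : (G.induce {d.fst}ᶜ).Connected) :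
    ∃ a : P.Face → ZMod 2, a (P.face d) + a (P.face d.symm) = 1 ∧
      a (P.face e) + a (P.face e.symm) = 1 ∧
      ∀ d' : G.Dart, d'.fst = d.fst → d' ≠ d → d' ≠ e →
        a (P.face d') + a (P.face d'.symm) = 0 := by
  classical
  have := Fintype.ofFinite V
  obtain ⟨z, hz, hz'⟩ := exists_chain_avoiding hv (u := d.snd) (w := e.snd) d.snd_ne_fst
    (hde ▸ e.snd_ne_fst)
  set D : G.edgeSet := ⟨d.edge, d.edge_mem⟩ with hD
  set E : G.edgeSet := ⟨e.edge, e.edge_mem⟩ with hE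
  have hDE : D ≠ E := fun h => hne ((dart_edge_eq_iff_of_fst hde).1 (congrArg Subtype.val h))
  have hmem : ∀ d' : G.Dart, d'.fst ∈ d'.edge := fun d' => Sym2.mem_mk_left _ _
  -- The chain `z` avoids the vertex, so adding the edges of `d` and `e` closes it to a cycle using
  -- only these two edges there. The 2-chain `a` plays the part of the interior of that cycle.
  obtain ⟨a, ha⟩ := P.exists_faceBoundary_eq (z + Pi.single D 1 + Pi.single E 1) (by
    have h1 : edgeBoundary G (Pi.single D 1) = Pi.single d.fst 1 + Pi.single d.snd 1 :=
      edgeBoundary_single d.adj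
    have h2 : edgeBoundary G (Pi.single E 1) = Pi.single e.fst 1 + Pi.single e.snd 1 :=
      edgeBoundary_single e.adj
    rw [map_add, map_add, hz', h1, h2, hde]
    generalize (Pi.single e.fst 1 : V → ZMod 2) = x
    generalize (Pi.single d.snd 1 : V → ZMod 2) = y
    generalize (Pi.single e.snd 1 : V → ZMod 2) = t
    have : y + t + (x + y) + (x + t) = (x + x) + (y + y) + (t + t) := by abel
    rw [this]
    ext i
    simp only [Pi.add_apply, CharTwo.add_self_eq_zero, Pi.zero_apply])
  refine ⟨a, ?_, ?_, ?_⟩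
  · rw [← faceBoundary_apply, ha]
    simp [← hD, hz D (hmem d), hDE]
  · rw [← faceBoundary_apply, ha]
    simp [← hE, hz E (hde ▸ hmem e), hDE.symm]
  · intro d' hd' h1 h2
    rw [← faceBoundary_apply, ha]
    have h3 : (⟨d'.edge, d'.edge_mem⟩ : G.edgeSet) ≠ D := fun h =>
      h1 ((dart_edge_eq_iff_of_fst hd').1 (congrArg Subtype.val h))
    have h4 : (⟨d'.edge, d'.edge_mem⟩ : G.edgeSet) ≠ E := fun h =>
      h2 ((dart_edge_eq_iff_of_fst (hd'.trans hde)).1 (congrArg Subtype.val h))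
    simp [h3, h4, hz ⟨d'.edge, d'.edge_mem⟩ (hd' ▸ hmem d')]

/-- The boundary of a 2-chain is a cycle, so it cannot meet a vertex in exactly one edge. -/
theorem sum_at_vertex_eq_zero (P : PlaneEmbedding G) [Finite V] (b : P.Face → ZMod 2)
    (d : G.Dart) (h : ∀ d' : G.Dart, d'.fst = d.fst → d' ≠ d →
      b (P.face d') + b (P.face d'.symm) = 0) : b (P.face d) + b (P.face d.symm) = 0 := by
  classical
  have := Fintype.ofFinite V
  have h0 := congrFun (P.edgeBoundary_faceBoundary b) d.fst
  change (∑ e : G.edgeSet, if d.fst ∈ (e : Sym2 V) then P.faceBoundary b e else 0) = 0 at h0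
  rw [Finset.sum_eq_single ⟨d.edge, d.edge_mem⟩, if_pos (show d.fst ∈ d.edge from Sym2.mem_mk_left _ _),
    faceBoundary_apply] at h0
  · exact h0
  · rintro ⟨e, he⟩ _ hne
    split_ifs with hv
    · obtain ⟨d', hd', rfl⟩ := exists_dart_of_mem_edge he hv
      rw [faceBoundary_apply]
      exact h d' hd' fun h => hne (by subst h; rfl)
    · rfl
  · simp

theorem forall_dart_of_forall_fst (hG : G.Connected) {p : G.Dart → Prop}
    (hsymm : ∀ d, p d → p d.symm) (hfst : ∀ d e : G.Dart, d.fst = e.fst → p d → p e)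
    {d : G.Dart} (hd : p d) (e : G.Dart) : p e := by
  have key : ∀ u v : V, G.Walk u v → ∀ d e : G.Dart, d.fst = u → e.fst = v → p d → p e := by
    intro u v w
    induction w with
    | nil => intro d e hd he; exact hfst d e (hd.trans he.symm)
    | cons h q ih =>
      intro d e hd he hpd
      exact ih _ e rfl he (hsymm _ (hfst d ⟨(_, _), h⟩ hd hpd))
  obtain ⟨w⟩ := hG.preconnected d.fst e.fst
  exact key _ _ w d e rfl rfl hd

/-- In a 2-connected plane graph, a nonempty set of inner faces that is closed under adjacency
covers all edges. -/
theorem mem_or_mem_of_closed (P : PlaneEmbedding G) [Finite V]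
    (hv : ∀ v : V, (G.induce {v}ᶜ).Connected) {Q : Set P.Face} (ho : P.face P.outer ∉ Q)
    (hne : Q.Nonempty) (hQ : ∀ d, P.face d ∈ Q → P.face d.symm ≠ P.face P.outer →
      P.face d.symm ∈ Q) (e : G.Dart) : P.face e ∈ Q ∨ P.face e.symm ∈ Q := by
  classical
  obtain ⟨f, hf⟩ := hne
  obtain ⟨d₀, rfl⟩ := P.exists_face_eq f
  refine forall_dart_of_forall_fst P.connected (p := fun e => P.face e ∈ Q ∨ P.face e.symm ∈ Q)
    (fun d => Or.symm) ?_ (Or.inl hf) e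
  intro d e hde hd
  by_contra he
  have hdne : d ≠ e := by rintro rfl; exact he hd
  obtain ⟨a, ha1, ha2, ha3⟩ := P.exists_faces_separating hde hdne (hv _)
  set o := P.face P.outer with hoo
  -- The chain `a`, normalized to vanish on the outer face and cut off outside `Q`. Since `Q` is
  -- closed, an edge with a side in `Q` has no side outside `Q` other than the outer face, so `b`
  -- has the same boundary as `a` there; at the remaining edges, `e` among them, its boundary is
  -- zero. Thus at the vertex only the edge `d` would be left, which is impossible.
  let b : P.Face → ZMod 2 := fun f => if f ∈ Q then a f + a o else 0
  have hb1 : ∀ d', P.face d' ∈ Q ∨ P.face d'.symm ∈ Q →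
      b (P.face d') + b (P.face d'.symm) = a (P.face d') + a (P.face d'.symm) := by
    have hb : ∀ f, f ∈ Q ∨ f = o → b f = a f + a o := by
      rintro f (h | rfl)
      · simp [b, h]
      · simp [b, ho, CharTwo.add_self_eq_zero]
    intro d' hd'
    have h1 : P.face d' ∈ Q ∨ P.face d' = o := by
      rcases hd' with h | h
      · exact Or.inl h
      · by_contra! h'
        exact h'.1 (by simpa using hQ d'.symm h (by simpa using h'.2))
    have h2 : P.face d'.symm ∈ Q ∨ P.face d'.symm = o := by
      rcases hd' with h | h
      · by_contra! h'
        exact h'.1 (hQ d' h h'.2)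
      · exact Or.inl h
    rw [hb _ h1, hb _ h2, add_add_add_comm, CharTwo.add_self_eq_zero, add_zero]
  have hb2 : ∀ d', ¬ (P.face d' ∈ Q ∨ P.face d'.symm ∈ Q) →
      b (P.face d') + b (P.face d'.symm) = 0 := by
    intro d' hd'
    push Not at hd'
    simp [b, hd'.1, hd'.2]
  have := P.sum_at_vertex_eq_zero b d fun d' hd' hne' => by
    by_cases h : P.face d' ∈ Q ∨ P.face d'.symm ∈ Q
    · rw [hb1 _ h]
      exact ha3 d' hd' hne' (by rintro rfl; exact he h)
    · exact hb2 _ h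
  rw [hb1 d hd, ha1] at this
  exact one_ne_zero this

end PlaneEmbedding

/-- There is a third vertex, and a walk to it that avoids `d.snd` has to leave `d.fst` by another
edge. So no vertex has degree one. -/
theorem IsTwoConnected.exists_ne_dart {V : Type*} {G : SimpleGraph V} (h : IsTwoConnected G)
    (d : G.Dart) : ∃ e : G.Dart, e.fst = d.fst ∧ e ≠ d := by
  classical
  obtain ⟨h3, hG, hv⟩ := h
  have hfin : Finite V := Nat.finite_of_card_ne_zero (by omega)
  have := Fintype.ofFinite V
  rw [Nat.card_eq_fintype_card] at h3
  obtain ⟨w, -, hw⟩ := Finset.exists_mem_notMem_of_card_lt_card (s := {d.fst, d.snd})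
    (t := Finset.univ) (by rw [Finset.card_univ]; exact Finset.card_le_two.trans_lt h3)
  simp only [Finset.mem_insert, Finset.mem_singleton, not_or] at hw
  obtain ⟨p⟩ := (hv d.snd).preconnected ⟨d.fst, d.fst_ne_snd⟩ ⟨w, hw.2⟩
  cases p with
  | nil => exact absurd rfl hw.1
  | @cons _ b _ hab q =>
    have hab' : G.Adj d.fst b.1 := hab
    refine ⟨⟨(d.fst, b.1), hab'⟩, rfl, ?_⟩
    intro h
    exact b.2 (congrArg (fun e : G.Dart => e.snd) h)

namespace PlaneEmbedding

variable {V : Type*} {G : SimpleGraph V}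

/-- If the outer face were the only one, no function on faces could differ on the two sides of an
edge. -/
theorem exists_inner_dart (P : PlaneEmbedding G) (h : IsTwoConnected G) :
    ∃ d, P.face d ≠ P.face P.outer := by
  have hfin : Finite V := Nat.finite_of_card_ne_zero (by have := h.1; omega)
  obtain ⟨e, he, hne⟩ := h.exists_ne_dart P.outer
  obtain ⟨a, ha, -⟩ := P.exists_faces_separating he hne (h.2.2 _)
  by_contra! hall
  rw [hall e, hall e.symm, CharTwo.add_self_eq_zero] at ha
  exact zero_ne_one ha

theorem rot_ne_self (P : PlaneEmbedding G) (h : IsTwoConnected G) (d : G.Dart) : P.rot d ≠ d := by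
  obtain ⟨e, he, hne⟩ := h.exists_ne_dart d
  intro hd
  exact hne ((P.rot_cyclic d e he.symm).eq_of_left hd).symm

end PlaneEmbedding

/-! ### Inner faces of a benzenoid traversed as hexagons -/

theorem hexEdges_add {V : Type*} (c : Fin 6 → V) (i : Fin 6) :
    hexEdges (fun k => c (i + k)) = hexEdges c := by
  ext e
  constructor
  · rintro ⟨k, rfl⟩
    exact ⟨i + k, by simp only [add_assoc]⟩
  · rintro ⟨k, rfl⟩
    exact ⟨k - i, by simp only [← add_assoc, add_sub_cancel]⟩

theorem hexEdges_sub {V : Type*} (c : Fin 6 → V) (i : Fin 6) :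
    hexEdges (fun k => c (i - k)) = hexEdges c := by
  ext e
  constructor
  · rintro ⟨k, rfl⟩
    refine ⟨i - k - 1, ?_⟩
    exact Sym2.eq_iff.2 (Or.inr ⟨by abel_nf, by abel_nf⟩)
  · rintro ⟨k, rfl⟩
    refine ⟨i - k - 1, ?_⟩
    exact Sym2.eq_iff.2 (Or.inr ⟨by abel_nf, by abel_nf⟩)

namespace PlaneEmbedding

variable {V : Type*} {G : SimpleGraph V}

theorem mem_boundary (P : PlaneEmbedding G) {d : G.Dart} {e : Sym2 V} :
    e ∈ P.boundary d ↔ ∃ d', P.face d' = P.face d ∧ d'.edge = e := by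
  simp only [boundary, Set.mem_ofPred_eq, face_eq_iff]
  exact ⟨fun ⟨d', h, h'⟩ => ⟨d', h.symm, h'⟩, fun ⟨d', h, h'⟩ => ⟨d', h.symm, h'⟩⟩

theorem boundary_mem_innerFaces (P : PlaneEmbedding G) {d : G.Dart}
    (hd : P.face d ≠ P.face P.outer) : P.boundary d ∈ P.innerFaces :=
  ⟨d, fun h => hd (P.face_eq_iff.2 h).symm, rfl⟩

/-- The darts of an inner face run once around its boundary hexagon. -/
theorem IsBenzenoid.exists_hexagon {P : PlaneEmbedding G} (hP : P.IsBenzenoid) {d : G.Dart}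
    (hd : P.face d ≠ P.face P.outer) : ∃ c : Fin 6 → V, Function.Injective c ∧
      (∀ k, G.Adj (c k) (c (k + 1))) ∧ d.fst = c 0 ∧ d.snd = c 1 ∧ P.boundary d = hexEdges c ∧
      ∀ d', P.face d' = P.face d ↔ ∃ k, d'.fst = c k ∧ d'.snd = c (k + 1) := by
  have hfin : Finite V := Nat.finite_of_card_ne_zero (by have := hP.twoConnected.1; omega)
  have hfinD : Finite G.Dart := Finite.of_injective _ Dart.toProd_injective
  -- The given numbering of the 6-cycle is shifted, and reversed if `d` runs against it, so that `d`
  -- becomes its first edge.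
  obtain ⟨c, hc, hadj, hbd, h0, h1⟩ : ∃ c : Fin 6 → V, Function.Injective c ∧
      (∀ k, G.Adj (c k) (c (k + 1))) ∧ P.boundary d = hexEdges c ∧ d.fst = c 0 ∧ d.snd = c 1 := by
    obtain ⟨c, hc, hadj, hC⟩ :=
      (hP.face_hexagon _ (P.boundary_mem_innerFaces hd)).exists_hexEdges
    have hmem : d.edge ∈ hexEdges c := hC ▸ P.mem_boundary.2 ⟨d, rfl, rfl⟩
    obtain ⟨i, hi⟩ := hmem
    rcases Sym2.eq_iff.1 hi with ⟨h0, h1⟩ | ⟨h0, h1⟩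
    · refine ⟨fun k => c (i + k), fun j k h => add_left_cancel (hc h), fun k => ?_, ?_, ?_, ?_⟩
      · simpa only [← add_assoc] using hadj (i + k)
      · rw [hexEdges_add, hC]
      · simpa using h0.symm
      · exact h1.symm
    · refine ⟨fun k => c (i + 1 - k), fun j k h => sub_right_injective (hc h), fun k => ?_,
        ?_, ?_, ?_⟩
      · have := (hadj (i - k)).symm
        rwa [show i - k + 1 = i + 1 - k by abel, show i - k = i + 1 - (k + 1) by abel] at this
      · rw [hexEdges_sub, hC]
      · simpa using h1.symm
      · simpa using h0.symm
  -- The next dart starts at `c (k + 1)` and its edge lies on the hexagon, so it goes forward or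
  -- straight back. Going back would mean that the rotation fixes a dart, which needs a vertex of
  -- degree one.
  have hstep : ∀ (d' : G.Dart) (k : Fin 6), P.face d' = P.face d → d'.fst = c k →
      d'.snd = c (k + 1) → (facePerm P.rot d').fst = c (k + 1) ∧
      (facePerm P.rot d').snd = c (k + 1 + 1) := by
    intro d' k hf hk hk1
    have hfst := P.facePerm_fst d'
    refine ⟨hfst.trans hk1, ?_⟩
    have hmem : (facePerm P.rot d').edge ∈ hexEdges c := hbd ▸ P.mem_boundary.2
      ⟨_, (P.face_facePerm d').trans hf, rfl⟩
    obtain ⟨j, hj⟩ := hmem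
    rcases Sym2.eq_iff.1 hj with ⟨h0, h1⟩ | ⟨h0, h1⟩
    · have : j = k + 1 := hc (h0.trans (hfst.trans hk1))
      rw [← this]; exact h1.symm
    · have hjk : j = k := add_right_cancel (hc (h1.trans (hfst.trans hk1)))
      exfalso
      apply P.rot_ne_self hP.twoConnected d'.symm
      rw [← facePerm_apply]
      apply Dart.ext
      apply Prod.ext
      · exact hfst
      · subst hjk; exact h0.symm.trans hk.symm
  have hiter : ∀ n : ℕ, ((facePerm P.rot ^ n) d).fst = c (Fin.ofNat 6 n) ∧
      ((facePerm P.rot ^ n) d).snd = c (Fin.ofNat 6 n + 1) ∧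
      P.face ((facePerm P.rot ^ n) d) = P.face d := by
    intro n
    induction n with
    | zero => exact ⟨h0, h1, rfl⟩
    | succ n ih =>
      rw [pow_succ', Equiv.Perm.mul_apply, show Fin.ofNat 6 (n + 1) = Fin.ofNat 6 n + 1 by
        ext; simp [Fin.ofNat, Fin.val_add]]
      obtain ⟨h2, h3, h4⟩ := ih
      obtain ⟨h5, h6⟩ := hstep _ _ h4 h2 h3
      exact ⟨h5, h6, (P.face_facePerm _).trans h4⟩
  refine ⟨c, hc, hadj, h0, h1, hbd, fun d' => ⟨fun h => ?_, ?_⟩⟩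
  · obtain ⟨n, rfl⟩ := (P.face_eq_iff.1 h.symm).exists_nat_pow_eq
    exact ⟨Fin.ofNat 6 n, (hiter n).1, (hiter n).2.1⟩
  · rintro ⟨k, hk, hk1⟩
    have : (facePerm P.rot ^ (k : ℕ)) d = d' := by
      apply Dart.ext
      apply Prod.ext
      · exact (hiter k).1.trans (by rw [hk, Fin.ofNat_eq_cast, Fin.cast_val_eq_self])
      · exact (hiter k).2.1.trans (by rw [hk1, Fin.ofNat_eq_cast, Fin.cast_val_eq_self])
    rw [← this]; exact (hiter k).2.2

/-- The darts of an inner face run around its hexagon in one direction only. -/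
theorem IsBenzenoid.face_symm_ne {P : PlaneEmbedding G} (hP : P.IsBenzenoid) {d : G.Dart}
    (hd : P.face d ≠ P.face P.outer) : P.face d.symm ≠ P.face d := by
  obtain ⟨c, hc, -, h0, h1, -, h2⟩ := hP.exists_hexagon hd
  intro h
  obtain ⟨k, hk, hk1⟩ := (h2 _).1 h
  have h3 : k = 1 := (hc (h1.symm.trans hk)).symm
  have h4 : k + 1 = 0 := (hc (h0.symm.trans hk1)).symm
  subst h3
  exact absurd h4 (by decide)

/-- Two different faces with the same boundary have each other on the far side of every edge, so by
connectedness there is no third face and one of the two is the outer one. -/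
theorem face_eq_of_boundary_eq (P : PlaneEmbedding G) {d e : G.Dart} (hd : P.face d ≠ P.face P.outer) (he : P.face e ≠ P.face P.outer)
    (h : P.boundary d = P.boundary e) : P.face d = P.face e := by
  by_contra hne
  have h1 : ∀ d e : G.Dart, P.boundary d = P.boundary e → P.face d ≠ P.face e →
      ∀ x, P.face x = P.face d → P.face x.symm = P.face e := by
    intro d e h hne x hx
    obtain ⟨y, hy, hyx⟩ := P.mem_boundary.1 (h ▸ P.mem_boundary.2 ⟨x, hx, rfl⟩)
    rcases dart_edge_eq_iff y x |>.1 hyx with rfl | rfl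
    · exact absurd (hx.symm.trans hy) hne
    · exact hy
  have h2 : ∀ x, (P.face x = P.face d ∨ P.face x = P.face e) →
      (P.face x.symm = P.face d ∨ P.face x.symm = P.face e) := by
    rintro x (hx | hx)
    · exact Or.inr (h1 d e h hne x hx)
    · exact Or.inl (h1 e d h.symm (Ne.symm hne) x hx)
  have := P.eq_of_forall_symm (fun f => f = P.face d ∨ f = P.face e)
    (fun x => propext ⟨h2 x, fun hx => by simpa using h2 x.symm hx⟩) (P.face d) (P.face P.outer)
  have h3 : P.face P.outer = P.face d ∨ P.face P.outer = P.face e := by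
    rw [← this]; exact Or.inl rfl
  rcases h3 with h3 | h3
  exacts [hd h3.symm, he h3.symm]

end PlaneEmbedding

/-! ### Catacondensed systems as sequences of hexagons -/

open scoped Classical in
/-- `1` if `w` lies on a hexagon of `l` other than `c`, and `0` otherwise. -/
noncomputable def sharedCount {V : Type*} (l : List (Fin 6 → V)) (c : Fin 6 → V) (w : V) : ℕ :=
  if ∃ c' ∈ l, c' ≠ c ∧ w ∈ Set.range c' then 1 else 0

/-- `l` is built by attaching one hexagon after the other along a single edge, the new hexagon
sharing nothing but that edge with the former ones; `k` counts the kinks that arise. -/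
inductive HexSeq {V : Type*} : List (Fin 6 → V) → ℕ → Prop
  | single (c : Fin 6 → V) (hc : Function.Injective c) : HexSeq [c] 0
  | cons {l : List (Fin 6 → V)} {k : ℕ} (c d : Fin 6 → V) (i : Fin 6) (hl : HexSeq l k)
      (hcl : c ∈ l) (hd : Function.Injective d) (h0 : d 0 = c i) (h5 : d 5 = c (i + 1))
      (h : ∀ c' ∈ l, ∀ j j', c' j = d j' → c' = c ∧ (j' = 0 ∨ j' = 5)) :
      -- `c (i + 5)` and `c (i + 2)` are the vertices of `c` next to the attaching edge; a kink
      -- arises at each of them that already lies on a hexagon other than `c`. The indices in `h0`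
      -- and `h5` make `c` and `d` traverse the common edge in opposite directions.
      HexSeq (d :: l) (k + sharedCount l c (c (i + 5)) + sharedCount l c (c (i + 2)))

namespace PlaneEmbedding

variable {V : Type*} {G : SimpleGraph V}

/-- `c` runs around the face `f`, which is a hexagon. -/
structure IsParam (P : PlaneEmbedding G) (f : P.Face) (c : Fin 6 → V) : Prop where
  inj : Function.Injective c
  adj : ∀ k, G.Adj (c k) (c (k + 1))
  face_eq : ∀ d, P.face d = f ↔ ∃ k, d.fst = c k ∧ d.snd = c (k + 1)

theorem IsParam.face_mk {P : PlaneEmbedding G} {f : P.Face} {c : Fin 6 → V} (h : P.IsParam f c)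
    (k : Fin 6) : P.face ⟨(c k, c (k + 1)), h.adj k⟩ = f :=
  (h.face_eq _).2 ⟨k, rfl, rfl⟩

theorem IsParam.unique {P : PlaneEmbedding G} {f g : P.Face} {c : Fin 6 → V}
    (h : P.IsParam f c) (h' : P.IsParam g c) : f = g :=
  (h.face_mk 0).symm.trans (h'.face_mk 0)

theorem IsParam.boundary {P : PlaneEmbedding G} {d : G.Dart} {c : Fin 6 → V}
    (h : P.IsParam (P.face d) c) : P.boundary d = hexEdges c := by
  ext e
  rw [mem_boundary]
  constructor
  · rintro ⟨d', h1, rfl⟩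
    obtain ⟨k, hk, hk1⟩ := (h.face_eq d').1 h1
    exact ⟨k, by simp only [← hk, ← hk1]; rfl⟩
  · rintro ⟨k, rfl⟩
    exact ⟨_, h.face_mk k, rfl⟩

theorem IsBenzenoid.exists_isParam {P : PlaneEmbedding G} (hP : P.IsBenzenoid) {d : G.Dart}
    (hd : P.face d ≠ P.face P.outer) :
    ∃ c, P.IsParam (P.face d) c ∧ d.fst = c 0 ∧ d.snd = c 1 := by
  obtain ⟨c, hc, hadj, h0, h1, -, h2⟩ := hP.exists_hexagon hd
  exact ⟨c, ⟨hc, hadj, h2⟩, h0, h1⟩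

/-- The condition that no vertex is shared by three inner faces, in terms of darts. -/
theorem faces_eq_of_three {P : PlaneEmbedding G}
    (hc : ¬ ∃ v, ∃ C₁ ∈ P.innerFaces, ∃ C₂ ∈ P.innerFaces, ∃ C₃ ∈ P.innerFaces,
      C₁ ≠ C₂ ∧ C₁ ≠ C₃ ∧ C₂ ≠ C₃ ∧ v ∈ vertsOf C₁ ∧ v ∈ vertsOf C₂ ∧ v ∈ vertsOf C₃)
    {v : V} {d₁ d₂ d₃ : G.Dart} (h1 : P.face d₁ ≠ P.face P.outer)
    (h2 : P.face d₂ ≠ P.face P.outer) (h3 : P.face d₃ ≠ P.face P.outer)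
    (hv1 : d₁.fst = v) (hv2 : d₂.fst = v) (hv3 : d₃.fst = v) :
    P.face d₁ = P.face d₂ ∨ P.face d₁ = P.face d₃ ∨ P.face d₂ = P.face d₃ := by
  by_contra! hne
  have hm : ∀ d : G.Dart, d.fst = v → v ∈ vertsOf (P.boundary d) := fun d hd =>
    ⟨d.edge, P.mem_boundary.2 ⟨d, rfl, rfl⟩, hd ▸ Sym2.mem_mk_left _ _⟩
  exact hc ⟨v, _, P.boundary_mem_innerFaces h1, _, P.boundary_mem_innerFaces h2, _,
    P.boundary_mem_innerFaces h3, fun h => hne.1 (P.face_eq_of_boundary_eq h1 h2 h),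
    fun h => hne.2.1 (P.face_eq_of_boundary_eq h1 h3 h),
    fun h => hne.2.2 (P.face_eq_of_boundary_eq h2 h3 h), hm _ hv1, hm _ hv2, hm _ hv3⟩

/-- Two different edges at a vertex cannot both lie between two inner faces. -/
theorem IsBenzenoid.eq_of_shared {P : PlaneEmbedding G} (hP : P.IsBenzenoid)
    (hc : ¬ ∃ v, ∃ C₁ ∈ P.innerFaces, ∃ C₂ ∈ P.innerFaces, ∃ C₃ ∈ P.innerFaces,
      C₁ ≠ C₂ ∧ C₁ ≠ C₃ ∧ C₂ ≠ C₃ ∧ v ∈ vertsOf C₁ ∧ v ∈ vertsOf C₂ ∧ v ∈ vertsOf C₃)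
    {d e : G.Dart} (hde : d.fst = e.fst) (hd : P.face d ≠ P.face P.outer)
    (hd' : P.face d.symm ≠ P.face P.outer) (he : P.face e ≠ P.face P.outer)
    (he' : P.face e.symm ≠ P.face P.outer) : d = e := by
  have hrot : ∀ d, P.face (P.rot d) = P.face d.symm := P.face_rot
  have hA : P.face d.symm ≠ P.face d := hP.face_symm_ne hd
  have hB : P.face e.symm ≠ P.face e := hP.face_symm_ne he
  -- Both sides of `d` and both sides of `e` are faces at the same vertex, and at most two inner
  -- faces meet there. So `e` has the same two faces as `d`, and two hexagons share only one edge.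
  have h1 := faces_eq_of_three hc hd (hrot d ▸ hd') he rfl (P.rot_fst d) hde.symm
  have h2 := faces_eq_of_three hc hd (hrot d ▸ hd') (hrot e ▸ he') rfl (P.rot_fst d)
    ((P.rot_fst e).trans hde.symm)
  rw [hrot] at h1 h2
  rw [hrot] at h2
  have hmem : e.edge ∈ P.boundary d ∩ P.boundary d.symm := by
    rcases h1 with h1 | h1 | h1
    · exact absurd h1.symm hA
    · rcases h2 with h2 | h2 | h2
      · exact absurd h2.symm hA
      · exact absurd (h2.symm.trans h1) hB
      · exact ⟨P.mem_boundary.2 ⟨e, h1.symm, rfl⟩,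
          P.mem_boundary.2 ⟨e.symm, h2.symm, e.edge_symm⟩⟩
    · rcases h2 with h2 | h2 | h2
      · exact absurd h2.symm hA
      · exact ⟨P.mem_boundary.2 ⟨e.symm, h2.symm, e.edge_symm⟩,
          P.mem_boundary.2 ⟨e, h1.symm, rfl⟩⟩
      · exact absurd (h2.symm.trans h1) hB
  have hmem' : d.edge ∈ P.boundary d ∩ P.boundary d.symm :=
    ⟨P.mem_boundary.2 ⟨d, rfl, rfl⟩, P.mem_boundary.2 ⟨d.symm, rfl, d.edge_symm⟩⟩
  have h6 := fun x (hx : P.face x ≠ P.face P.outer) =>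
    hP.face_hexagon _ (P.boundary_mem_innerFaces hx)
  rcases hP.pair _ _ (h6 _ hd) (h6 _ hd')
    (fun h => hA (P.face_eq_of_boundary_eq hd hd' h).symm) with h | h
  · exact absurd (⟨d.edge, hmem'.2, Sym2.mem_mk_left _ _⟩ : d.fst ∈ vertsOf (P.boundary d.symm))
      (Set.disjoint_left.1 h ⟨d.edge, hmem'.1, Sym2.mem_mk_left _ _⟩)
  · obtain ⟨x, hx⟩ := Set.ncard_eq_one.1 h
    rw [hx] at hmem hmem'
    exact (dart_edge_eq_iff_of_fst hde).1 (hmem'.trans hmem.symm)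

theorem exists_dart_fst (hG : G.Connected) (d : G.Dart) (v : V) : ∃ e : G.Dart, e.fst = v := by
  by_cases h : v = d.fst
  · exact ⟨d, h.symm⟩
  · have : Nontrivial V := ⟨⟨v, _, h⟩⟩
    obtain ⟨w, hw⟩ := hG.preconnected.exists_adj_of_nontrivial (v := v)
    exact ⟨⟨(v, w), hw⟩, rfl⟩

end PlaneEmbedding

/-! ### Counting vertices and listing the faces of a catacondensed embedding -/

namespace PlaneEmbedding

variable {V : Type*} {G : SimpleGraph V}

/-- Benzenoid, and no vertex on three inner faces. -/
structure IsCata (P : PlaneEmbedding G) : Prop extends P.IsBenzenoid where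
  no_internal : ¬ ∃ v, ∃ C₁ ∈ P.innerFaces, ∃ C₂ ∈ P.innerFaces, ∃ C₃ ∈ P.innerFaces,
      C₁ ≠ C₂ ∧ C₁ ≠ C₃ ∧ C₂ ≠ C₃ ∧ v ∈ vertsOf C₁ ∧ v ∈ vertsOf C₂ ∧ v ∈ vertsOf C₃

theorem IsCata.finite {P : PlaneEmbedding G} (hP : P.IsCata) : Finite V :=
  Nat.finite_of_card_ne_zero (by have := hP.twoConnected.1; omega)

/-- The set of all inner faces is closed under adjacency, so it touches every edge. -/
theorem IsCata.inner_or_inner {P : PlaneEmbedding G} (hP : P.IsCata) (d : G.Dart) :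
    P.face d ≠ P.face P.outer ∨ P.face d.symm ≠ P.face P.outer := by
  have := hP.finite
  obtain ⟨e, he⟩ := P.exists_inner_dart hP.twoConnected
  exact P.mem_or_mem_of_closed hP.twoConnected.2.2 (Q := {f | f ≠ P.face P.outer})
    (fun h => h rfl) ⟨_, he⟩ (fun d _ h => h) d

theorem IsCata.exists_inner_fst {P : PlaneEmbedding G} (hP : P.IsCata) (v : V) :
    ∃ d : G.Dart, d.fst = v ∧ P.face d ≠ P.face P.outer := by
  obtain ⟨e, rfl⟩ := exists_dart_fst P.connected P.outer v
  rcases hP.inner_or_inner e with h | h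
  · exact ⟨e, rfl, h⟩
  · exact ⟨P.rot e, P.rot_fst e, by rwa [face_rot]⟩

-- At most one dart `d` at a vertex has inner faces on both sides, by `eq_of_shared`; if there is
-- one, then `d` and `rot d` both belong to inner faces. Otherwise one dart with an inner face is
-- enough.
open scoped Classical in
theorem IsCata.card_vertex_darts {P : PlaneEmbedding G} (hP : P.IsCata) [Fintype G.Dart] (v : V) :
    (Finset.univ.filter fun d : G.Dart => (P.face d ≠ P.face P.outer ∧
      P.face d.symm ≠ P.face P.outer) ∧ d.fst = v).card + 1 ≤
    (Finset.univ.filter fun d : G.Dart => P.face d ≠ P.face P.outer ∧ d.fst = v).card := by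
  by_cases h : ∃ d : G.Dart, (P.face d ≠ P.face P.outer ∧
      P.face d.symm ≠ P.face P.outer) ∧ d.fst = v
  · obtain ⟨d, ⟨h1, h2⟩, hv⟩ := h
    have hle : (Finset.univ.filter fun d : G.Dart => (P.face d ≠ P.face P.outer ∧
        P.face d.symm ≠ P.face P.outer) ∧ d.fst = v).card ≤ 1 := by
      refine Finset.card_le_one.2 fun a ha b hb => ?_
      simp only [Finset.mem_filter, Finset.mem_univ, true_and] at ha hb
      exact hP.eq_of_shared hP.no_internal (ha.2.trans hb.2.symm) ha.1.1 ha.1.2 hb.1.1 hb.1.2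
    have hlt : 1 < (Finset.univ.filter fun d : G.Dart => P.face d ≠ P.face P.outer ∧
        d.fst = v).card := by
      refine Finset.one_lt_card.2 ⟨d, by simp [h1, hv], P.rot d, ?_, ?_⟩
      · simp only [Finset.mem_filter, Finset.mem_univ, true_and]
        exact ⟨by rwa [face_rot], (P.rot_fst d).trans hv⟩
      · exact (P.rot_ne_self hP.twoConnected d).symm
    omega
  · have h0 : (Finset.univ.filter fun d : G.Dart => (P.face d ≠ P.face P.outer ∧
        P.face d.symm ≠ P.face P.outer) ∧ d.fst = v).card = 0 := by
      rw [Finset.card_eq_zero, Finset.filter_eq_empty_iff]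
      exact fun d _ hd => h ⟨d, hd⟩
    obtain ⟨d, hd, hd'⟩ := hP.exists_inner_fst v
    rw [h0, zero_add, Nat.succ_le_iff, Finset.card_pos]
    exact ⟨d, by simp [hd, hd']⟩

open scoped Classical in
theorem IsParam.card_fiber {P : PlaneEmbedding G} [Fintype G.Dart] {f : P.Face} {c : Fin 6 → V}
    (h : P.IsParam f c) : (Finset.univ.filter fun d : G.Dart => P.face d = f).card = 6 := by
  have h1 : (Finset.univ.filter fun d : G.Dart => P.face d = f) =
      Finset.univ.image fun k => (⟨(c k, c (k + 1)), h.adj k⟩ : G.Dart) := by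
    ext d
    simp only [Finset.mem_filter, Finset.mem_univ, true_and, Finset.mem_image, h.face_eq]
    exact ⟨fun ⟨k, hk, hk1⟩ => ⟨k, Dart.ext _ _ (Prod.ext hk.symm hk1.symm)⟩,
      fun ⟨k, hk⟩ => ⟨k, by rw [← hk], by rw [← hk]⟩⟩
  rw [h1, Finset.card_image_of_injective, Finset.card_univ, Fintype.card_fin]
  intro j k hjk
  exact h.inj (congrArg (fun d : G.Dart => d.fst) hjk)

theorem IsCata.exists_param {P : PlaneEmbedding G} (hP : P.IsCata) {f : P.Face}
    (hf : f ≠ P.face P.outer) : ∃ c, P.IsParam f c := by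
  obtain ⟨d, rfl⟩ := P.exists_face_eq f
  obtain ⟨c, hc, -⟩ := hP.exists_isParam hf
  exact ⟨c, hc⟩

/-- Let `x` be the number of darts with inner faces on both sides. There are `6 h` darts on inner
faces and every edge has an inner side, so `2 |E| = 12 h - x`. Summing `card_vertex_darts` gives `x
+ |V| ≤ 6 h`, and Euler's formula `|E| = |V| + h - 1` then yields the bound. -/
theorem IsCata.card_vertices_ge {P : PlaneEmbedding G} (hP : P.IsCata) {h : ℕ}
    (hh : Nat.card P.Face = h + 1) : 4 * h + 2 ≤ Nat.card V := by
  classical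
  have := hP.finite
  have := Fintype.ofFinite V
  have := Fintype.ofFinite P.Face
  set o := P.face P.outer with ho
  let I : Finset G.Dart := Finset.univ.filter fun d => P.face d ≠ o
  let J : Finset G.Dart := Finset.univ.filter fun d => P.face d.symm ≠ o
  have hI : I.card = 6 * h := by
    rw [Finset.card_eq_sum_card_fiberwise (f := P.face) (t := Finset.univ.erase o)]
    · rw [Finset.sum_congr rfl (g := fun _ => 6), Finset.sum_const, Finset.card_erase_of_mem
        (Finset.mem_univ _), Finset.card_univ, ← Nat.card_eq_fintype_card, hh]
      · simp [mul_comm]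
      · intro f hf
        obtain ⟨c, hc⟩ := hP.exists_param (Finset.ne_of_mem_erase hf)
        rw [← hc.card_fiber]
        congr 1
        ext d
        simp only [I, Finset.mem_filter, Finset.mem_univ, true_and, and_iff_right_iff_imp]
        rintro rfl
        exact Finset.ne_of_mem_erase hf
    · intro d hd
      simpa [I] using hd
  have hJ : J.card = I.card := by
    refine Finset.card_bij (fun d _ => d.symm) ?_ ?_ ?_
    · intro d hd; simpa [I, J] using hd
    · intro d _ e _ h; simpa using congrArg Dart.symm h
    · intro d hd; exact ⟨d.symm, by simpa [I, J] using hd, d.symm_symm⟩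
  have hIJ : (I ∪ J) = Finset.univ := by
    ext d
    simpa [I, J] using hP.inner_or_inner d
  have hE := G.dart_card_eq_twice_card_edges
  rw [← Finset.card_univ, ← hIJ] at hE
  have h1 := Finset.card_union_add_card_inter I J
  have h2 : (I ∩ J).card + Fintype.card V ≤ I.card := by
    rw [Finset.card_eq_sum_card_fiberwise (s := I) (f := fun d => d.fst) (t := Finset.univ)
      (fun _ _ => Finset.mem_coe.2 (Finset.mem_univ _)),
      Finset.card_eq_sum_card_fiberwise (s := I ∩ J) (f := fun d => d.fst) (t := Finset.univ)
      (fun _ _ => Finset.mem_coe.2 (Finset.mem_univ _)), ← Finset.card_univ,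
      Finset.card_eq_sum_ones (Finset.univ : Finset V), ← Finset.sum_add_distrib]
    refine Finset.sum_le_sum fun v _ => ?_
    refine le_of_eq_of_le ?_ ((hP.card_vertex_darts v).trans_eq ?_)
    · congr 2; ext d; simp [I, J, ho]
    · congr 1; ext d; simp [I, ho]
  have h3 := P.euler
  rw [Nat.card_eq_fintype_card (α := G.edgeSet), ← edgeFinset_card] at h3
  have h4 : Nat.card (Quotient (Equiv.Perm.SameCycle.setoid (facePerm P.rot))) = h + 1 := hh
  rw [h4, Nat.card_eq_fintype_card] at h3
  rw [Nat.card_eq_fintype_card]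
  omega

/-- Inner faces, listed so that each one is adjacent to a former one. -/
inductive FaceSeq (P : PlaneEmbedding G) : List P.Face → Prop
  | single (f : P.Face) (hf : f ≠ P.face P.outer) : FaceSeq P [f]
  | cons {l : List P.Face} (e : G.Dart) (hl : FaceSeq P l) (he : P.face e ∉ l)
      (ho : P.face e ≠ P.face P.outer) (hs : P.face e.symm ∈ l) : FaceSeq P (P.face e :: l)

theorem FaceSeq.nodup {P : PlaneEmbedding G} {l : List P.Face} (h : P.FaceSeq l) : l.Nodup := by
  induction h with
  | single f hf => simp
  | cons e hl he ho hs ih => exact List.nodup_cons.2 ⟨he, ih⟩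

theorem FaceSeq.ne_outer {P : PlaneEmbedding G} {l : List P.Face} (h : P.FaceSeq l) :
    ∀ f ∈ l, f ≠ P.face P.outer := by
  induction h with
  | single f hf => simpa
  | cons e hl he ho hs ih => exact List.forall_mem_cons.2 ⟨ho, ih⟩

/-- The vertices on the faces in `l`. -/
def faceVerts (P : PlaneEmbedding G) (l : List P.Face) : Set V :=
  {v | ∃ d : G.Dart, d.fst = v ∧ P.face d ∈ l}

theorem faceVerts_cons (P : PlaneEmbedding G) (f : P.Face) (l : List P.Face) :
    P.faceVerts (f :: l) = P.faceVerts l ∪ P.faceVerts [f] := by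
  ext v
  simp only [faceVerts, List.mem_cons, Set.mem_ofPred_eq, Set.mem_union, List.not_mem_nil,
    or_false]
  constructor
  · rintro ⟨d, h, h' | h'⟩
    exacts [Or.inr ⟨d, h, h'⟩, Or.inl ⟨d, h, h'⟩]
  · rintro (⟨d, h, h'⟩ | ⟨d, h, h'⟩)
    exacts [⟨d, h, Or.inr h'⟩, ⟨d, h, Or.inl h'⟩]

theorem IsParam.faceVerts_eq {P : PlaneEmbedding G} {f : P.Face} {c : Fin 6 → V}
    (h : P.IsParam f c) : P.faceVerts [f] = Set.range c := by
  ext v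
  simp only [faceVerts, List.mem_cons, Set.mem_ofPred_eq, List.not_mem_nil, or_false,
    Set.mem_range]
  constructor
  · rintro ⟨d, rfl, hd⟩
    obtain ⟨k, hk, -⟩ := (h.face_eq d).1 hd
    exact ⟨k, hk.symm⟩
  · rintro ⟨k, rfl⟩
    exact ⟨_, rfl, h.face_mk k⟩

theorem IsParam.ncard_range {P : PlaneEmbedding G} {f : P.Face} {c : Fin 6 → V}
    (h : P.IsParam f c) : (P.faceVerts [f]).ncard = 6 := by
  rw [h.faceVerts_eq, ← Set.image_univ, Set.ncard_image_of_injective _ h.inj, Set.ncard_univ,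
    Nat.card_eq_fintype_card, Fintype.card_fin]

theorem faceVerts_inter_subset (P : PlaneEmbedding G) {l : List P.Face} {e : G.Dart}
    (hs : P.face e.symm ∈ l) :
    {e.fst, e.snd} ⊆ P.faceVerts l ∩ P.faceVerts [P.face e] := by
  intro v hv
  rcases hv with rfl | rfl
  · exact ⟨⟨facePerm P.rot e.symm, P.facePerm_fst _, by rwa [face_facePerm]⟩,
      ⟨e, rfl, by simp⟩⟩
  · exact ⟨⟨e.symm, rfl, hs⟩, ⟨facePerm P.rot e, P.facePerm_fst _, by simp [face_facePerm]⟩⟩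

theorem IsCata.ncard_faceVerts_cons {P : PlaneEmbedding G} (hP : P.IsCata) {l : List P.Face}
    {e : G.Dart} (ho : P.face e ≠ P.face P.outer) :
    (P.faceVerts (P.face e :: l)).ncard + (P.faceVerts l ∩ P.faceVerts [P.face e]).ncard =
      (P.faceVerts l).ncard + 6 := by
  have := hP.finite
  obtain ⟨c, hc⟩ := hP.exists_param ho
  rw [faceVerts_cons, Set.ncard_union_add_ncard_inter, hc.ncard_range]

theorem IsCata.two_le_ncard_inter {P : PlaneEmbedding G} (hP : P.IsCata) {l : List P.Face}
    {e : G.Dart} (hs : P.face e.symm ∈ l) :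
    2 ≤ (P.faceVerts l ∩ P.faceVerts [P.face e]).ncard := by
  have := hP.finite
  rw [← Set.ncard_pair e.fst_ne_snd]
  exact Set.ncard_le_ncard (P.faceVerts_inter_subset hs)

/-- Each new hexagon shares at least the ends of `e` with the former ones, so it contributes at most
four vertices. -/
theorem FaceSeq.ncard_le {P : PlaneEmbedding G} (hP : P.IsCata) {l : List P.Face}
    (h : P.FaceSeq l) : (P.faceVerts l).ncard ≤ 4 * l.length + 2 := by
  induction h with
  | single f hf =>
    obtain ⟨c, hc⟩ := hP.exists_param hf
    rw [hc.ncard_range]; rfl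
  | @cons l e hl he ho hs ih =>
    have h1 := hP.ncard_faceVerts_cons (l := l) ho
    have h2 := hP.two_le_ncard_inter hs
    rw [List.length_cons]
    omega

/-- A list that cannot be extended is closed under adjacency, hence touches the edges of `f`, and
closedness then puts `f` itself into the list. -/
theorem FaceSeq.exists_cons {P : PlaneEmbedding G} (hP : P.IsCata) {l : List P.Face}
    (h : P.FaceSeq l) {f : P.Face} (hf : f ∉ l) (hfo : f ≠ P.face P.outer) :
    ∃ g, P.FaceSeq (g :: l) := by
  have := hP.finite
  by_contra hno
  have hclosed : ∀ d, P.face d ∈ l → P.face d.symm ≠ P.face P.outer → P.face d.symm ∈ l := by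
    intro d hd hd'
    by_contra hdl
    exact hno ⟨_, FaceSeq.cons d.symm h hdl hd' (by simpa using hd)⟩
  have hne : ∃ g, g ∈ l := by
    cases h with
    | single f hf => exact ⟨f, by simp⟩
    | cons e => exact ⟨P.face e, by simp⟩
  obtain ⟨d, rfl⟩ := P.exists_face_eq f
  rcases P.mem_or_mem_of_closed hP.twoConnected.2.2 (Q := {f | f ∈ l})
    (fun h' => h.ne_outer _ h' rfl) hne hclosed d with h' | h'
  · exact hf h'
  · exact hf (by simpa using hclosed d.symm h' (by simpa using hfo))

theorem IsCata.exists_faceSeq {P : PlaneEmbedding G} (hP : P.IsCata) :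
    ∃ l, P.FaceSeq l ∧ ∀ f, f ≠ P.face P.outer → f ∈ l := by
  classical
  have := hP.finite
  have hfin : Finite P.Face := by
    have : Finite G.Dart := Finite.of_injective _ Dart.toProd_injective
    infer_instance
  have := Fintype.ofFinite P.Face
  by_contra! hno
  have key : ∀ n : ℕ, ∃ l, P.FaceSeq l ∧ l.length = n + 1 := by
    intro n
    induction n with
    | zero =>
      obtain ⟨d, hd⟩ := P.exists_inner_dart hP.twoConnected
      exact ⟨_, FaceSeq.single _ hd, rfl⟩
    | succ n ih =>
      obtain ⟨l, hl, hn⟩ := ih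
      obtain ⟨f, hf, hfl⟩ := hno l hl
      obtain ⟨g, hg⟩ := hl.exists_cons hP hfl hf
      exact ⟨_, hg, by rw [List.length_cons, hn]⟩
  obtain ⟨l, hl, hn⟩ := key (Fintype.card P.Face)
  have := hl.nodup.length_le_card
  omega

/-- When the vertex count attains its maximum, every hexagon has contributed exactly four vertices,
so it meets the former ones in the ends of `e` only. These ends also lie on the hexagon across `e`,
and since no vertex is on three faces, on no other former hexagon. The remaining conclusions, a
bijection between numberings and faces, serve the induction. -/
theorem FaceSeq.exists_hexSeq {P : PlaneEmbedding G} (hP : P.IsCata) {l : List P.Face}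
    (h : P.FaceSeq l) (hcard : (P.faceVerts l).ncard = 4 * l.length + 2) :
    ∃ L k, HexSeq L k ∧ L.length = l.length ∧ (∀ c ∈ L, ∃ f ∈ l, P.IsParam f c) ∧
      (∀ f ∈ l, ∃ c ∈ L, P.IsParam f c) ∧
      ∀ c ∈ L, ∀ c' ∈ L, ∀ f, P.IsParam f c → P.IsParam f c' → c = c' := by
  have hfin := hP.finite
  induction h with
  | single f hf =>
    obtain ⟨c, hc⟩ := hP.exists_param hf
    refine ⟨[c], 0, HexSeq.single c hc.inj, rfl, ?_, ?_, ?_⟩ <;> simp [hc]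
  | @cons l e hl he ho hs ih =>
    have h1 := hP.ncard_faceVerts_cons (l := l) ho
    have h2 := hP.two_le_ncard_inter hs
    have h3 := hl.ncard_le hP
    rw [List.length_cons] at hcard
    obtain ⟨L, k, hL, hlen, hLl, hlL, huniq⟩ := ih (by omega)
    have hinter : {e.fst, e.snd} = P.faceVerts l ∩ P.faceVerts [P.face e] :=
      Set.eq_of_subset_of_ncard_le (P.faceVerts_inter_subset hs)
        (by rw [Set.ncard_pair e.fst_ne_snd]; omega)
    -- Starting the numbering at the successor of `e` makes `e` the edge from index 5 to index 0.
    obtain ⟨d, hd, hd0, -⟩ := hP.exists_isParam (d := facePerm P.rot e)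
      (by rwa [face_facePerm])
    rw [face_facePerm] at hd
    rw [facePerm_fst] at hd0
    have hd5 : e.fst = d 5 := by
      obtain ⟨j, hj, hj1⟩ := (hd.face_eq e).1 rfl
      have : j + 1 = 0 := hd.inj (hj1.symm.trans hd0)
      rw [hj]; congr 1; omega
    obtain ⟨c, hcL, hc⟩ := hlL _ hs
    obtain ⟨i, hi, hi1⟩ := (hc.face_eq e.symm).1 rfl
    refine ⟨d :: L, _, HexSeq.cons c d i hL hcL hd.inj (hd0.symm.trans hi) (hd5.symm.trans hi1) ?_,
      by rw [List.length_cons, hlen, List.length_cons], ?_, ?_, ?_⟩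
    · intro c' hc' j j' hj
      obtain ⟨f', hf', hcf'⟩ := hLl c' hc'
      have hv1 : c' j ∈ P.faceVerts l := ⟨_, rfl, by rw [hcf'.face_mk j]; exact hf'⟩
      have hv2 : c' j ∈ P.faceVerts [P.face e] := by
        rw [hd.faceVerts_eq, hj]; exact ⟨j', rfl⟩
      have hv : c' j ∈ ({e.fst, e.snd} : Set V) := hinter ▸ ⟨hv1, hv2⟩
      refine ⟨?_, ?_⟩
      · have hx : ∃ x : G.Dart, x.fst = c' j ∧ P.face x = P.face e.symm := by
          rcases hv with hv | hv
          · exact ⟨facePerm P.rot e.symm, (P.facePerm_fst _).trans hv.symm, P.face_facePerm _⟩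
          · exact ⟨e.symm, hv.symm, rfl⟩
        obtain ⟨x, hx1, hx2⟩ := hx
        have h3 := faces_eq_of_three hP.no_internal (d₁ := ⟨(c' j, c' (j + 1)), hcf'.adj j⟩)
          (d₂ := ⟨(d j', d (j' + 1)), hd.adj j'⟩) (d₃ := x) (v := c' j)
          (by rw [hcf'.face_mk]; exact hl.ne_outer _ hf') (by rwa [hd.face_mk])
          (by rw [hx2]; exact hl.ne_outer _ hs) rfl hj.symm hx1
        rw [hcf'.face_mk, hd.face_mk, hx2] at h3
        rcases h3 with h3 | h3 | h3
        · exact absurd (h3 ▸ hf') he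
        · exact huniq c' hc' c hcL f' hcf' (h3 ▸ hc)
        · exact absurd (h3 ▸ hs) he
      · rw [hj] at hv
        rcases hv with hv | hv
        · exact Or.inr (hd.inj (hv.trans hd5))
        · exact Or.inl (hd.inj (hv.trans hd0))
    · intro c' hc'
      rcases List.mem_cons.1 hc' with rfl | hc'
      · exact ⟨_, List.mem_cons_self, hd⟩
      · obtain ⟨f, hf, hcf⟩ := hLl c' hc'
        exact ⟨f, List.mem_cons_of_mem _ hf, hcf⟩
    · intro f hf
      rcases List.mem_cons.1 hf with rfl | hf
      · exact ⟨_, List.mem_cons_self, hd⟩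
      · obtain ⟨c', hc', hcf⟩ := hlL f hf
        exact ⟨c', List.mem_cons_of_mem _ hc', hcf⟩
    · have hdL : ∀ c' ∈ L, ∀ f, P.IsParam f d → P.IsParam f c' → False := by
        intro c' hc' f hf hf'
        obtain ⟨f', hf'l, hcf'⟩ := hLl c' hc'
        have : f' = P.face e := (hcf'.unique hf').trans (hf.unique hd)
        exact he (this ▸ hf'l)
      intro c' hc' c'' hc'' f h' h''
      rcases List.mem_cons.1 hc' with hd' | hd' <;> rcases List.mem_cons.1 hc'' with hd'' | hd''
      · exact hd'.trans hd''.symm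
      · exact (hdL _ hd'' f (hd' ▸ h') h'').elim
      · exact (hdL _ hd' f (hd'' ▸ h'') h').elim
      · exact huniq c' hd' c'' hd'' f h' h''

end PlaneEmbedding

/-- A catacondensed benzenoid graph is built from its hexagons by successive attachment. -/
theorem IsCatacondensed.exists_hexSeq {V : Type*} {G : SimpleGraph V} {F : Set (Set (Sym2 V))}
    (h : IsCatacondensed G F) : Finite V ∧ F = {C | IsCycleEdges G 6 C} ∧
      ∃ l k, HexSeq l k ∧ F = hexEdges '' {c | c ∈ l} ∧
        (∀ a b, G.Adj a b ↔ ∃ c ∈ l, s(a, b) ∈ hexEdges c) ∧ ∀ v, ∃ c ∈ l, v ∈ Set.range c := by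
  obtain ⟨P, hB, rfl, hno⟩ := h
  have hP : P.IsCata := ⟨hB, hno⟩
  have hfin := hP.finite
  refine ⟨hfin, Set.Subset.antisymm hB.face_hexagon hB.hexagon_face, ?_⟩
  obtain ⟨l, hl, hall⟩ := hP.exists_faceSeq
  have hverts : P.faceVerts l = Set.univ := by
    ext v
    obtain ⟨d, hd, hd'⟩ := hP.exists_inner_fst v
    simp only [Set.mem_univ, iff_true]
    exact ⟨d, hd, hall _ hd'⟩
  have hcardF : Nat.card P.Face = l.length + 1 := by
    classical
    have : Finite G.Dart := Finite.of_injective _ Dart.toProd_injective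
    have := Fintype.ofFinite P.Face
    rw [Nat.card_eq_fintype_card, ← Finset.card_univ,
      ← Finset.card_erase_add_one (Finset.mem_univ (P.face P.outer)),
      ← List.toFinset_card_of_nodup hl.nodup]
    congr 2
    ext f
    simp only [Finset.mem_erase, Finset.mem_univ, and_true, List.mem_toFinset]
    exact ⟨hall f, hl.ne_outer f⟩
  -- The lower bound from Euler's formula and the upper bound from the list coincide.
  have h1 := hP.card_vertices_ge hcardF
  have h2 := hl.ncard_le hP
  have h3 : (P.faceVerts l).ncard = Nat.card V := by rw [hverts, Set.ncard_univ]
  obtain ⟨L, k, hL, -, hLl, hlL, -⟩ := hl.exists_hexSeq hP (by omega)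
  refine ⟨L, k, hL, ?_, ?_, ?_⟩
  · ext C
    constructor
    · rintro ⟨d, hd, rfl⟩
      obtain ⟨c, hc, hcd⟩ := hlL (P.face d)
        (hall _ fun h => hd (P.face_eq_iff.1 h.symm))
      exact ⟨c, hc, hcd.boundary.symm⟩
    · rintro ⟨c, hc, rfl⟩
      obtain ⟨f, hf, hcf⟩ := hLl c hc
      obtain ⟨d, rfl⟩ := P.exists_face_eq f
      rw [← hcf.boundary]
      exact P.boundary_mem_innerFaces (hl.ne_outer _ hf)
  · intro a b
    constructor
    · intro hab
      obtain ⟨d, hd, hdi⟩ : ∃ d : G.Dart, d.edge = s(a, b) ∧ P.face d ≠ P.face P.outer := by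
        rcases hP.inner_or_inner ⟨(a, b), hab⟩ with h | h
        · exact ⟨_, rfl, h⟩
        · exact ⟨_, (Dart.edge_symm _), h⟩
      obtain ⟨c, hc, hcd⟩ := hlL _ (hall _ hdi)
      exact ⟨c, hc, by rw [← hcd.boundary, ← hd]; exact P.mem_boundary.2 ⟨d, rfl, rfl⟩⟩
    · rintro ⟨c, hc, i, hi⟩
      obtain ⟨f, hf, hcf⟩ := hLl c hc
      have := hcf.adj i
      rw [← mem_edgeSet] at this ⊢
      rw [← hi]; exact this
  · intro v
    obtain ⟨d, hd, hd'⟩ := hP.exists_inner_fst v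
    obtain ⟨c, hc, hcd⟩ := hlL _ (hall _ hd')
    obtain ⟨j, hj, -⟩ := (hcd.face_eq d).1 rfl
    exact ⟨c, hc, j, hj.symm.trans hd⟩

/-! ### Pairs at distance three in bipartite graphs -/

/-- The pairs of nonadjacent vertices joined by a walk of length three. -/
def polarityPairs {V : Type*} (G : SimpleGraph V) : Set (Sym2 V) :=
  {p | ∃ u v, p = s(u, v) ∧ ¬ G.Adj u v ∧ ∃ a b, G.Adj u a ∧ G.Adj a b ∧ G.Adj b v}

/-- A walk of length three joins vertices of different colors, so their distance is one or three. -/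
theorem dist_eq_three_iff {V : Type*} {G : SimpleGraph V} {col : V → Bool}
    (hcol : ∀ a b, G.Adj a b → col b = !col a) (u v : V) :
    G.dist u v = 3 ↔ ¬ G.Adj u v ∧ ∃ a b, G.Adj u a ∧ G.Adj a b ∧ G.Adj b v := by
  constructor
  · intro h
    refine ⟨fun h' => by rw [dist_eq_one_iff_adj.2 h'] at h; omega, ?_⟩
    obtain ⟨w, hw⟩ := (Reachable.of_dist_ne_zero (by omega : G.dist u v ≠ 0)).exists_walk_length_eq_dist
    rw [h] at hw
    match w, hw with
    | .cons h0 (.cons h1 (.cons h2 .nil)), _ => exact ⟨_, _, h0, h1, h2⟩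
  · rintro ⟨hn, a, b, h0, h1, h2⟩
    have hle : G.dist u v ≤ 3 := dist_le (.cons h0 (.cons h1 (.cons h2 .nil)))
    have hr : G.Reachable u v := ⟨.cons h0 (.cons h1 (.cons h2 .nil))⟩
    have hc : col v = !col u := by simp [hcol _ _ h2, hcol _ _ h1, hcol _ _ h0]
    obtain ⟨w, hw⟩ := hr.exists_walk_length_eq_dist
    generalize G.dist u v = n at *
    match n, w, hw with
    | 0, .nil, _ => simp at hc
    | 1, .cons h .nil, _ => exact absurd h hn
    | 2, .cons h (.cons h' .nil), _ => simp [hcol _ _ h', hcol _ _ h] at hc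
    | 3, _, _ => rfl
    | n + 4, _, _ => omega

theorem wienerPolarity_eq {V : Type*} {G : SimpleGraph V} {col : V → Bool}
    (hcol : ∀ a b, G.Adj a b → col b = !col a) :
    wienerPolarity G = (polarityPairs G).ncard := by
  simp only [wienerPolarity, polarityPairs, dist_eq_three_iff hcol]

/-- Isolated vertices take part in no pair. This allows all intermediate graphs to live on one fixed
vertex type, on which attaching a hexagon only adds edges. -/
theorem ncard_polarityPairs_of_embedding {V W : Type*} {G : SimpleGraph V} {H : SimpleGraph W}
    {f : V → W} (hf : Function.Injective f) (hadj : ∀ a b, H.Adj (f a) (f b) ↔ G.Adj a b)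
    (hr : ∀ x y, H.Adj x y → x ∈ Set.range f) :
    (polarityPairs H).ncard = (polarityPairs G).ncard := by
  rw [← Set.ncard_image_of_injective (polarityPairs G) (Sym2.map.injective hf)]
  congr 1
  ext p
  constructor
  · rintro ⟨u, v, rfl, hn, a, b, h0, h1, h2⟩
    obtain ⟨u, rfl⟩ := hr _ _ h0
    obtain ⟨a, rfl⟩ := hr _ _ h1
    obtain ⟨b, rfl⟩ := hr _ _ h2
    obtain ⟨v, rfl⟩ := hr _ _ h2.symm
    rw [hadj] at hn h0 h1 h2
    exact ⟨s(u, v), ⟨u, v, rfl, hn, a, b, h0, h1, h2⟩, rfl⟩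
  · rintro ⟨_, ⟨u, v, rfl, hn, a, b, h0, h1, h2⟩, rfl⟩
    exact ⟨f u, f v, rfl, by rwa [hadj], f a, f b, (hadj _ _).2 h0, (hadj _ _).2 h1,
      (hadj _ _).2 h2⟩

/-- `G'` arises from `G` by joining the ends of the edge `xy` by a path through new vertices
`p₁, p₂, p₃, p₄`; in `G` the vertices `x` and `y` have just one more neighbor each. -/
structure HexEar {V : Type*} (G G' : SimpleGraph V) (x y u v p₁ p₂ p₃ p₄ : V) : Prop where
  nx : ∀ z, G.Adj x z ↔ z = y ∨ z = u
  ny : ∀ z, G.Adj y z ↔ z = x ∨ z = v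
  n₁ : ∀ z, ¬ G.Adj z p₁
  n₂ : ∀ z, ¬ G.Adj z p₂
  n₃ : ∀ z, ¬ G.Adj z p₃
  n₄ : ∀ z, ¬ G.Adj z p₄
  nodup : [p₁, p₂, p₃, p₄].Nodup
  adj : ∀ a b, G'.Adj a b ↔ G.Adj a b ∨ s(a, b) = s(x, p₁) ∨ s(a, b) = s(p₁, p₂) ∨
    s(a, b) = s(p₂, p₃) ∨ s(a, b) = s(p₃, p₄) ∨ s(a, b) = s(p₄, y)

/-- Five new pairs are always present: `p₁p₄`, `p₂y`, `p₂u`, `p₃x`, `p₃v`. Besides these, `p₁` is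
paired with `v` and the neighbors of `u` other than `x`, and `p₄` symmetrically. The unions take
into account that `v` may itself be a neighbor of `u`, which happens when the ear is attached to a
square. -/
theorem HexEar.ncard_polarityPairs {V : Type*} [Finite V] {G G' : SimpleGraph V}
    {x y u v p₁ p₂ p₃ p₄ : V} (h : HexEar G G' x y u v p₁ p₂ p₃ p₄)
    (huy : u ≠ y) (hvx : v ≠ x) :
    (polarityPairs G').ncard = (polarityPairs G).ncard + 5 +
      ({z | z ≠ x ∧ G.Adj u z} ∪ {v}).ncard + ({z | z ≠ y ∧ G.Adj v z} ∪ {u}).ncard := by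
  obtain ⟨nx, ny, n1, n2, n3, n4, nodup, adj⟩ := h
  set A := {z | z ≠ x ∧ G.Adj u z} ∪ {v} with hA
  set B := {z | z ≠ y ∧ G.Adj v z} ∪ {u} with hB
  have hxy : G.Adj x y := (nx y).2 (Or.inl rfl)
  have hxu : G.Adj x u := (nx u).2 (Or.inr rfl)
  have hyv : G.Adj y v := (ny v).2 (Or.inr rfl)
  simp only [List.nodup_cons, List.mem_cons, List.not_mem_nil, or_false, not_or, not_false_eq_true,
    List.nodup_nil, and_true] at nodup
  obtain ⟨⟨d12, d13, d14⟩, ⟨d23, d24⟩, d34⟩ := nodup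
  have old : ∀ {a b}, G.Adj a b → a ≠ p₁ ∧ a ≠ p₂ ∧ a ≠ p₃ ∧ a ≠ p₄ := fun {a b} hab =>
    ⟨fun e => n1 b (e ▸ hab.symm), fun e => n2 b (e ▸ hab.symm), fun e => n3 b (e ▸ hab.symm),
      fun e => n4 b (e ▸ hab.symm)⟩
  obtain ⟨x1, x2, x3, x4⟩ := old hxy
  obtain ⟨y1, y2, y3, y4⟩ := old hxy.symm
  obtain ⟨u1, u2, u3, u4⟩ := old hxu.symm
  obtain ⟨v1, v2, v3, v4⟩ := old hyv.symm
  have hxyne := hxy.ne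
  have m1 : ∀ z, G'.Adj p₁ z ↔ z = x ∨ z = p₂ := by
    intro z; rw [adj]; simp only [Sym2.eq_iff]; have := n1 z; have := fun h => n1 z (G.adj_symm h)
    grind
  have m2 : ∀ z, G'.Adj p₂ z ↔ z = p₁ ∨ z = p₃ := by
    intro z; rw [adj]; simp only [Sym2.eq_iff]; have := fun h => n2 z (G.adj_symm h)
    grind
  have m3 : ∀ z, G'.Adj p₃ z ↔ z = p₂ ∨ z = p₄ := by
    intro z; rw [adj]; simp only [Sym2.eq_iff]; have := fun h => n3 z (G.adj_symm h)
    grind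
  have m4 : ∀ z, G'.Adj p₄ z ↔ z = p₃ ∨ z = y := by
    intro z; rw [adj]; simp only [Sym2.eq_iff]; have := fun h => n4 z (G.adj_symm h)
    grind
  have mx : ∀ z, G'.Adj x z ↔ z = y ∨ z = u ∨ z = p₁ := by
    intro z; rw [adj, nx]; simp only [Sym2.eq_iff]; grind
  have my : ∀ z, G'.Adj y z ↔ z = x ∨ z = v ∨ z = p₄ := by
    intro z; rw [adj, ny]; simp only [Sym2.eq_iff]; grind
  have mo : ∀ w z, w ≠ x → w ≠ y → w ≠ p₁ → w ≠ p₂ → w ≠ p₃ → w ≠ p₄ →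
      (G'.Adj w z ↔ G.Adj w z) := by
    intro w z; rw [adj]; simp only [Sym2.eq_iff]; grind
  have mu : ∀ z, G'.Adj u z ↔ G.Adj u z := fun z => mo u z hxu.ne' huy u1 u2 u3 u4
  have mv : ∀ z, G'.Adj v z ↔ G.Adj v z := fun z => mo v z hvx hyv.ne' v1 v2 v3 v4
  let T : Set (V × V) := ({(p₁, p₄), (p₂, y), (p₂, u), (p₃, x), (p₃, v)} : Set (V × V)) ∪
    (Prod.mk p₁ '' A ∪ Prod.mk p₄ '' B)
  have hTmem : ∀ a b, (a, b) ∈ T ↔ (a = p₁ ∧ b = p₄) ∨ (a = p₂ ∧ b = y) ∨ (a = p₂ ∧ b = u) ∨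
      (a = p₃ ∧ b = x) ∨ (a = p₃ ∧ b = v) ∨ (a = p₁ ∧ ((b ≠ x ∧ G.Adj u b) ∨ b = v)) ∨
      (a = p₄ ∧ ((b ≠ y ∧ G.Adj v b) ∨ b = u)) := by
    intro a b
    simp only [T, hA, hB, Set.mem_union, Set.mem_insert_iff, Set.mem_singleton_iff, Prod.mk.injEq,
      Set.mem_image, Set.mem_ofPred_eq]
    grind
  have oldA : ∀ z, (z ≠ x ∧ G.Adj u z) ∨ z = v → z ≠ p₁ ∧ z ≠ p₂ ∧ z ≠ p₃ ∧ z ≠ p₄ := by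
    rintro z (⟨-, h⟩ | rfl)
    exacts [old h.symm, ⟨v1, v2, v3, v4⟩]
  have oldB : ∀ z, (z ≠ y ∧ G.Adj v z) ∨ z = u → z ≠ p₁ ∧ z ≠ p₂ ∧ z ≠ p₃ ∧ z ≠ p₄ := by
    rintro z (⟨-, h⟩ | rfl)
    exacts [old h.symm, ⟨u1, u2, u3, u4⟩]
  have hT : T.ncard = 5 + A.ncard + B.ncard := by
    have i1 : Function.Injective (Prod.mk p₁ : V → V × V) := fun a b h => (Prod.mk.inj h).2
    have i4 : Function.Injective (Prod.mk p₄ : V → V × V) := fun a b h => (Prod.mk.inj h).2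
    rw [Set.ncard_union_eq, Set.ncard_union_eq, Set.ncard_image_of_injective _ i1,
      Set.ncard_image_of_injective _ i4, add_assoc]
    · congr 1
      rw [Set.ncard_insert_of_notMem, Set.ncard_insert_of_notMem, Set.ncard_insert_of_notMem,
        Set.ncard_pair]
      all_goals simp only [Set.mem_insert_iff, Set.mem_singleton_iff, Prod.mk.injEq, ne_eq]
      all_goals grind
    · rw [Set.disjoint_left]
      rintro _ ⟨a, _, rfl⟩ ⟨b, _, h⟩
      exact d14 (congrArg Prod.fst h).symm
    · rw [Set.disjoint_left]
      rintro ⟨a, b⟩ h1 h2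
      simp only [Set.mem_insert_iff, Set.mem_singleton_iff, Prod.mk.injEq] at h1
      rcases h2 with ⟨z, hz, h⟩ | ⟨z, hz, h⟩
      · have := oldA z hz
        rw [Prod.mk.injEq] at h
        grind
      · have := oldB z hz
        rw [Prod.mk.injEq] at h
        grind
  have hinj : Set.InjOn (fun q : V × V => s(q.1, q.2)) T := by
    rintro ⟨a, b⟩ hab ⟨c, d⟩ hcd heq
    simp only [Sym2.eq_iff] at heq
    rcases heq with ⟨rfl, rfl⟩ | ⟨rfl, rfl⟩
    · rfl
    · rw [hTmem] at hab hcd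
      have h1 := oldA a
      have h2 := oldB a
      have h3 := oldA b
      have h4 := oldB b
      exfalso
      grind
  have key : ∀ s a b t, (s = p₁ ∨ s = p₂ ∨ s = p₃ ∨ s = p₄) → ¬ G'.Adj s t → G'.Adj s a →
      G'.Adj a b → G'.Adj b t → (s, t) ∈ T ∨ (t, s) ∈ T := by
    intro s a b t hs hst h0 h1 h2
    rw [hTmem, hTmem]
    rcases hs with rfl | rfl | rfl | rfl
    · rw [m1] at h0 hst
      rcases h0 with rfl | rfl
      · rw [mx] at h1
        rcases h1 with rfl | rfl | rfl
        · rw [my] at h2; grind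
        · rw [mu] at h2; grind
        · rw [m1] at h2; grind
      · rw [m2] at h1
        rcases h1 with rfl | rfl
        · rw [m1] at h2; grind
        · rw [m3] at h2; grind
    · rw [m2] at h0 hst
      rcases h0 with rfl | rfl
      · rw [m1] at h1
        rcases h1 with rfl | rfl
        · rw [mx] at h2; grind
        · rw [m2] at h2; grind
      · rw [m3] at h1
        rcases h1 with rfl | rfl
        · rw [m2] at h2; grind
        · rw [m4] at h2; grind
    · rw [m3] at h0 hst
      rcases h0 with rfl | rfl
      · rw [m2] at h1
        rcases h1 with rfl | rfl
        · rw [m1] at h2; grind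
        · rw [m3] at h2; grind
      · rw [m4] at h1
        rcases h1 with rfl | rfl
        · rw [m3] at h2; grind
        · rw [my] at h2; grind
    · rw [m4] at h0 hst
      rcases h0 with rfl | rfl
      · rw [m3] at h1
        rcases h1 with rfl | rfl
        · rw [m2] at h2; grind
        · rw [m4] at h2; grind
      · rw [my] at h1
        rcases h1 with rfl | rfl | rfl
        · rw [mx] at h2; grind
        · rw [mv] at h2; grind
        · rw [m4] at h2; grind
  have hEq : polarityPairs G' = polarityPairs G ∪ (fun q : V × V => s(q.1, q.2)) '' T := by
    ext p
    constructor
    · rintro ⟨s, t, rfl, hst, a, b, h0, h1, h2⟩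
      by_cases hs : s = p₁ ∨ s = p₂ ∨ s = p₃ ∨ s = p₄
      · rcases key s a b t hs hst h0 h1 h2 with h | h
        exacts [Or.inr ⟨_, h, rfl⟩, Or.inr ⟨_, h, Sym2.eq_swap⟩]
      by_cases ht : t = p₁ ∨ t = p₂ ∨ t = p₃ ∨ t = p₄
      · rcases key t b a s ht (fun h => hst h.symm) h2.symm h1.symm h0.symm with h | h
        exacts [Or.inr ⟨_, h, Sym2.eq_swap⟩, Or.inr ⟨_, h, rfl⟩]
      left
      have hst' : ¬ G.Adj s t := fun h => hst ((adj _ _).2 (Or.inl h))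
      -- A walk of length three between old vertices is too short to run through the ear. It could
      -- only step into it and back, and then its ends would be adjacent.
      have back : ∀ s a b t, ¬ (s = p₁ ∨ s = p₂ ∨ s = p₃ ∨ s = p₄) →
          ¬ (t = p₁ ∨ t = p₂ ∨ t = p₃ ∨ t = p₄) → ¬ G'.Adj s t → G'.Adj s a →
          G'.Adj a b → G'.Adj b t → ¬ (a = p₁ ∨ a = p₂ ∨ a = p₃ ∨ a = p₄) := by
        intro s a b t hs ht hst h0 h1 h2 ha
        have h0' := h0.symm
        rcases ha with rfl | rfl | rfl | rfl
        · rw [m1] at h0' h1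
          rcases h1 with rfl | rfl
          · grind
          · rw [m2] at h2; grind
        · rw [m2] at h0'; grind
        · rw [m3] at h0'; grind
        · rw [m4] at h0' h1
          rcases h1 with rfl | rfl
          · rw [m3] at h2; grind
          · grind
      have ha := back s a b t hs ht hst h0 h1 h2
      have hb := back t b a s ht hs (fun h => hst h.symm) h2.symm h1.symm h0.symm
      have down : ∀ a b, ¬ (a = p₁ ∨ a = p₂ ∨ a = p₃ ∨ a = p₄) →
          ¬ (b = p₁ ∨ b = p₂ ∨ b = p₃ ∨ b = p₄) → G'.Adj a b → G.Adj a b := by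
        intro a b ha hb hab
        rw [adj] at hab
        simp only [Sym2.eq_iff] at hab
        grind
      exact ⟨s, t, rfl, hst', a, b, down _ _ hs ha h0, down _ _ ha hb h1, down _ _ hb ht h2⟩
    · rintro (⟨s, t, rfl, hst, a, b, h0, h1, h2⟩ | ⟨⟨s, t⟩, hst, rfl⟩)
      · refine ⟨s, t, rfl, ?_, a, b, (adj _ _).2 (Or.inl h0), (adj _ _).2 (Or.inl h1),
          (adj _ _).2 (Or.inl h2)⟩
        rw [adj]
        have := old h0
        have := old h2.symm
        simp only [Sym2.eq_iff]
        grind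
      · rw [hTmem] at hst
        rcases hst with ⟨rfl, rfl⟩ | ⟨rfl, rfl⟩ | ⟨rfl, rfl⟩ | ⟨rfl, rfl⟩ | ⟨rfl, rfl⟩ | ⟨rfl, h⟩ |
          ⟨rfl, h⟩
        · refine ⟨_, _, rfl, ?_, p₂, p₃, (m1 _).2 (Or.inr rfl), (m2 _).2 (Or.inr rfl),
            (m3 _).2 (Or.inr rfl)⟩
          rw [m1]; grind
        · refine ⟨_, _, rfl, ?_, p₁, x, (m2 _).2 (Or.inl rfl), (m1 _).2 (Or.inl rfl),
            (mx _).2 (Or.inl rfl)⟩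
          rw [m2]; grind
        · refine ⟨_, _, rfl, ?_, p₁, x, (m2 _).2 (Or.inl rfl), (m1 _).2 (Or.inl rfl),
            (mx _).2 (Or.inr (Or.inl rfl))⟩
          rw [m2]; grind
        · refine ⟨_, _, rfl, ?_, p₄, y, (m3 _).2 (Or.inr rfl), (m4 _).2 (Or.inr rfl),
            (my _).2 (Or.inl rfl)⟩
          rw [m3]; grind
        · refine ⟨_, _, rfl, ?_, p₄, y, (m3 _).2 (Or.inr rfl), (m4 _).2 (Or.inr rfl),
            (my _).2 (Or.inr (Or.inl rfl))⟩
          rw [m3]; grind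
        · have h' := oldA t h
          rcases h with ⟨hx, h⟩ | rfl
          · refine ⟨_, _, rfl, ?_, x, u, (m1 _).2 (Or.inl rfl), (mx _).2 (Or.inr (Or.inl rfl)),
              (mu _).2 h⟩
            rw [m1]; grind
          · refine ⟨_, _, rfl, ?_, x, y, (m1 _).2 (Or.inl rfl), (mx _).2 (Or.inl rfl),
              (my _).2 (Or.inr (Or.inl rfl))⟩
            rw [m1]; grind
        · have h' := oldB t h
          rcases h with ⟨hx, h⟩ | rfl
          · refine ⟨_, _, rfl, ?_, y, v, (m4 _).2 (Or.inr rfl), (my _).2 (Or.inr (Or.inl rfl)),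
              (mv _).2 h⟩
            rw [m4]; grind
          · refine ⟨_, _, rfl, ?_, y, x, (m4 _).2 (Or.inr rfl), (my _).2 (Or.inl rfl),
              (mx _).2 (Or.inr (Or.inl rfl))⟩
            rw [m4]; grind
  rw [hEq, Set.ncard_union_eq, hinj.ncard_image, hT]
  · ring
  · rw [Set.disjoint_left]
    rintro _ ⟨s, t, rfl, -, a, b, h0, -, h2⟩ ⟨⟨c, d⟩, hcd, heq⟩
    have o1 := old h0
    have o2 := old h2.symm
    rw [hTmem] at hcd
    simp only [Sym2.eq_iff] at heq
    grind

/-- `G'` arises from `G` by joining the ends of the edge `xy` by a path through new vertices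
`p, q`; in `G` the vertices `x` and `y` have just one more neighbor each. -/
structure SquareEar {V : Type*} (G G' : SimpleGraph V) (x y u v p q : V) : Prop where
  nx : ∀ z, G.Adj x z ↔ z = y ∨ z = u
  ny : ∀ z, G.Adj y z ↔ z = x ∨ z = v
  np : ∀ z, ¬ G.Adj z p
  nq : ∀ z, ¬ G.Adj z q
  ne : p ≠ q
  adj : ∀ a b, G'.Adj a b ↔ G.Adj a b ∨ s(a, b) = s(x, p) ∨ s(a, b) = s(p, q) ∨
    s(a, b) = s(q, y)

/-- The path through `p` and `q` joins the adjacent vertices `x` and `y`, so no old pair is gained.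
The new vertex `p` is paired with `v` and the neighbors of `u` other than `x`, and `q`
symmetrically; within the square no pair arises. -/
theorem SquareEar.ncard_polarityPairs {V : Type*} [Finite V] {G G' : SimpleGraph V}
    {x y u v p q : V} (h : SquareEar G G' x y u v p q) (huy : u ≠ y) (hvx : v ≠ x) (huv : u ≠ v) :
    (polarityPairs G').ncard = (polarityPairs G).ncard +
      ({z | z ≠ x ∧ G.Adj u z} ∪ {v}).ncard + ({z | z ≠ y ∧ G.Adj v z} ∪ {u}).ncard := by
  obtain ⟨nx, ny, np, nq, ne, adj⟩ := h
  set A := {z | z ≠ x ∧ G.Adj u z} ∪ {v} with hA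
  set B := {z | z ≠ y ∧ G.Adj v z} ∪ {u} with hB
  have hxy : G.Adj x y := (nx y).2 (Or.inl rfl)
  have hxu : G.Adj x u := (nx u).2 (Or.inr rfl)
  have hyv : G.Adj y v := (ny v).2 (Or.inr rfl)
  have old : ∀ {a b}, G.Adj a b → a ≠ p ∧ a ≠ q := fun {a b} hab =>
    ⟨fun e => np b (e ▸ hab.symm), fun e => nq b (e ▸ hab.symm)⟩
  obtain ⟨x1, x2⟩ := old hxy
  obtain ⟨y1, y2⟩ := old hxy.symm
  obtain ⟨u1, u2⟩ := old hxu.symm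
  obtain ⟨v1, v2⟩ := old hyv.symm
  have hxyne := hxy.ne
  have m1 : ∀ z, G'.Adj p z ↔ z = x ∨ z = q := by
    intro z; rw [adj]; simp only [Sym2.eq_iff]; have := fun h => np z (G.adj_symm h)
    grind
  have m2 : ∀ z, G'.Adj q z ↔ z = p ∨ z = y := by
    intro z; rw [adj]; simp only [Sym2.eq_iff]; have := fun h => nq z (G.adj_symm h)
    grind
  have mx : ∀ z, G'.Adj x z ↔ z = y ∨ z = u ∨ z = p := by
    intro z; rw [adj, nx]; simp only [Sym2.eq_iff]; grind
  have my : ∀ z, G'.Adj y z ↔ z = x ∨ z = v ∨ z = q := by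
    intro z; rw [adj, ny]; simp only [Sym2.eq_iff]; grind
  have mo : ∀ w z, w ≠ x → w ≠ y → w ≠ p → w ≠ q → (G'.Adj w z ↔ G.Adj w z) := by
    intro w z; rw [adj]; simp only [Sym2.eq_iff]; grind
  have mu : ∀ z, G'.Adj u z ↔ G.Adj u z := fun z => mo u z hxu.ne' huy u1 u2
  have mv : ∀ z, G'.Adj v z ↔ G.Adj v z := fun z => mo v z hvx hyv.ne' v1 v2
  let T : Set (V × V) := Prod.mk p '' A ∪ Prod.mk q '' B
  have hTmem : ∀ a b, (a, b) ∈ T ↔ (a = p ∧ ((b ≠ x ∧ G.Adj u b) ∨ b = v)) ∨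
      (a = q ∧ ((b ≠ y ∧ G.Adj v b) ∨ b = u)) := by
    intro a b
    simp only [T, hA, hB, Set.mem_union, Set.mem_singleton_iff, Prod.mk.injEq,
      Set.mem_image, Set.mem_ofPred_eq]
    grind
  have oldA : ∀ z, (z ≠ x ∧ G.Adj u z) ∨ z = v → z ≠ p ∧ z ≠ q := by
    rintro z (⟨-, h⟩ | rfl)
    exacts [old h.symm, ⟨v1, v2⟩]
  have oldB : ∀ z, (z ≠ y ∧ G.Adj v z) ∨ z = u → z ≠ p ∧ z ≠ q := by
    rintro z (⟨-, h⟩ | rfl)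
    exacts [old h.symm, ⟨u1, u2⟩]
  have hT : T.ncard = A.ncard + B.ncard := by
    have i1 : Function.Injective (Prod.mk p : V → V × V) := fun a b h => (Prod.mk.inj h).2
    have i4 : Function.Injective (Prod.mk q : V → V × V) := fun a b h => (Prod.mk.inj h).2
    rw [Set.ncard_union_eq, Set.ncard_image_of_injective _ i1, Set.ncard_image_of_injective _ i4]
    rw [Set.disjoint_left]
    rintro _ ⟨a, _, rfl⟩ ⟨b, _, h⟩
    exact ne (congrArg Prod.fst h).symm
  have hinj : Set.InjOn (fun q : V × V => s(q.1, q.2)) T := by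
    rintro ⟨a, b⟩ hab ⟨c, d⟩ hcd heq
    simp only [Sym2.eq_iff] at heq
    rcases heq with ⟨rfl, rfl⟩ | ⟨rfl, rfl⟩
    · rfl
    · rw [hTmem] at hab hcd
      have h1 := oldA a
      have h2 := oldB a
      have h3 := oldA b
      have h4 := oldB b
      exfalso
      grind
  have key : ∀ s a b t, (s = p ∨ s = q) → ¬ G'.Adj s t → G'.Adj s a →
      G'.Adj a b → G'.Adj b t → (s, t) ∈ T ∨ (t, s) ∈ T := by
    intro s a b t hs hst h0 h1 h2
    rw [hTmem, hTmem]
    rcases hs with rfl | rfl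
    · rw [m1] at h0 hst
      rcases h0 with rfl | rfl
      · rw [mx] at h1
        rcases h1 with rfl | rfl | rfl
        · rw [my] at h2; grind
        · rw [mu] at h2; grind
        · rw [m1] at h2; grind
      · rw [m2] at h1
        rcases h1 with rfl | rfl
        · rw [m1] at h2; grind
        · rw [my] at h2; grind
    · rw [m2] at h0 hst
      rcases h0 with rfl | rfl
      · rw [m1] at h1
        rcases h1 with rfl | rfl
        · rw [mx] at h2; grind
        · rw [m2] at h2; grind
      · rw [my] at h1
        rcases h1 with rfl | rfl | rfl
        · rw [mx] at h2; grind
        · rw [mv] at h2; grind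
        · rw [m2] at h2; grind
  have hEq : polarityPairs G' = polarityPairs G ∪ (fun q : V × V => s(q.1, q.2)) '' T := by
    ext r
    constructor
    · rintro ⟨s, t, rfl, hst, a, b, h0, h1, h2⟩
      by_cases hs : s = p ∨ s = q
      · rcases key s a b t hs hst h0 h1 h2 with h | h
        exacts [Or.inr ⟨_, h, rfl⟩, Or.inr ⟨_, h, Sym2.eq_swap⟩]
      by_cases ht : t = p ∨ t = q
      · rcases key t b a s ht (fun h => hst h.symm) h2.symm h1.symm h0.symm with h | h
        exacts [Or.inr ⟨_, h, Sym2.eq_swap⟩, Or.inr ⟨_, h, rfl⟩]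
      left
      have hst' : ¬ G.Adj s t := fun h => hst ((adj _ _).2 (Or.inl h))
      have back : ∀ s a b t, ¬ (s = p ∨ s = q) → ¬ (t = p ∨ t = q) → ¬ G'.Adj s t →
          G'.Adj s a → G'.Adj a b → G'.Adj b t → ¬ (a = p ∨ a = q) := by
        intro s a b t hs ht hst h0 h1 h2 ha
        have h0' := h0.symm
        rcases ha with rfl | rfl
        · rw [m1] at h0' h1
          rcases h1 with rfl | rfl
          · grind
          · rw [m2] at h2
            rcases h0' with rfl | rfl
            · rw [mx] at hst; grind
            · grind
        · rw [m2] at h0' h1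
          rcases h1 with rfl | rfl
          · rw [m1] at h2
            rcases h0' with rfl | rfl
            · grind
            · rw [my] at hst; grind
          · grind
      have ha := back s a b t hs ht hst h0 h1 h2
      have hb := back t b a s ht hs (fun h => hst h.symm) h2.symm h1.symm h0.symm
      have down : ∀ a b, ¬ (a = p ∨ a = q) → ¬ (b = p ∨ b = q) → G'.Adj a b → G.Adj a b := by
        intro a b ha hb hab
        rw [adj] at hab
        simp only [Sym2.eq_iff] at hab
        grind
      exact ⟨s, t, rfl, hst', a, b, down _ _ hs ha h0, down _ _ ha hb h1, down _ _ hb ht h2⟩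
    · rintro (⟨s, t, rfl, hst, a, b, h0, h1, h2⟩ | ⟨⟨s, t⟩, hst, rfl⟩)
      · refine ⟨s, t, rfl, ?_, a, b, (adj _ _).2 (Or.inl h0), (adj _ _).2 (Or.inl h1),
          (adj _ _).2 (Or.inl h2)⟩
        rw [adj]
        have := old h0
        have := old h2.symm
        simp only [Sym2.eq_iff]
        grind
      · rw [hTmem] at hst
        rcases hst with ⟨rfl, h⟩ | ⟨rfl, h⟩
        · have h' := oldA t h
          rcases h with ⟨hx, h⟩ | rfl
          · refine ⟨_, _, rfl, ?_, x, u, (m1 _).2 (Or.inl rfl), (mx _).2 (Or.inr (Or.inl rfl)),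
              (mu _).2 h⟩
            rw [m1]; grind
          · refine ⟨_, _, rfl, ?_, x, y, (m1 _).2 (Or.inl rfl), (mx _).2 (Or.inl rfl),
              (my _).2 (Or.inr (Or.inl rfl))⟩
            rw [m1]; grind
        · have h' := oldB t h
          rcases h with ⟨hx, h⟩ | rfl
          · refine ⟨_, _, rfl, ?_, y, v, (m2 _).2 (Or.inr rfl), (my _).2 (Or.inr (Or.inl rfl)),
              (mv _).2 h⟩
            rw [m2]; grind
          · refine ⟨_, _, rfl, ?_, y, x, (m2 _).2 (Or.inr rfl), (my _).2 (Or.inl rfl),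
              (mx _).2 (Or.inr (Or.inl rfl))⟩
            rw [m2]; grind
  rw [hEq, Set.ncard_union_eq, hinj.ncard_image, hT]
  · ring
  · rw [Set.disjoint_left]
    rintro _ ⟨s, t, rfl, -, a, b, h0, -, h2⟩ ⟨⟨c, d⟩, hcd, heq⟩
    have o1 := old h0
    have o2 := old h2.symm
    rw [hTmem] at hcd
    simp only [Sym2.eq_iff] at heq
    grind

/-! ### Combinatorics of hexagon sequences -/

namespace HexSeq

variable {V : Type*} {l : List (Fin 6 → V)} {k : ℕ}

theorem injective (h : HexSeq l k) : ∀ c ∈ l, Function.Injective c := by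
  induction h with
  | single c hc => simpa
  | cons c d i hl hcl hd h0 h5 h ih => exact List.forall_mem_cons.2 ⟨hd, ih⟩

theorem notMem_of_attach {d : Fin 6 → V} {c : Fin 6 → V}
    (h : ∀ c' ∈ l, ∀ j j', c' j = d j' → c' = c ∧ (j' = 0 ∨ j' = 5)) : d ∉ l := fun hd => by
  have := (h d hd 1 1 rfl).2
  revert this; decide

theorem length_pos (h : HexSeq l k) : 0 < l.length := by
  cases h <;> simp

theorem nodup (h : HexSeq l k) : l.Nodup := by
  induction h with
  | single c hc => simp
  | cons c d i hl hcl hd h0 h5 h ih => exact List.nodup_cons.2 ⟨notMem_of_attach h, ih⟩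

/-- Two hexagons with a common vertex share exactly one edge, traversed in opposite directions. -/
theorem shared (h : HexSeq l k) : ∀ c ∈ l, ∀ c' ∈ l, c ≠ c' → ∀ j j', c j = c' j' →
    ∃ i i', c i = c' (i' + 1) ∧ c (i + 1) = c' i' ∧
      ∀ j j', c j = c' j' → j = i ∧ j' = i' + 1 ∨ j = i + 1 ∧ j' = i' := by
  induction h with
  | single c hc =>
    intro c₁ h1 c₂ h2 hne
    rw [List.mem_singleton] at h1 h2
    exact absurd (h1.trans h2.symm) hne
  | @cons l k c d i hl hcl hd h0 h5 h ih =>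
    have hcinj := hl.injective c hcl
    have hkey : ∀ j j', c j = d j' → j = i ∧ j' = 5 + 1 ∨ j = i + 1 ∧ j' = 5 := by
      intro j j' hj
      rcases (h c hcl j j' hj).2 with rfl | rfl
      · exact Or.inl ⟨hcinj (hj.trans h0), rfl⟩
      · exact Or.inr ⟨hcinj (hj.trans h5), rfl⟩
    intro c₁ h1 c₂ h2 hne j j' hj
    rcases List.mem_cons.1 h1 with e1 | h1' <;> rcases List.mem_cons.1 h2 with e2 | h2'
    · exact absurd (e1.trans e2.symm) hne
    · subst e1
      obtain ⟨rfl, -⟩ := h c₂ h2' j' j hj.symm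
      refine ⟨5, i, h5, h0, fun j j' hj => ?_⟩
      rcases hkey j' j hj.symm with ⟨a, b⟩ | ⟨a, b⟩
      exacts [Or.inr ⟨b, a⟩, Or.inl ⟨b, a⟩]
    · subst e2
      obtain ⟨rfl, -⟩ := h c₁ h1' j j' hj
      exact ⟨i, 5, h0.symm, h5.symm, hkey⟩
    · exact ih c₁ h1' c₂ h2' hne j j' hj

/-- No vertex lies on three hexagons. -/
theorem two_of_three (h : HexSeq l k) : ∀ a ∈ l, ∀ b ∈ l, ∀ c ∈ l, ∀ i j m, a i = b j →
    b j = c m → a = b ∨ a = c ∨ b = c := by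
  induction h with
  | single c hc =>
    intro a ha b hb _ _ _ _ _ _ _
    rw [List.mem_singleton] at ha hb
    exact Or.inl (ha.trans hb.symm)
  | @cons l k c d i hl hcl hd h0 h5 h ih =>
    intro x hx y hy z hz i j m hxy hyz
    rcases List.mem_cons.1 hx with ex | hx' <;> rcases List.mem_cons.1 hy with ey | hy' <;>
      rcases List.mem_cons.1 hz with ez | hz'
    · exact Or.inl (ex.trans ey.symm)
    · exact Or.inl (ex.trans ey.symm)
    · exact Or.inr (Or.inl (ex.trans ez.symm))
    · subst ex
      exact Or.inr (Or.inr ((h y hy' j i hxy.symm).1.trans (h z hz' m i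
        (hxy.trans hyz).symm).1.symm))
    · exact Or.inr (Or.inr (ey.trans ez.symm))
    · subst ey
      exact Or.inr (Or.inl ((h x hx' i j hxy).1.trans (h z hz' m j hyz.symm).1.symm))
    · subst ez
      exact Or.inl ((h x hx' i m (hxy.trans hyz)).1.trans (h y hy' j m hyz).1.symm)
    · exact ih x hx' y hy' z hz' i j m hxy hyz

/-- Different hexagons have at most the two ends of an edge `c i`, `c (i + 1)` in common, so `c (i +
2)` tells them apart. -/
theorem hexEdges_injOn (h : HexSeq l k) : Set.InjOn hexEdges {c | c ∈ l} := by
  intro c hc c' hc' heq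
  by_contra hne
  have hr : Set.range c = Set.range c' := by
    rw [← vertsOf_hexEdges, ← vertsOf_hexEdges, heq]
  have hall : ∀ j, ∃ j', c j = c' j' := fun j => by
    obtain ⟨j', hj'⟩ : c j ∈ Set.range c' := hr ▸ ⟨j, rfl⟩
    exact ⟨j', hj'.symm⟩
  obtain ⟨j', hj'⟩ := hall 0
  obtain ⟨i, i', -, -, hi⟩ := h.shared c hc c' hc' hne 0 j' hj'
  obtain ⟨j', hj'⟩ := hall (i + 2)
  rcases hi _ _ hj' with ⟨h, -⟩ | ⟨h, -⟩ <;> omega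

/-- The vertices can be 2-colored along the hexagons. -/
theorem exists_coloring (h : HexSeq l k) :
    ∃ col : V → Bool, ∀ c ∈ l, ∀ j, col (c (j + 1)) = !col (c j) := by
  classical
  let par : Fin 6 → Bool := fun j => decide ((j : ℕ) % 2 = 1)
  have hpar : ∀ j, par (j + 1) = !par j := by decide
  have ext : ∀ (d : Fin 6 → V), Function.Injective d → ∀ (col : V → Bool) (b : Bool),
      ∃ col' : V → Bool, (∀ j, col' (d j) = (par j ^^ b)) ∧
        ∀ v, v ∉ Set.range d → col' v = col v := by
    intro d hd col b
    refine ⟨fun v => if h : v ∈ Set.range d then (par h.choose ^^ b) else col v, ?_, ?_⟩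
    · intro j
      have hj : d j ∈ Set.range d := ⟨j, rfl⟩
      simp only [hj, dif_pos]
      rw [hd hj.choose_spec]
    · intro v hv
      simp only [hv, dif_neg, not_false_eq_true]
  induction h with
  | single c hc =>
    obtain ⟨col, hcol, -⟩ := ext c hc (fun _ => false) false
    refine ⟨col, fun c' hc' j => ?_⟩
    obtain rfl := List.mem_singleton.1 hc'
    rw [hcol, hcol, hpar]; simp
  | @cons l k c d i hl hcl hd h0 h5 h ih =>
    obtain ⟨col, hcol⟩ := ih
    -- The new hexagon is colored alternately from the old color of `d 0`. As 5 is odd, `d 5` also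
    -- keeps the color it has as the neighbor of `d 0` on `c`.
    obtain ⟨col', hcol', hcol''⟩ := ext d hd col (col (d 0))
    have hold : ∀ c' ∈ l, ∀ j, col' (c' j) = col (c' j) := by
      intro c' hc' j
      by_cases hj : c' j ∈ Set.range d
      · obtain ⟨j', hj'⟩ := hj
        rw [← hj', hcol']
        rcases (h c' hc' j j' hj'.symm).2 with rfl | rfl
        · simp [par]
        · rw [h5, h0, hcol c hcl]; simp [par]
      · exact hcol'' _ hj
    refine ⟨col', fun c' hc' j => ?_⟩
    rcases List.mem_cons.1 hc' with rfl | hc'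
    · rw [hcol', hcol', hpar]; simp
    · rw [hold c' hc', hold c' hc', hcol c' hc']

/-- The hexagons can be 2-colored such that adjacent hexagons get different colors. -/
theorem exists_dual_coloring (h : HexSeq l k) : ∃ κ : (Fin 6 → V) → Bool,
    ∀ c ∈ l, ∀ c' ∈ l, c ≠ c' → ∀ j j', c j = c' j' → κ c' = !κ c := by
  classical
  induction h with
  | single c hc =>
    refine ⟨fun _ => false, fun c₁ h1 c₂ h2 hne => ?_⟩
    rw [List.mem_singleton] at h1 h2
    exact absurd (h1.trans h2.symm) hne
  | @cons l k c d i hl hcl hd h0 h5 h ih =>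
    obtain ⟨κ, hκ⟩ := ih
    have hdl := notMem_of_attach h
    have hold : ∀ c' ∈ l, Function.update κ d (!κ c) c' = κ c' := fun c' hc' =>
      Function.update_of_ne (by rintro rfl; exact hdl hc') _ _
    refine ⟨Function.update κ d (!κ c), fun c₁ h1 c₂ h2 hne j j' hj => ?_⟩
    rcases List.mem_cons.1 h1 with e1 | h1' <;> rcases List.mem_cons.1 h2 with e2 | h2'
    · exact absurd (e1.trans e2.symm) hne
    · subst e1
      obtain ⟨rfl, -⟩ := h c₂ h2' j' j hj.symm
      rw [hold _ h2', Function.update_self]; simp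
    · subst e2
      obtain ⟨rfl, -⟩ := h c₁ h1' j j' hj
      rw [hold _ h1', Function.update_self]
    · rw [hold _ h1', hold _ h2', hκ c₁ h1' c₂ h2' hne j j' hj]

end HexSeq

/-- The union of the hexagons in `l`. -/
def hexGraph {V : Type*} (l : List (Fin 6 → V)) : SimpleGraph V where
  Adj a b := a ≠ b ∧ ∃ c ∈ l, s(a, b) ∈ hexEdges c
  symm := ⟨fun a b ⟨hne, c, hc, h⟩ => ⟨hne.symm, c, hc, by rwa [Sym2.eq_swap]⟩⟩
  loopless := ⟨fun _ h => h.1 rfl⟩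

theorem mk_mem_hexEdges_iff {V : Type*} {c : Fin 6 → V} {a b : V} :
    s(a, b) ∈ hexEdges c ↔ ∃ j, a = c j ∧ (b = c (j + 1) ∨ b = c (j + 5)) := by
  constructor
  · rintro ⟨j, hj⟩
    rcases Sym2.eq_iff.1 hj with ⟨h, h'⟩ | ⟨h, h'⟩
    · exact ⟨j, h.symm, Or.inl h'.symm⟩
    · refine ⟨j + 1, h'.symm, Or.inr ?_⟩
      rw [← h]; congr 1; omega
  · rintro ⟨j, rfl, rfl | rfl⟩
    · exact ⟨j, rfl⟩
    · refine ⟨j + 5, ?_⟩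
      dsimp only
      rw [show j + 5 + 1 = j by omega]
      exact Sym2.eq_swap

/-- The hexagons in `l` pulled apart, with the two copies of each common vertex joined. -/
def phenGraph {V : Type*} (l : List (Fin 6 → V)) : SimpleGraph ((Fin 6 → V) × Fin 6) where
  Adj p q := p.1 ∈ l ∧ q.1 ∈ l ∧ (p.1 = q.1 ∧ (q.2 = p.2 + 1 ∨ p.2 = q.2 + 1) ∨
    p.1 ≠ q.1 ∧ p.1 p.2 = q.1 q.2)
  symm := ⟨fun p q ⟨h1, h2, h⟩ => ⟨h2, h1, h.imp (fun h => ⟨h.1.symm, h.2.symm⟩)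
    (fun h => ⟨h.1.symm, h.2.symm⟩)⟩⟩
  loopless := ⟨fun p h => by
    rcases h.2.2 with ⟨-, h | h⟩ | ⟨h, -⟩
    · omega
    · omega
    · exact h rfl⟩

/-! ### Neighbors of the vertices of a hexagon -/

namespace HexSeq

variable {V : Type*} {l : List (Fin 6 → V)} {k : ℕ}

theorem hexGraph_adj (h : HexSeq l k) {a b : V} :
    (hexGraph l).Adj a b ↔ ∃ c ∈ l, ∃ j, a = c j ∧ (b = c (j + 1) ∨ b = c (j + 5)) := by
  simp only [hexGraph, mk_mem_hexEdges_iff]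
  refine ⟨And.right, fun h' => ⟨?_, h'⟩⟩
  obtain ⟨c, hc, j, rfl, rfl | rfl⟩ := h'
  · exact fun e => by have := h.injective c hc e; omega
  · exact fun e => by have := h.injective c hc e; omega

theorem hexGraph_adj_iff (h : HexSeq l k) {c : Fin 6 → V} (hc : c ∈ l) (j : Fin 6) (z : V) :
    (hexGraph l).Adj (c j) z ↔ z = c (j + 1) ∨ z = c (j + 5) ∨
      ∃ c' ∈ l, c' ≠ c ∧ ∃ j', c j = c' j' ∧ (z = c' (j' + 1) ∨ z = c' (j' + 5)) := by
  rw [h.hexGraph_adj]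
  constructor
  · rintro ⟨c', hc', j', hj', hz⟩
    by_cases he : c' = c
    · subst he
      obtain rfl := h.injective _ hc hj'
      exact hz.imp_right Or.inl
    · exact Or.inr (Or.inr ⟨c', hc', he, j', hj', hz⟩)
  · rintro (hz | hz | ⟨c', hc', -, j', hj', hz⟩)
    exacts [⟨c, hc, j, rfl, Or.inl hz⟩, ⟨c, hc, j, rfl, Or.inr hz⟩, ⟨c', hc', j', hj', hz⟩]

theorem hexGraph_adj_of_not_shared (h : HexSeq l k) {c : Fin 6 → V} (hc : c ∈ l) (j : Fin 6)
    (hs : ¬ ∃ c' ∈ l, c' ≠ c ∧ c j ∈ Set.range c') (z : V) :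
    (hexGraph l).Adj (c j) z ↔ z = c (j + 1) ∨ z = c (j + 5) := by
  rw [h.hexGraph_adj_iff hc]
  refine or_congr_right (or_iff_left ?_)
  rintro ⟨c', hc', hne, j', hj', -⟩
  exact hs ⟨c', hc', hne, j', hj'.symm⟩

/-- The vertex lies on exactly one other hexagon. One of its two neighbors there is the other end of
the common edge, hence on `c`; the remaining one is `w`. -/
theorem hexGraph_adj_of_shared (h : HexSeq l k) {c : Fin 6 → V} (hc : c ∈ l) (j : Fin 6)
    (hs : ∃ c' ∈ l, c' ≠ c ∧ c j ∈ Set.range c') :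
    ∃ w, w ∉ Set.range c ∧ ∀ z, (hexGraph l).Adj (c j) z ↔ z = c (j + 1) ∨ z = c (j + 5) ∨
      z = w := by
  obtain ⟨c', hc', hne, j', hj'⟩ := hs
  have honly : ∀ c'' ∈ l, c'' ≠ c → ∀ j'', c j = c'' j'' → c'' = c' ∧ j'' = j' := by
    intro c'' hc'' hne'' j'' hj''
    rcases h.two_of_three c hc c' hc' c'' hc'' j j' j'' hj'.symm (hj'.trans hj'') with e | e | e
    · exact absurd e.symm hne
    · exact absurd e.symm hne''
    · subst e
      exact ⟨rfl, h.injective _ hc' (hj''.symm.trans hj'.symm)⟩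
  obtain ⟨i, i', h1, h2, h3⟩ := h.shared c hc c' hc' hne.symm j j' hj'.symm
  have hiff : ∀ z, (hexGraph l).Adj (c j) z ↔ z = c (j + 1) ∨ z = c (j + 5) ∨
      z = c' (j' + 1) ∨ z = c' (j' + 5) := by
    intro z
    rw [h.hexGraph_adj_iff hc]
    refine or_congr_right (or_congr_right ⟨?_, fun hz => ⟨c', hc', hne, j', hj'.symm, hz⟩⟩)
    rintro ⟨c'', hc'', hne'', j'', hj'', hz⟩
    obtain ⟨rfl, rfl⟩ := honly c'' hc'' hne'' j'' hj''
    exact hz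
  rcases h3 j j' hj'.symm with ⟨rfl, rfl⟩ | ⟨rfl, rfl⟩
  · refine ⟨c' (i' + 1 + 1), ?_, fun z => ?_⟩
    · rintro ⟨m, hm⟩
      rcases h3 _ _ hm with ⟨-, e⟩ | ⟨-, e⟩ <;> omega
    · rw [hiff, show i' + 1 + 5 = i' by omega, h2]
      tauto
  · refine ⟨c' (j' + 5), ?_, fun z => ?_⟩
    · rintro ⟨m, hm⟩
      rcases h3 _ _ hm with ⟨-, e⟩ | ⟨-, e⟩ <;> omega
    · rw [hiff, show i + 1 + 5 = i by omega, h1]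
      tauto

end HexSeq

/-- Counting the neighbors of a vertex of degree two or three on the hexagon `f`. -/
theorem ncard_neighbors {W : Type*} {G : SimpleGraph W} {f : Fin 6 → W}
    (hf : Function.Injective f) {j : Fin 6} {p : Prop} [Decidable p]
    (h0 : ¬ p → ∀ z, G.Adj (f j) z ↔ z = f (j + 1) ∨ z = f (j + 5))
    (h1 : p → ∃ w, w ∉ Set.range f ∧ ∀ z, G.Adj (f j) z ↔ z = f (j + 1) ∨ z = f (j + 5) ∨ z = w)
    (m r : Fin 6) (hm : m = j + 1 ∨ m = j + 5) (hr1 : r ≠ j + 1) (hr5 : r ≠ j + 5) :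
    ({z | z ≠ f m ∧ G.Adj (f j) z} ∪ {f r}).ncard = 2 + if p then 1 else 0 := by
  obtain ⟨n, hmn, hn⟩ : ∃ n, m ≠ n ∧ ∀ z, (z = f (j + 1) ∨ z = f (j + 5)) ↔ z = f m ∨ z = f n := by
    rcases hm with rfl | rfl
    · exact ⟨j + 5, by omega, fun z => Iff.rfl⟩
    · exact ⟨j + 1, by omega, fun z => or_comm⟩
  have hmn' : f m ≠ f n := hf.ne hmn
  have hrn : f r ≠ f n := by
    intro e
    rcases (hn (f n)).2 (Or.inr rfl) with e' | e'
    · exact hr1 (hf (e.trans e'))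
    · exact hr5 (hf (e.trans e'))
  split_ifs with hs
  · obtain ⟨w, hw, hadj⟩ := h1 hs
    have h1 : ∀ i, w ≠ f i := fun i e => hw ⟨i, e.symm⟩
    have : ({z | z ≠ f m ∧ G.Adj (f j) z} ∪ {f r}) = {f r, f n, w} := by
      ext z
      simp only [hadj, ← or_assoc, hn, Set.mem_union, Set.mem_ofPred_eq, Set.mem_singleton_iff,
        Set.mem_insert_iff]
      have := h1 m
      grind
    rw [this, Set.ncard_insert_of_notMem, Set.ncard_pair (h1 n).symm]
    simp [hrn, (h1 r).symm]
  · have : ({z | z ≠ f m ∧ G.Adj (f j) z} ∪ {f r}) = {f r, f n} := by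
      ext z
      simp only [h0 hs, hn, Set.mem_union, Set.mem_ofPred_eq,
        Set.mem_singleton_iff, Set.mem_insert_iff]
      grind
    rw [this, Set.ncard_pair hrn]

/-! ### Pairs at distance three, counted hexagon by hexagon -/

namespace HexSeq

variable {V : Type*} {l : List (Fin 6 → V)} {k : ℕ}

/-- Evaluates the two variable terms of the ear formula, with `c j` in the role of `u` or `v`, `c m`
in that of the end of the attaching edge next to it, and `c r` in that of the opposite vertex `v` or
`u`. -/
theorem ncard_hexGraph (h : HexSeq l k) {c : Fin 6 → V} (hc : c ∈ l) (j m r : Fin 6)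
    (hm : m = j + 1 ∨ m = j + 5) (hr1 : r ≠ j + 1) (hr5 : r ≠ j + 5) :
    ({z | z ≠ c m ∧ (hexGraph l).Adj (c j) z} ∪ {c r}).ncard = 2 + sharedCount l c (c j) := by
  classical
  rw [ncard_neighbors (h.injective c hc) (h.hexGraph_adj_of_not_shared hc j)
    (h.hexGraph_adj_of_shared hc j) m r hm hr1 hr5, sharedCount]

/-- The ends of the attaching edge lie on `c` alone before `d` is attached, so they have degree two;
this is what an ear requires. -/
theorem not_shared_of_attach {c d : Fin 6 → V} {j : Fin 6} {j' : Fin 6} (hj : c j = d j')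
    (h : ∀ c' ∈ l, ∀ j j', c' j = d j' → c' = c ∧ (j' = 0 ∨ j' = 5)) :
    ¬ ∃ c' ∈ l, c' ≠ c ∧ c j ∈ Set.range c' := by
  rintro ⟨c', hc', hne, m, hm⟩
  exact hne (h c' hc' m j' (hm.trans hj)).1

theorem phenGraph_adj_iff {c : Fin 6 → V} (hc : c ∈ l) (j : Fin 6)
    (z : (Fin 6 → V) × Fin 6) : (phenGraph l).Adj (c, j) z ↔ z = (c, j + 1) ∨ z = (c, j + 5) ∨
      ∃ c' ∈ l, c' ≠ c ∧ ∃ j', c j = c' j' ∧ z = (c', j') := by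
  obtain ⟨c', j'⟩ := z
  simp only [phenGraph, hc, true_and, Prod.mk.injEq]
  constructor
  · rintro ⟨hc', ⟨rfl, rfl | rfl⟩ | ⟨hne, hj⟩⟩
    · exact Or.inl ⟨rfl, rfl⟩
    · exact Or.inr (Or.inl ⟨rfl, by omega⟩)
    · exact Or.inr (Or.inr ⟨c', hc', Ne.symm hne, j', hj, rfl, rfl⟩)
  · rintro (⟨rfl, rfl⟩ | ⟨rfl, rfl⟩ | ⟨c'', hc'', hne, j'', hj, rfl, rfl⟩)
    · exact ⟨hc, Or.inl ⟨rfl, Or.inl rfl⟩⟩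
    · exact ⟨hc, Or.inl ⟨rfl, Or.inr (by omega)⟩⟩
    · exact ⟨hc'', Or.inr ⟨hne.symm, hj⟩⟩

theorem phenGraph_adj_of_not_shared {c : Fin 6 → V} (hc : c ∈ l) (j : Fin 6)
    (hs : ¬ ∃ c' ∈ l, c' ≠ c ∧ c j ∈ Set.range c') (z : (Fin 6 → V) × Fin 6) :
    (phenGraph l).Adj (c, j) z ↔ z = (c, j + 1) ∨ z = (c, j + 5) := by
  rw [phenGraph_adj_iff hc]
  refine or_congr_right (or_iff_left ?_)
  rintro ⟨c', hc', hne, j', hj', -⟩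
  exact hs ⟨c', hc', hne, j', hj'.symm⟩

/-- Here the third neighbor is the copy of the vertex in the only other hexagon containing it. -/
theorem phenGraph_adj_of_shared (h : HexSeq l k) {c : Fin 6 → V} (hc : c ∈ l) (j : Fin 6)
    (hs : ∃ c' ∈ l, c' ≠ c ∧ c j ∈ Set.range c') :
    ∃ w, w ∉ Set.range (Prod.mk c) ∧ ∀ z, (phenGraph l).Adj (c, j) z ↔
      z = (c, j + 1) ∨ z = (c, j + 5) ∨ z = w := by
  obtain ⟨c', hc', hne, j', hj'⟩ := hs
  refine ⟨(c', j'), ?_, fun z => ?_⟩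
  · rintro ⟨m, hm⟩
    exact hne (congrArg Prod.fst hm).symm
  rw [phenGraph_adj_iff hc]
  refine or_congr_right (or_congr_right ⟨?_, fun hz => ⟨c', hc', hne, j', hj'.symm, hz⟩⟩)
  rintro ⟨c'', hc'', hne'', j'', hj'', rfl⟩
  rcases h.two_of_three c hc c' hc' c'' hc'' j j' j'' hj'.symm (hj'.trans hj'') with e | e | e
  · exact absurd e.symm hne
  · exact absurd e.symm hne''
  · subst e
    rw [h.injective _ hc' (hj''.symm.trans hj'.symm)]

theorem ncard_phenGraph (h : HexSeq l k) {c : Fin 6 → V} (hc : c ∈ l) (j m r : Fin 6)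
    (hm : m = j + 1 ∨ m = j + 5) (hr1 : r ≠ j + 1) (hr5 : r ≠ j + 5) :
    ({z | z ≠ (c, m) ∧ (phenGraph l).Adj (c, j) z} ∪ {(c, r)}).ncard =
      2 + sharedCount l c (c j) := by
  classical
  rw [ncard_neighbors (f := Prod.mk c) (Prod.mk_right_injective c)
    (phenGraph_adj_of_not_shared hc j)
    (h.phenGraph_adj_of_shared hc j) m r hm hr1 hr5, sharedCount]

/-- Attaching a hexagon to a benzenoid. -/
theorem hexEar {c d : Fin 6 → V} {i : Fin 6} (hl : HexSeq l k)
    (hcl : c ∈ l) (hd : Function.Injective d) (h0 : d 0 = c i) (h5 : d 5 = c (i + 1))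
    (h : ∀ c' ∈ l, ∀ j j', c' j = d j' → c' = c ∧ (j' = 0 ∨ j' = 5)) :
    HexEar (hexGraph l) (hexGraph (d :: l)) (c i) (c (i + 1)) (c (i + 5)) (c (i + 2))
      (d 1) (d 2) (d 3) (d 4) := by
  have hnew : ∀ j', j' ≠ 0 → j' ≠ 5 → ∀ z, ¬ (hexGraph l).Adj z (d j') := by
    intro j' hj0 hj5 z hz
    obtain ⟨c', hc', j, hj, -⟩ := hl.hexGraph_adj.1 hz.symm
    rcases (h c' hc' j j' hj.symm).2 with e | e
    exacts [hj0 e, hj5 e]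
  refine ⟨?_, ?_, hnew 1 (by decide) (by decide), hnew 2 (by decide) (by decide),
    hnew 3 (by decide) (by decide), hnew 4 (by decide) (by decide), ?_, fun a b => ?_⟩
  · intro z
    exact hl.hexGraph_adj_of_not_shared hcl i (not_shared_of_attach h0.symm h) z
  · intro z
    rw [hl.hexGraph_adj_of_not_shared hcl (i + 1) (not_shared_of_attach h5.symm h) z,
      show i + 1 + 5 = i by omega, show i + 1 + 1 = i + 2 by omega, or_comm]
  · simp [hd.eq_iff]
  · have hall : (hexGraph (d :: l)).Adj a b ↔ (hexGraph l).Adj a b ∨ s(a, b) ∈ hexEdges d := by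
      simp only [hexGraph, List.mem_cons, or_and_right, exists_or, exists_eq_left]
      constructor
      · rintro ⟨hne, h | h⟩
        exacts [Or.inr h, Or.inl ⟨hne, h⟩]
      · rintro (⟨hne, h⟩ | h)
        · exact ⟨hne, Or.inr h⟩
        · refine ⟨?_, Or.inl h⟩
          obtain ⟨j, rfl, rfl | rfl⟩ := mk_mem_hexEdges_iff.1 h
          · exact hd.ne (by omega)
          · exact hd.ne (by omega)
    rw [hall, hexEdges, Set.mem_range]
    -- Of the six edges of `d`, the one from 5 to 0 is old and the other five form the ear.
    have hadj : s(a, b) = s(d 5, d 0) → (hexGraph l).Adj a b := by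
      intro e
      rw [← mem_edgeSet, e, mem_edgeSet, h0, h5]
      exact (hl.hexGraph_adj_iff hcl (i + 1) _).2 (Or.inr (Or.inl (by congr 1; omega)))
    rw [← h0, ← h5]
    constructor
    · rintro (h | ⟨j, hj⟩)
      · exact Or.inl h
      · fin_cases j
        · exact Or.inr (Or.inl hj.symm)
        · exact Or.inr (Or.inr (Or.inl hj.symm))
        · exact Or.inr (Or.inr (Or.inr (Or.inl hj.symm)))
        · exact Or.inr (Or.inr (Or.inr (Or.inr (Or.inl hj.symm))))
        · exact Or.inr (Or.inr (Or.inr (Or.inr (Or.inr hj.symm))))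
        · exact Or.inl (hadj hj.symm)
    · rintro (h | h | h | h | h | h)
      exacts [Or.inl h, Or.inr ⟨0, h.symm⟩, Or.inr ⟨1, h.symm⟩, Or.inr ⟨2, h.symm⟩,
        Or.inr ⟨3, h.symm⟩, Or.inr ⟨4, h.symm⟩]

theorem ncard_polarityPairs_hexagon :
    (polarityPairs (hexGraph [(id : Fin 6 → Fin 6)])).ncard = 3 := by
  have hadj : ∀ a b : Fin 6, (hexGraph [(id : Fin 6 → Fin 6)]).Adj a b ↔
      b = a + 1 ∨ b = a + 5 := by
    intro a b
    rw [(HexSeq.single (id : Fin 6 → Fin 6) Function.injective_id).hexGraph_adj]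
    simp
  have h3 : ∀ u v : Fin 6, (¬ (v = u + 1 ∨ v = u + 5) ∧ ∃ a b : Fin 6, (a = u + 1 ∨ a = u + 5) ∧
      (b = a + 1 ∨ b = a + 5) ∧ (v = b + 1 ∨ v = b + 5)) ↔ v = u + 3 := by decide
  have : polarityPairs (hexGraph [(id : Fin 6 → Fin 6)]) = {s(0, 3), s(1, 4), s(2, 5)} := by
    ext p
    simp only [polarityPairs, hadj, h3, Set.mem_ofPred_eq, Set.mem_insert_iff,
      Set.mem_singleton_iff]
    constructor
    · rintro ⟨u, v, rfl, rfl⟩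
      revert u; decide
    · rintro (rfl | rfl | rfl)
      exacts [⟨0, 3, rfl, rfl⟩, ⟨1, 4, rfl, rfl⟩, ⟨2, 5, rfl, rfl⟩]
  rw [this, Set.ncard_insert_of_notMem (by decide +revert), Set.ncard_pair (by decide)]

/-- The number of pairs at distance three in a catacondensed benzenoid graph. -/
theorem ncard_polarityPairs_hexGraph [Finite V] (h : HexSeq l k) :
    (polarityPairs (hexGraph l)).ncard + 6 = 9 * l.length + k := by
  induction h with
  | single c hc =>
    have hs := HexSeq.single c hc
    have hi := HexSeq.single (id : Fin 6 → Fin 6) Function.injective_id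
    rw [ncard_polarityPairs_of_embedding (G := hexGraph [(id : Fin 6 → Fin 6)]) hc,
      ncard_polarityPairs_hexagon]
    · rfl
    · intro a b
      rw [hs.hexGraph_adj, hi.hexGraph_adj]
      simp [hc.eq_iff]
    · intro a b hab
      obtain ⟨c', hc', j, rfl, -⟩ := hs.hexGraph_adj.1 hab
      obtain rfl := List.mem_singleton.1 hc'
      exact ⟨j, rfl⟩
  | @cons l k c d i hl hcl hd h0 h5 h ih =>
    have hinj := hl.injective c hcl
    -- The increment is `5 + 2 + 2 = 9` plus the two shared counts, which are the new kinks.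
    rw [(hl.hexEar hcl hd h0 h5 h).ncard_polarityPairs (hinj.ne (by omega)) (hinj.ne (by omega)),
      hl.ncard_hexGraph hcl (i + 5) i (i + 2) (by omega) (by omega) (by omega),
      hl.ncard_hexGraph hcl (i + 2) (i + 1) (i + 5) (by omega) (by omega) (by omega),
      List.length_cons]
    omega

theorem phenGraph_cons_adj {c d : Fin 6 → V} {i : Fin 6} (hl : HexSeq l k)
    (hcl : c ∈ l) (h0 : d 0 = c i) (h5 : d 5 = c (i + 1))
    (h : ∀ c' ∈ l, ∀ j j', c' j = d j' → c' = c ∧ (j' = 0 ∨ j' = 5))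
    (p q : (Fin 6 → V) × Fin 6) : (phenGraph (d :: l)).Adj p q ↔ (phenGraph l).Adj p q ∨
      s(p, q) = s((c, i), (d, 0)) ∨ s(p, q) = s((d, 5), (c, i + 1)) ∨
      ∃ j, s(p, q) = s((d, j), (d, j + 1)) := by
  have hdl := notMem_of_attach h
  have hcinj := hl.injective c hcl
  have hcd : c ≠ d := fun e => hdl (e ▸ hcl)
  have hkey : ∀ c' ∈ l, ∀ j j', c' j = d j' ↔ c' = c ∧ (j = i ∧ j' = 0 ∨ j = i + 1 ∧ j' = 5) := by
    intro c' hc' j j'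
    constructor
    · intro hj
      obtain ⟨rfl, rfl | rfl⟩ := h c' hc' j j' hj
      · exact ⟨rfl, Or.inl ⟨hcinj (hj.trans h0), rfl⟩⟩
      · exact ⟨rfl, Or.inr ⟨hcinj (hj.trans h5), rfl⟩⟩
    · rintro ⟨rfl, ⟨rfl, rfl⟩ | ⟨rfl, rfl⟩⟩
      exacts [h0.symm, h5.symm]
  obtain ⟨p1, p2⟩ := p
  obtain ⟨q1, q2⟩ := q
  simp only [phenGraph, List.mem_cons, Sym2.eq_iff, Prod.mk.injEq]
  constructor
  · rintro ⟨rfl | hp, rfl | hq, h'⟩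
    · rcases h' with ⟨-, rfl | rfl⟩ | ⟨e, -⟩
      · exact Or.inr (Or.inr (Or.inr ⟨p2, Or.inl ⟨⟨rfl, rfl⟩, rfl, rfl⟩⟩))
      · exact Or.inr (Or.inr (Or.inr ⟨q2, Or.inr ⟨⟨rfl, rfl⟩, rfl, rfl⟩⟩))
      · exact absurd rfl e
    · rcases h' with ⟨rfl, -⟩ | ⟨-, e⟩
      · exact absurd hq hdl
      · obtain ⟨rfl, ⟨rfl, rfl⟩ | ⟨rfl, rfl⟩⟩ := (hkey q1 hq q2 p2).1 e.symm
        · exact Or.inr (Or.inl (Or.inr ⟨⟨rfl, rfl⟩, rfl, rfl⟩))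
        · exact Or.inr (Or.inr (Or.inl (Or.inl ⟨⟨rfl, rfl⟩, rfl, rfl⟩)))
    · rcases h' with ⟨rfl, -⟩ | ⟨-, e⟩
      · exact absurd hp hdl
      · obtain ⟨rfl, ⟨rfl, rfl⟩ | ⟨rfl, rfl⟩⟩ := (hkey p1 hp p2 q2).1 e
        · exact Or.inr (Or.inl (Or.inl ⟨⟨rfl, rfl⟩, rfl, rfl⟩))
        · exact Or.inr (Or.inr (Or.inl (Or.inr ⟨⟨rfl, rfl⟩, rfl, rfl⟩)))
    · exact Or.inl ⟨hp, hq, h'⟩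
  · rintro (⟨hp, hq, h'⟩ | (⟨⟨rfl, rfl⟩, rfl, rfl⟩ | ⟨⟨rfl, rfl⟩, rfl, rfl⟩) |
      (⟨⟨rfl, rfl⟩, rfl, rfl⟩ | ⟨⟨rfl, rfl⟩, rfl, rfl⟩) |
      ⟨j, ⟨⟨rfl, rfl⟩, rfl, rfl⟩ | ⟨⟨rfl, rfl⟩, rfl, rfl⟩⟩)
    · exact ⟨Or.inr hp, Or.inr hq, h'⟩
    · exact ⟨Or.inr hcl, Or.inl rfl, Or.inr ⟨hcd, h0.symm⟩⟩
    · exact ⟨Or.inl rfl, Or.inr hcl, Or.inr ⟨hcd.symm, h0⟩⟩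
    · exact ⟨Or.inl rfl, Or.inr hcl, Or.inr ⟨hcd.symm, h5⟩⟩
    · exact ⟨Or.inr hcl, Or.inl rfl, Or.inr ⟨hcd, h5.symm⟩⟩
    · exact ⟨Or.inl rfl, Or.inl rfl, Or.inl ⟨rfl, Or.inl rfl⟩⟩
    · exact ⟨Or.inl rfl, Or.inl rfl, Or.inl ⟨rfl, Or.inr rfl⟩⟩

/-- Attaching a square and then a hexagon to a phenylene. -/
theorem phenGraph_ears {c d : Fin 6 → V} {i : Fin 6} (hl : HexSeq l k)
    (hcl : c ∈ l) (h0 : d 0 = c i) (h5 : d 5 = c (i + 1))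
    (h : ∀ c' ∈ l, ∀ j j', c' j = d j' → c' = c ∧ (j' = 0 ∨ j' = 5)) :
    ∃ M : SimpleGraph ((Fin 6 → V) × Fin 6),
      SquareEar (phenGraph l) M (c, i) (c, i + 1) (c, i + 5) (c, i + 2) (d, 0) (d, 5) ∧
      HexEar M (phenGraph (d :: l)) (d, 0) (d, 5) (c, i) (c, i + 1) (d, 1) (d, 2) (d, 3)
        (d, 4) := by
  have hdl := notMem_of_attach h
  have hcd : c ≠ d := fun e => hdl (e ▸ hcl)
  have hnew : ∀ j z, ¬ (phenGraph l).Adj z (d, j) := fun j z hz => hdl hz.2.1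
  have nx := phenGraph_adj_of_not_shared hcl i (not_shared_of_attach h0.symm h)
  have ny := phenGraph_adj_of_not_shared hcl (i + 1) (not_shared_of_attach h5.symm h)
  -- The intermediate graph has the square but not yet the rest of the hexagon.
  refine ⟨phenGraph l ⊔ fromEdgeSet {s((c, i), (d, 0)), s((d, 0), (d, 5)), s((d, 5), (c, i + 1))},
    ?_⟩
  have hM : ∀ a b, (phenGraph l ⊔ fromEdgeSet {s((c, i), (d, 0)), s((d, 0), (d, 5)),
      s((d, 5), (c, i + 1))}).Adj a b ↔ (phenGraph l).Adj a b ∨ s(a, b) = s((c, i), (d, 0)) ∨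
      s(a, b) = s((d, 0), (d, 5)) ∨ s(a, b) = s((d, 5), (c, i + 1)) := by
    intro a b
    rw [sup_adj, fromEdgeSet_adj, and_iff_left_of_imp]
    · simp only [Set.mem_insert_iff, Set.mem_singleton_iff]
    · rintro hab rfl
      simp only [Set.mem_insert_iff, Set.mem_singleton_iff, Sym2.eq_iff] at hab
      grind
  refine ⟨⟨nx, fun z => ?_, hnew 0, hnew 5, by simp, hM⟩,
    ⟨fun z => ?_, fun z => ?_, fun z => ?_, fun z => ?_, fun z => ?_, fun z => ?_, by simp,
      fun a b => ?_⟩⟩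
  · rw [ny, show i + 1 + 5 = i by omega, show i + 1 + 1 = i + 2 by omega, or_comm]
  · rw [hM, or_iff_right (fun e => hnew 0 _ e.symm)]
    simp only [Sym2.eq_iff, Prod.mk.injEq, hcd.symm, false_and, false_or, true_and]
    simp [or_comm]
  · rw [hM, or_iff_right (fun e => hnew 5 _ e.symm)]
    simp only [Sym2.eq_iff, Prod.mk.injEq, hcd.symm, false_and, false_or, true_and]
    simp
  iterate 4
    rw [hM, or_iff_right (hnew _ _)]
    simp [hcd.symm]
  · rw [hl.phenGraph_cons_adj hcl h0 h5 h, hM]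
    constructor
    · rintro (h | h | h | ⟨j, h⟩)
      · exact Or.inl (Or.inl h)
      · exact Or.inl (Or.inr (Or.inl h))
      · exact Or.inl (Or.inr (Or.inr (Or.inr h)))
      · fin_cases j
        · exact Or.inr (Or.inl h)
        · exact Or.inr (Or.inr (Or.inl h))
        · exact Or.inr (Or.inr (Or.inr (Or.inl h)))
        · exact Or.inr (Or.inr (Or.inr (Or.inr (Or.inl h))))
        · exact Or.inr (Or.inr (Or.inr (Or.inr (Or.inr h))))
        · exact Or.inl (Or.inr (Or.inr (Or.inl (h.trans Sym2.eq_swap))))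
    · rintro ((h | h | h | h) | h | h | h | h | h)
      exacts [Or.inl h, Or.inr (Or.inl h), Or.inr (Or.inr (Or.inr ⟨5, h.trans Sym2.eq_swap⟩)),
        Or.inr (Or.inr (Or.inl h)), Or.inr (Or.inr (Or.inr ⟨0, h⟩)),
        Or.inr (Or.inr (Or.inr ⟨1, h⟩)), Or.inr (Or.inr (Or.inr ⟨2, h⟩)),
        Or.inr (Or.inr (Or.inr ⟨3, h⟩)), Or.inr (Or.inr (Or.inr ⟨4, h⟩))]

/-- The number of pairs at distance three in a phenylene. -/
theorem ncard_polarityPairs_phenGraph [Finite V] (h : HexSeq l k) :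
    (polarityPairs (phenGraph l)).ncard + 10 = 13 * l.length + k := by
  induction h with
  | single c hc =>
    have hi := HexSeq.single (id : Fin 6 → Fin 6) Function.injective_id
    rw [ncard_polarityPairs_of_embedding (G := hexGraph [(id : Fin 6 → Fin 6)])
      (Prod.mk_right_injective c), ncard_polarityPairs_hexagon]
    · rfl
    · intro a b
      rw [hi.hexGraph_adj, phenGraph_adj_of_not_shared (by simp)]
      · simp
      · simp
    · rintro ⟨a, j⟩ b hab
      obtain rfl := List.mem_singleton.1 hab.1
      exact ⟨j, rfl⟩
  | @cons l k c d i hl hcl hd h0 h5 h ih =>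
    have hcd : c ≠ d := fun e => notMem_of_attach h (e ▸ hcl)
    obtain ⟨M, hM, hM'⟩ := hl.phenGraph_ears hcl h0 h5 h
    have hinj : Function.Injective (Prod.mk c : Fin 6 → _) := Prod.mk_right_injective c
    -- For the hexagonal ear the neighbors `(c, i)` and `(c, i + 1)` are adjacent to each other, so
    -- each variable term is 2, kinks or not. The kinks enter through the square, giving `(2 + 2) +
    -- (5 + 2 + 2) = 13` plus the shared counts.
    have hA : ({z | z ≠ (d, 0) ∧ M.Adj (c, i) z} ∪ {(c, i + 1)}).ncard = 2 := by
      rw [← Set.ncard_pair (a := (c, i + 5)) (b := (c, i + 1)) (hinj.ne (by omega))]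
      congr 1
      ext z
      simp only [hM.adj, hM.nx, Set.mem_union, Set.mem_ofPred_eq, Set.mem_singleton_iff,
        Set.mem_insert_iff, Sym2.eq_iff, Prod.mk.injEq, hcd, false_and, or_false, true_and]
      grind
    have hB : ({z | z ≠ (d, 5) ∧ M.Adj (c, i + 1) z} ∪ {(c, i)}).ncard = 2 := by
      rw [← Set.ncard_pair (a := (c, i + 2)) (b := (c, i)) (hinj.ne (by omega))]
      congr 1
      ext z
      simp only [hM.adj, hM.ny, Set.mem_union, Set.mem_ofPred_eq, Set.mem_singleton_iff,
        Set.mem_insert_iff, Sym2.eq_iff, Prod.mk.injEq, hcd, false_and, or_false, true_and]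
      grind
    rw [hM'.ncard_polarityPairs (by simp [hcd]) (by simp [hcd]), hA, hB,
      hM.ncard_polarityPairs (hinj.ne (by omega)) (hinj.ne (by omega)) (hinj.ne (by omega)),
      hl.ncard_phenGraph hcl (i + 5) i (i + 2) (by omega) (by omega) (by omega),
      hl.ncard_phenGraph hcl (i + 2) (i + 1) (i + 5) (by omega) (by omega) (by omega),
      List.length_cons]
    omega

end HexSeq

/-! ### The Wiener polarity index of benzenoids and phenylenes -/

theorem dist_iso_le {V W : Type*} {G : SimpleGraph V} {H : SimpleGraph W} (φ : G ≃g H) {u v : V}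
    (hr : G.Reachable u v) : H.dist (φ u) (φ v) ≤ G.dist u v := by
  obtain ⟨w, hw⟩ := hr.exists_walk_length_eq_dist
  rw [← hw, ← Walk.length_map φ.toHom w]
  exact dist_le _

theorem dist_iso {V W : Type*} {G : SimpleGraph V} {H : SimpleGraph W} (φ : G ≃g H) (u v : V) :
    H.dist (φ u) (φ v) = G.dist u v := by
  by_cases hr : G.Reachable u v
  · refine le_antisymm (dist_iso_le φ hr) ?_
    have h := dist_iso_le φ.symm (hr.map φ.toHom)
    simpa using h
  · rw [dist_eq_zero_of_not_reachable hr, dist_eq_zero_of_not_reachable]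
    intro h
    apply hr
    simpa using h.map φ.symm.toHom

theorem wienerPolarity_iso {V W : Type*} {G : SimpleGraph V} {H : SimpleGraph W} (φ : G ≃g H) :
    wienerPolarity G = wienerPolarity H := by
  unfold wienerPolarity
  rw [← Set.ncard_image_of_injective _ (Sym2.map.injective φ.injective)]
  congr 1
  ext p
  constructor
  · rintro ⟨_, ⟨u, v, rfl, h⟩, rfl⟩
    exact ⟨φ u, φ v, rfl, by rwa [dist_iso]⟩
  · rintro ⟨u, v, rfl, h⟩
    refine ⟨s(φ.symm u, φ.symm v), ⟨_, _, rfl, by rwa [dist_iso]⟩, ?_⟩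
    simp

/-- `G` is the union of the hexagons in `l`, and `F` consists of their boundaries. -/
structure IsHexSystem {V : Type*} (G : SimpleGraph V) (F : Set (Set (Sym2 V)))
    (l : List (Fin 6 → V)) (k : ℕ) : Prop where
  seq : HexSeq l k
  faces : F = hexEdges '' {c | c ∈ l}
  graph : G = hexGraph l
  cover : ∀ v, ∃ c ∈ l, v ∈ Set.range c
  cycles : F = {C | IsCycleEdges G 6 C}

theorem IsCatacondensed.exists_isHexSystem {V : Type*} {G : SimpleGraph V}
    {F : Set (Set (Sym2 V))} (h : IsCatacondensed G F) :
    Finite V ∧ ∃ l k, IsHexSystem G F l k := by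
  obtain ⟨hfin, hC, l, k, hs, hF, hG, hv⟩ := h.exists_hexSeq
  refine ⟨hfin, l, k, hs, hF, ?_, hv, hC⟩
  ext a b
  rw [hG]
  refine ⟨fun h' => ⟨?_, h'⟩, And.right⟩
  exact ((hG a b).2 h').ne

namespace IsHexSystem

variable {V : Type*} {G : SimpleGraph V} {F : Set (Set (Sym2 V))} {l : List (Fin 6 → V)} {k : ℕ}

theorem hexagons_eq (h : IsHexSystem G F l k) : hexagons G F = F := by
  ext C
  refine ⟨And.left, fun hC => ⟨hC, ?_⟩⟩
  rw [h.cycles] at hC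
  exact hC

theorem ncard_hexagons (h : IsHexSystem G F l k) : (hexagons G F).ncard = l.length := by
  classical
  rw [h.hexagons_eq, h.faces, h.seq.hexEdges_injOn.ncard_image,
    ← List.toFinset_card_of_nodup h.seq.nodup, ← Set.ncard_coe_finset]
  congr 1
  ext c
  simp

theorem wienerPolarity_eq [Finite V] (h : IsHexSystem G F l k) :
    wienerPolarity G + 6 = 9 * l.length + k := by
  obtain ⟨col, hcol⟩ := h.seq.exists_coloring
  rw [_root_.wienerPolarity_eq (col := col), h.graph, h.seq.ncard_polarityPairs_hexGraph]
  intro a b hab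
  rw [h.graph, h.seq.hexGraph_adj] at hab
  obtain ⟨c, hc, j, rfl, rfl | rfl⟩ := hab
  · exact hcol c hc j
  · have := hcol c hc (j + 5)
    rw [show j + 5 + 1 = j by omega] at this
    rw [this, Bool.not_not]

theorem exists_param (h : IsHexSystem G F l k) (x : PhenyleneVertex F) :
    ∃ p : (Fin 6 → V) × Fin 6, p.1 ∈ l ∧ hexEdges p.1 = x.1.2 ∧ p.1 p.2 = x.1.1 := by
  obtain ⟨⟨v, C⟩, hC, hv⟩ := x
  dsimp only at hC hv
  obtain ⟨c, hc, rfl⟩ : C ∈ hexEdges '' {c | c ∈ l} := h.faces ▸ hC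
  rw [vertsOf_hexEdges] at hv
  obtain ⟨j, rfl⟩ := hv
  exact ⟨(c, j), hc, rfl, rfl⟩

/-- The vertex of `phenGraph l` corresponding to a vertex of the phenylene. -/
noncomputable def toPhen (h : IsHexSystem G F l k) (x : PhenyleneVertex F) :
    (Fin 6 → V) × Fin 6 := (h.exists_param x).choose

theorem toPhen_mem (h : IsHexSystem G F l k) (x : PhenyleneVertex F) : (h.toPhen x).1 ∈ l :=
  (h.exists_param x).choose_spec.1

theorem hexEdges_toPhen (h : IsHexSystem G F l k) (x : PhenyleneVertex F) :
    hexEdges (h.toPhen x).1 = x.1.2 := (h.exists_param x).choose_spec.2.1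

theorem toPhen_apply (h : IsHexSystem G F l k) (x : PhenyleneVertex F) :
    (h.toPhen x).1 (h.toPhen x).2 = x.1.1 := (h.exists_param x).choose_spec.2.2

theorem toPhen_injective (h : IsHexSystem G F l k) : Function.Injective h.toPhen := by
  intro x y hxy
  apply Subtype.ext
  apply Prod.ext
  · rw [← h.toPhen_apply, ← h.toPhen_apply, hxy]
  · rw [← h.hexEdges_toPhen, ← h.hexEdges_toPhen, hxy]

/-- The copy of the vertex `c j` in the hexagon `c`. -/
def vertex (h : IsHexSystem G F l k) (c : Fin 6 → V) (hc : c ∈ l) (j : Fin 6) :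
    PhenyleneVertex F :=
  ⟨(c j, hexEdges c), by rw [h.faces]; exact ⟨c, hc, rfl⟩, by rw [vertsOf_hexEdges]; exact ⟨j, rfl⟩⟩

theorem toPhen_vertex (h : IsHexSystem G F l k) (c : Fin 6 → V) (hc : c ∈ l) (j : Fin 6) :
    h.toPhen (h.vertex c hc j) = (c, j) := by
  have h1 := h.seq.hexEdges_injOn (h.toPhen_mem (h.vertex c hc j)) hc (h.hexEdges_toPhen _)
  apply Prod.ext h1
  have h2 := h.toPhen_apply (h.vertex c hc j)
  rw [h1] at h2
  exact h.seq.injective c hc h2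

theorem vertex_toPhen (h : IsHexSystem G F l k) (x : PhenyleneVertex F) :
    h.vertex (h.toPhen x).1 (h.toPhen_mem x) (h.toPhen x).2 = x := by
  apply h.toPhen_injective
  rw [toPhen_vertex]

/-- Two hexagons have a common edge at each common vertex. -/
theorem exists_common_edge (h : IsHexSystem G F l k) {c c' : Fin 6 → V} (hc : c ∈ l)
    (hc' : c' ∈ l) (hne : c ≠ c') {j j' : Fin 6} (hj : c j = c' j') :
    ∃ e ∈ hexEdges c ∩ hexEdges c', c j ∈ e := by
  obtain ⟨i, i', h1, h2, h3⟩ := h.seq.shared c hc c' hc' hne j j' hj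
  refine ⟨s(c i, c (i + 1)), ⟨⟨i, rfl⟩, i', ?_⟩, ?_⟩
  · rw [h1, h2]; exact Sym2.eq_swap
  · rcases h3 j j' hj with ⟨rfl, -⟩ | ⟨rfl, -⟩
    exacts [Sym2.mem_mk_left _ _, Sym2.mem_mk_right _ _]

theorem phenyleneGraph_adj (h : IsHexSystem G F l k) (x y : PhenyleneVertex F) :
    (phenGraph l).Adj (h.toPhen x) (h.toPhen y) ↔ (phenyleneGraph F).Adj x y := by
  have key : ∀ (c : Fin 6 → V) (hc : c ∈ l) (j : Fin 6) (c' : Fin 6 → V) (hc' : c' ∈ l)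
      (j' : Fin 6), (phenGraph l).Adj (c, j) (c', j') ↔
        (phenyleneGraph F).Adj (h.vertex c hc j) (h.vertex c' hc' j') := by
    intro c hc j c' hc' j'
    have hinj := h.seq.injective c hc
    have hne : hexEdges c = hexEdges c' ↔ c = c' :=
      ⟨fun e => h.seq.hexEdges_injOn hc hc' e, fun e => by rw [e]⟩
    simp only [phenGraph, phenyleneGraph, vertex, hc, hc', true_and, hne, ne_eq]
    apply or_congr
    · refine and_congr_right ?_
      rintro rfl
      rw [hinj.eq_iff, mk_mem_hexEdges_iff]
      constructor
      · rintro (rfl | rfl)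
        · exact ⟨by omega, j, rfl, Or.inl rfl⟩
        · exact ⟨by omega, j' + 1, rfl, Or.inr (by congr 1; omega)⟩
      · rintro ⟨-, m, hm, e | e⟩
        · left; rw [hinj hm]; exact hinj e
        · right; rw [hinj hm, hinj e]; omega
    · constructor
      · rintro ⟨hcc, hj⟩
        exact ⟨hj, hcc, h.exists_common_edge hc hc' hcc hj⟩
      · rintro ⟨hj, hcc, -⟩
        exact ⟨hcc, hj⟩
  conv_rhs => rw [← h.vertex_toPhen x, ← h.vertex_toPhen y]
  exact key _ _ _ _ _ _

theorem mem_range_toPhen (h : IsHexSystem G F l k) (p q : (Fin 6 → V) × Fin 6)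
    (hpq : (phenGraph l).Adj p q) : p ∈ Set.range h.toPhen :=
  ⟨h.vertex p.1 hpq.1 p.2, h.toPhen_vertex _ _ _⟩

theorem wienerPolarity_phenyleneGraph [Finite V] (h : IsHexSystem G F l k) :
    wienerPolarity (phenyleneGraph F) + 10 = 13 * l.length + k := by
  obtain ⟨col, hcol⟩ := h.seq.exists_coloring
  obtain ⟨κ, hκ⟩ := h.seq.exists_dual_coloring
  -- The two copies of a common vertex are adjacent in the phenylene, so the color of a vertex is
  -- twisted by the color of its hexagon.
  rw [_root_.wienerPolarity_eq
    (col := fun x => (col ((h.toPhen x).1 (h.toPhen x).2) ^^ κ (h.toPhen x).1)),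
    ← ncard_polarityPairs_of_embedding h.toPhen_injective h.phenyleneGraph_adj h.mem_range_toPhen,
    h.seq.ncard_polarityPairs_phenGraph]
  intro x y hxy
  rw [← h.phenyleneGraph_adj] at hxy
  obtain ⟨hx, hy, ⟨e, e' | e'⟩ | ⟨hne, e⟩⟩ := hxy
  · rw [← e, e', hcol _ hx]; simp
  · rw [← e, e', hcol _ hx]; simp
  · rw [hκ _ hx _ hy hne _ _ e, ← e]; simp

end IsHexSystem

/-! ### Linear chains have no kinks -/

/-- A kink arises when `d` is attached to `c` while a vertex of `c` next to the attaching edge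
already lies on another hexagon. That vertex and the adjacent end of the edge are consecutive on
`c`. -/
theorem HexSeq.exists_kink {V : Type*} {l : List (Fin 6 → V)} {k : ℕ} (h : HexSeq l k)
    (hk : k ≠ 0) : ∃ c ∈ l, ∃ j, ∃ d ∈ l, ∃ e ∈ l, d ≠ c ∧ e ≠ c ∧ d ≠ e ∧ c j ∈ Set.range d ∧
      c (j + 1) ∈ Set.range e := by
  induction h with
  | single c hc => exact absurd rfl hk
  | @cons l k c d i hl hcl hd h0 h5 h ih =>
    have hdl := notMem_of_attach h
    by_cases hk0 : k = 0
    · by_cases h1 : ∃ c' ∈ l, c' ≠ c ∧ c (i + 5) ∈ Set.range c'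
      · obtain ⟨e, he, hec, hce⟩ := h1
        refine ⟨c, List.mem_cons_of_mem _ hcl, i + 5, e, List.mem_cons_of_mem _ he, d,
          List.mem_cons_self, hec, ?_, ?_, hce, 0, ?_⟩
        · rintro rfl; exact hdl hcl
        · rintro rfl; exact hdl he
        · rw [h0]; congr 1; omega
      · by_cases h2 : ∃ c' ∈ l, c' ≠ c ∧ c (i + 2) ∈ Set.range c'
        · obtain ⟨e, he, hec, hce⟩ := h2
          refine ⟨c, List.mem_cons_of_mem _ hcl, i + 1, d, List.mem_cons_self, e,
            List.mem_cons_of_mem _ he, ?_, hec, ?_, ⟨5, h5⟩, ?_⟩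
          · rintro rfl; exact hdl hcl
          · rintro rfl; exact hdl he
          · rwa [show i + 1 + 1 = i + 2 by omega]
        · rw [sharedCount, sharedCount, if_neg h1, if_neg h2] at hk
          exact absurd hk0 hk
    · obtain ⟨c, hc, j, d', hd', e, he, h'⟩ := ih hk0
      exact ⟨c, List.mem_cons_of_mem _ hc, j, d', List.mem_cons_of_mem _ hd', e,
        List.mem_cons_of_mem _ he, h'⟩

namespace IsHexSystem

variable {V : Type*} {G : SimpleGraph V} {F : Set (Set (Sym2 V))} {l : List (Fin 6 → V)} {k : ℕ}

theorem mem_faces (h : IsHexSystem G F l k) {c : Fin 6 → V} (hc : c ∈ l) : hexEdges c ∈ F := by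
  rw [h.faces]; exact ⟨c, hc, rfl⟩

theorem inter_nonempty_iff (h : IsHexSystem G F l k) {c d : Fin 6 → V} (hc : c ∈ l) (hd : d ∈ l)
    (hne : c ≠ d) : (hexEdges c ∩ hexEdges d).Nonempty ↔ ∃ j j', c j = d j' := by
  constructor
  · rintro ⟨e, ⟨j, rfl⟩, j', hj'⟩
    rcases Sym2.eq_iff.1 hj' with ⟨h, -⟩ | ⟨h, -⟩
    exacts [⟨_, _, h.symm⟩, ⟨_, _, h.symm⟩]
  · rintro ⟨j, j', hj⟩
    obtain ⟨e, he, -⟩ := h.exists_common_edge hc hd hne hj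
    exact ⟨e, he⟩

/-- The hexagons adjacent to a given one. -/
theorem adjacentFaces_eq (h : IsHexSystem G F l k) {c : Fin 6 → V} (hc : c ∈ l) :
    adjacentFaces F (hexEdges c) =
      hexEdges '' {d | d ∈ l ∧ d ≠ c ∧ ∃ j j', c j = d j'} := by
  ext D
  constructor
  · rintro ⟨hD, hne, hn⟩
    rw [h.faces] at hD
    obtain ⟨d, hd, rfl⟩ := hD
    have hdc : d ≠ c := fun e => hne (by rw [e])
    exact ⟨d, ⟨hd, hdc, (h.inter_nonempty_iff hc hd hdc.symm).1 hn⟩, rfl⟩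
  · rintro ⟨d, ⟨hd, hdc, hj⟩, rfl⟩
    exact ⟨h.mem_faces hd, fun e => hdc (h.seq.hexEdges_injOn hd hc e),
      (h.inter_nonempty_iff hc hd hdc.symm).2 hj⟩

theorem ncard_adjacentFaces (h : IsHexSystem G F l k) {c : Fin 6 → V} (hc : c ∈ l) :
    (adjacentFaces F (hexEdges c)).ncard = {d | d ∈ l ∧ d ≠ c ∧ ∃ j j', c j = d j'}.ncard := by
  rw [h.adjacentFaces_eq hc, (h.seq.hexEdges_injOn.mono fun d hd => hd.1).ncard_image]

theorem ncard_neighborSet_eq_two_iff (h : IsHexSystem G F l k) {c : Fin 6 → V} (hc : c ∈ l)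
    (j : Fin 6) : (G.neighborSet (c j)).ncard = 2 ↔ ¬ ∃ d ∈ l, d ≠ c ∧ c j ∈ Set.range d := by
  have hinj := h.seq.injective c hc
  rw [h.graph]
  constructor
  · intro h2 hs
    obtain ⟨w, hw, hadj⟩ := h.seq.hexGraph_adj_of_shared hc j hs
    have : (hexGraph l).neighborSet (c j) = {c (j + 1), c (j + 5), w} := by
      ext z; simp [hadj]
    rw [this, Set.ncard_insert_of_notMem, Set.ncard_pair] at h2
    · omega
    · exact fun e => hw ⟨_, e⟩
    · simp only [Set.mem_insert_iff, Set.mem_singleton_iff, not_or]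
      exact ⟨hinj.ne (by omega), fun e => hw ⟨_, e⟩⟩
  · intro hs
    have : (hexGraph l).neighborSet (c j) = {c (j + 1), c (j + 5)} := by
      ext z; simp [h.seq.hexGraph_adj_of_not_shared hc j hs]
    rw [this, Set.ncard_pair (hinj.ne (by omega))]

/-- At a kink the edges that `c` shares with `d` and `e` are separated by a single edge of `c`. This
leaves two adjacent vertices of `c`, and only the edge between them can be shared with a third
hexagon. If it is shared, `c` is branched; if not, its ends have degree two and `c` is angular. -/
theorem kinks_eq_zero (h : IsHexSystem G F l k) (hlin : HasLinearHexagons G F) : k = 0 := by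
  by_contra hk
  obtain ⟨c, hc, j, d, hd, e, he, hdc, hec, hde, ⟨jd, hjd⟩, ⟨je, hje⟩⟩ := h.seq.exists_kink hk
  have hinj := h.seq.injective c hc
  obtain ⟨hang, hbr⟩ := hlin (hexEdges c) (by rw [h.hexagons_eq]; exact h.mem_faces hc)
  rw [IsBranched, h.ncard_adjacentFaces hc] at hbr
  rw [IsAngular, h.ncard_adjacentFaces hc] at hang
  set N := {d | d ∈ l ∧ d ≠ c ∧ ∃ j j', c j = d j'} with hN
  have huniq : ∀ (m m1 m2 : Fin 6) (a b : Fin 6 → V), a ∈ l → b ∈ l → a ≠ c → b ≠ c →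
      a m1 = c m → b m2 = c m → a = b := by
    intro m m1 m2 a b ha hb hac hbc h1 h2
    rcases h.seq.two_of_three c hc a ha b hb m m1 m2 h1.symm (h1.trans h2.symm) with e | e | e
    exacts [absurd e.symm hac, absurd e.symm hbc, e]
  have hedge : ∀ a ∈ l, a ≠ c → ∀ m m', c m = a m' → ∃ i, (∃ m1, a m1 = c i) ∧
      (∃ m2, a m2 = c (i + 1)) ∧ ∀ m, c m ∈ Set.range a → m = i ∨ m = i + 1 := by
    intro a ha hac m m' hm
    obtain ⟨i, i', h1, h2, h3⟩ := h.seq.shared c hc a ha (Ne.symm hac) m m' hm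
    refine ⟨i, ⟨_, h1.symm⟩, ⟨_, h2.symm⟩, ?_⟩
    rintro m ⟨m', hm'⟩
    exact (h3 m m' hm'.symm).imp And.left And.left
  -- the edge shared with `d` ends in `c j`, the one shared with `e` starts in `c (j + 1)`
  obtain ⟨i, ⟨m1, hm1⟩, ⟨m2, hm2⟩, hi⟩ := hedge d hd hdc j jd hjd.symm
  obtain ⟨i', ⟨m1', hm1'⟩, ⟨m2', hm2'⟩, hi'⟩ := hedge e he hec (j + 1) je hje.symm
  have hij : j = i + 1 := by
    rcases hi j ⟨jd, hjd⟩ with e1 | e1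
    · subst e1
      exact absurd (huniq _ _ _ _ _ hd he hdc hec hm2 hje) hde
    · exact e1
  have hij' : j + 1 = i' := by
    rcases hi' (j + 1) ⟨je, hje⟩ with e1 | e1
    · exact e1
    · obtain rfl := add_right_cancel e1
      exact absurd (huniq _ _ _ _ _ hd he hdc hec hjd hm1') hde
  subst hij
  subst hij'
  have hN3 : ∀ a ∈ N, a = d ∨ a = e ∨ c (i + 4) ∈ Set.range a := by
    rintro a ⟨ha, hac, m, m', hm⟩
    obtain ⟨n, ⟨q1, hq1⟩, ⟨q2, hq2⟩, hn⟩ := hedge a ha hac m m' hm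
    have hcase : n = i ∨ n = i + 1 ∨ n = i + 1 + 1 ∨ n = i + 1 + 1 + 1 ∨ n + 1 = i ∨
        n = i + 4 := by omega
    rcases hcase with rfl | rfl | rfl | rfl | rfl | rfl
    · exact Or.inl (huniq _ _ _ _ _ ha hd hac hdc hq1 hm1)
    · exact Or.inl (huniq _ _ _ _ _ ha hd hac hdc hq1 hm2)
    · exact Or.inr (Or.inl (huniq _ _ _ _ _ ha he hac hec hq1 hm1'))
    · exact Or.inr (Or.inl (huniq _ _ _ _ _ ha he hac hec hq1 hm2'))
    · exact Or.inl (huniq _ _ _ _ _ ha hd hac hdc hq2 hm1)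
    · exact Or.inr (Or.inr ⟨q1, hq1⟩)
  have hdN : d ∈ N := ⟨hd, hdc, _, _, hjd.symm⟩
  have heN : e ∈ N := ⟨he, hec, _, _, hje.symm⟩
  by_cases hthird : ∃ a ∈ N, c (i + 4) ∈ Set.range a
  · obtain ⟨a, ⟨ha, hac, hj⟩, q, hq⟩ := hthird
    apply hbr
    have : N = {d, e, a} := by
      ext b
      simp only [Set.mem_insert_iff, Set.mem_singleton_iff]
      constructor
      · intro hb
        rcases hN3 b hb with rfl | rfl | ⟨q', hq'⟩
        exacts [Or.inl rfl, Or.inr (Or.inl rfl),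
          Or.inr (Or.inr (huniq _ _ _ _ _ hb.1 ha hb.2.1 hac hq' hq))]
      · rintro (rfl | rfl | rfl)
        exacts [hdN, heN, ⟨ha, hac, hj⟩]
    have hda : d ≠ a := by
      rintro rfl
      rcases hi (i + 4) ⟨q, hq⟩ with e | e <;> omega
    have hea : e ≠ a := by
      rintro rfl
      rcases hi' (i + 4) ⟨q, hq⟩ with e | e <;> omega
    rw [this, Set.ncard_insert_of_notMem (by simp [hde, hda]), Set.ncard_pair hea]
  · have hN2 : N = {d, e} := by
      ext b
      simp only [Set.mem_insert_iff, Set.mem_singleton_iff]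
      constructor
      · intro hb
        rcases hN3 b hb with h1 | h1 | h1
        exacts [Or.inl h1, Or.inr h1, absurd ⟨b, hb, h1⟩ hthird]
      · rintro (rfl | rfl)
        exacts [hdN, heN]
    have hfree : ∀ m, m = i + 4 ∨ m = i + 5 → ¬ ∃ a ∈ l, a ≠ c ∧ c m ∈ Set.range a := by
      rintro m hm ⟨a, ha, hac, q, hq⟩
      have haN : a ∈ N := ⟨ha, hac, m, q, hq.symm⟩
      rw [hN2] at haN
      rcases haN with rfl | rfl
      · rcases hi m ⟨q, hq⟩ with e | e <;> omega
      · rcases hi' m ⟨q, hq⟩ with e | e <;> omega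
    apply hang
    refine ⟨by rw [hN2, Set.ncard_pair hde], c (i + 4), ?_, c (i + 5), ?_,
      (h.ncard_neighborSet_eq_two_iff hc _).2 (hfree _ (Or.inl rfl)),
      (h.ncard_neighborSet_eq_two_iff hc _).2 (hfree _ (Or.inr rfl)), ?_⟩
    · rw [vertsOf_hexEdges]; exact ⟨_, rfl⟩
    · rw [vertsOf_hexEdges]; exact ⟨_, rfl⟩
    · rw [h.graph]
      exact (h.seq.hexGraph_adj_iff hc _ _).2 (Or.inl (by congr 1; omega))

/-! ### The hexagons of a phenylene -/

theorem vertex_adj (h : IsHexSystem G F l k) {c : Fin 6 → V} (hc : c ∈ l) (j : Fin 6) :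
    (phenyleneGraph F).Adj (h.vertex c hc j) (h.vertex c hc (j + 1)) := by
  rw [← h.phenyleneGraph_adj, h.toPhen_vertex, h.toPhen_vertex]
  exact ⟨hc, hc, Or.inl ⟨rfl, Or.inl rfl⟩⟩

theorem vertex_injective (h : IsHexSystem G F l k) {c : Fin 6 → V} (hc : c ∈ l) :
    Function.Injective (h.vertex c hc) := fun _ _ hij =>
  h.seq.injective c hc (congrArg (fun x : PhenyleneVertex F => x.1.1) hij)

theorem exists_vertex (h : IsHexSystem G F l k) {c : Fin 6 → V} (hc : c ∈ l)
    (x : PhenyleneVertex F) (hx : x.1.2 = hexEdges c) : ∃ j, x = h.vertex c hc j := by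
  have h1 : (h.toPhen x).1 = c := h.seq.hexEdges_injOn (h.toPhen_mem x) hc
    ((h.hexEdges_toPhen x).trans hx)
  refine ⟨(h.toPhen x).2, h.toPhen_injective ?_⟩
  rw [h.toPhen_vertex]
  exact Prod.ext h1 rfl

theorem phenyleneHexagon_eq (h : IsHexSystem G F l k) {c : Fin 6 → V} (hc : c ∈ l) :
    phenyleneHexagon F (hexEdges c) = hexEdges (h.vertex c hc) := by
  ext e
  constructor
  · rintro ⟨he, hC⟩
    induction e using Sym2.ind with
    | _ x y =>
      obtain ⟨i, rfl⟩ := h.exists_vertex hc x (hC x (Sym2.mem_mk_left _ _))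
      obtain ⟨j, rfl⟩ := h.exists_vertex hc y (hC y (Sym2.mem_mk_right _ _))
      rw [mem_edgeSet, ← h.phenyleneGraph_adj, h.toPhen_vertex, h.toPhen_vertex] at he
      rcases he with ⟨-, -, ⟨-, e | e⟩ | ⟨e, -⟩⟩
      · exact ⟨i, by rw [show j = i + 1 from e]⟩
      · refine ⟨j, ?_⟩
        rw [show i = j + 1 from e]
        exact Sym2.eq_swap
      · exact absurd rfl e
  · rintro ⟨j, rfl⟩
    refine ⟨h.vertex_adj hc j, fun x hx => ?_⟩
    rcases Sym2.mem_iff.1 hx with rfl | rfl <;> rfl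

theorem isCycleEdges_phenyleneHexagon (h : IsHexSystem G F l k) {C : Set (Sym2 V)} (hC : C ∈ F) :
    IsCycleEdges (phenyleneGraph F) 6 (phenyleneHexagon F C) := by
  rw [h.faces] at hC
  obtain ⟨c, hc, rfl⟩ := hC
  rw [h.phenyleneHexagon_eq hc]
  exact isCycleEdges_hexEdges (h.vertex_injective hc) fun i => h.vertex_adj hc i

theorem vertsOf_phenyleneHexagon (h : IsHexSystem G F l k) {C : Set (Sym2 V)} (hC : C ∈ F) :
    vertsOf (phenyleneHexagon F C) = {x | x.1.2 = C} := by
  rw [h.faces] at hC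
  obtain ⟨c, hc, rfl⟩ := hC
  rw [h.phenyleneHexagon_eq hc, vertsOf_hexEdges]
  ext x
  constructor
  · rintro ⟨j, rfl⟩; rfl
  · intro hx
    obtain ⟨j, hj⟩ := h.exists_vertex hc x hx
    exact ⟨j, hj.symm⟩

/-- Adjacent hexagons share one edge. -/
theorem exists_inter_eq (h : IsHexSystem G F l k) {C D : Set (Sym2 V)} (hC : C ∈ F) (hD : D ∈ F)
    (hne : C ≠ D) (hn : (C ∩ D).Nonempty) : ∃ a b, a ≠ b ∧ C ∩ D = {s(a, b)} := by
  rw [h.faces] at hC hD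
  obtain ⟨c, hc, rfl⟩ := hC
  obtain ⟨d, hd, rfl⟩ := hD
  have hcd : c ≠ d := fun e => hne (by rw [e])
  obtain ⟨j, j', hj⟩ := (h.inter_nonempty_iff hc hd hcd).1 hn
  obtain ⟨i, i', h1, h2, h3⟩ := h.seq.shared c hc d hd hcd j j' hj
  refine ⟨c i, c (i + 1), (h.seq.injective c hc).ne (by omega), ?_⟩
  ext e
  constructor
  · rintro ⟨⟨m, rfl⟩, m', hm'⟩
    have hm : (m = i ∨ m = i + 1) ∧ (m + 1 = i ∨ m + 1 = i + 1) := by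
      rcases Sym2.eq_iff.1 hm' with ⟨e1, e2⟩ | ⟨e1, e2⟩
      · exact ⟨(h3 _ _ e1.symm).imp And.left And.left, (h3 _ _ e2.symm).imp And.left And.left⟩
      · exact ⟨(h3 _ _ e2.symm).imp And.left And.left, (h3 _ _ e1.symm).imp And.left And.left⟩
    have : m = i := by omega
    rw [this]; rfl
  · rintro rfl
    refine ⟨⟨i, rfl⟩, i', ?_⟩
    rw [h1, h2]; exact Sym2.eq_swap

theorem vertsOf_singleton {a b : V} : vertsOf ({s(a, b)} : Set (Sym2 V)) = {a, b} := by
  ext x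
  simp [vertsOf]

/-- An upper bound is enough: it keeps a quadrilateral from being a 6-cycle, hence from counting as
a hexagon. -/
theorem ncard_vertsOf_phenyleneQuadrilateral_le [Finite V] (h : IsHexSystem G F l k)
    {C D : Set (Sym2 V)} (hC : C ∈ F) (hD : D ∈ F) (hne : C ≠ D) (hn : (C ∩ D).Nonempty) :
    (vertsOf (phenyleneQuadrilateral F C D)).ncard ≤ 4 := by
  obtain ⟨a, b, hab, hCD⟩ := h.exists_inter_eq hC hD hne hn
  have h1 : Subtype.val '' (vertsOf (phenyleneQuadrilateral F C D)) ⊆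
      ({a, b} : Set V) ×ˢ ({C, D} : Set (Set (Sym2 V))) := by
    rintro _ ⟨x, ⟨e, he, hx⟩, rfl⟩
    have := he.2 x hx
    rw [hCD, vertsOf_singleton] at this
    exact ⟨this.2, this.1⟩
  have h2 := Set.ncard_le_ncard h1
  rwa [Set.ncard_image_of_injective _ Subtype.val_injective, Set.ncard_prod, Set.ncard_pair hab,
    Set.ncard_pair hne] at h2

theorem not_isCycleEdges_phenyleneQuadrilateral [Finite V] (h : IsHexSystem G F l k)
    {C D : Set (Sym2 V)} (hC : C ∈ F) (hD : D ∈ F) (hne : C ≠ D) (hn : (C ∩ D).Nonempty) :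
    ¬ IsCycleEdges (phenyleneGraph F) 6 (phenyleneQuadrilateral F C D) := by
  intro hcyc
  have h1 := h.ncard_vertsOf_phenyleneQuadrilateral_le hC hD hne hn
  obtain ⟨c, hc, -, hc'⟩ := hcyc.exists_hexEdges
  rw [hc', vertsOf_hexEdges, ← Set.image_univ, Set.ncard_image_of_injective _ hc, Set.ncard_univ,
    Nat.card_eq_fintype_card, Fintype.card_fin] at h1
  omega

theorem hexagons_phenylene [Finite V] (h : IsHexSystem G F l k) :
    hexagons (phenyleneGraph F) (phenyleneFaces F) = phenyleneHexagon F '' F := by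
  ext B
  constructor
  · rintro ⟨⟨C, hC, rfl⟩ | ⟨C, hC, D, hD, hne, hn, rfl⟩, hcyc⟩
    · exact ⟨C, hC, rfl⟩
    · exact absurd hcyc (h.not_isCycleEdges_phenyleneQuadrilateral hC hD hne hn)
  · rintro ⟨C, hC, rfl⟩
    exact ⟨Or.inl ⟨C, hC, rfl⟩, h.isCycleEdges_phenyleneHexagon hC⟩

theorem phenyleneHexagon_nonempty (h : IsHexSystem G F l k) {C : Set (Sym2 V)} (hC : C ∈ F) :
    (phenyleneHexagon F C).Nonempty := by
  rw [h.faces] at hC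
  obtain ⟨c, hc, rfl⟩ := hC
  rw [h.phenyleneHexagon_eq hc]
  exact ⟨_, 0, rfl⟩

theorem eq_of_inter_phenyleneHexagon {C D : Set (Sym2 V)}
    (hn : (phenyleneHexagon F C ∩ phenyleneHexagon F D).Nonempty) : C = D := by
  obtain ⟨e, he, he'⟩ := hn
  induction e using Sym2.ind with
  | _ x y => exact (he.2 x (Sym2.mem_mk_left _ _)).symm.trans (he'.2 x (Sym2.mem_mk_left _ _))

theorem phenyleneHexagon_injOn (h : IsHexSystem G F l k) : Set.InjOn (phenyleneHexagon F) F := by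
  intro C hC D hD hCD
  apply eq_of_inter_phenyleneHexagon (F := F)
  rw [← hCD, Set.inter_self]
  exact h.phenyleneHexagon_nonempty hC

theorem ncard_hexagons_phenylene [Finite V] (h : IsHexSystem G F l k) :
    (hexagons (phenyleneGraph F) (phenyleneFaces F)).ncard = l.length := by
  rw [h.hexagons_phenylene, h.phenyleneHexagon_injOn.ncard_image, ← h.ncard_hexagons,
    h.hexagons_eq]

theorem phenyleneQuadrilateral_comm (C D : Set (Sym2 V)) :
    phenyleneQuadrilateral F C D = phenyleneQuadrilateral F D C := by
  ext e
  simp only [phenyleneQuadrilateral, Set.inter_comm C D, or_comm (a := _ = C)]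

theorem exists_mem_quadrilateral (h : IsHexSystem G F l k) {C D : Set (Sym2 V)} (hC : C ∈ F)
    (hD : D ∈ F) (hne : C ≠ D) (hn : (C ∩ D).Nonempty) :
    ∃ x y : PhenyleneVertex F, x.1.2 = C ∧ y.1.2 = D ∧ s(x, y) ∈ phenyleneQuadrilateral F C D := by
  obtain ⟨a, b, hab, hCD⟩ := h.exists_inter_eq hC hD hne hn
  have hmem : s(a, b) ∈ C ∩ D := by rw [hCD]; rfl
  refine ⟨⟨(a, C), hC, _, hmem.1, Sym2.mem_mk_left _ _⟩, ⟨(a, D), hD, _, hmem.2, Sym2.mem_mk_left _ _⟩,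
    rfl, rfl, Or.inr ⟨rfl, hne, _, hmem, Sym2.mem_mk_left _ _⟩, fun x hx => ?_⟩
  rcases Sym2.mem_iff.1 hx with rfl | rfl
  · exact ⟨Or.inl rfl, _, hmem, Sym2.mem_mk_left _ _⟩
  · exact ⟨Or.inr rfl, _, hmem, Sym2.mem_mk_left _ _⟩

theorem inter_quadrilateral_nonempty (h : IsHexSystem G F l k) {C D : Set (Sym2 V)} (hC : C ∈ F)
    (hD : D ∈ F) (hne : C ≠ D) (hn : (C ∩ D).Nonempty) :
    (phenyleneHexagon F C ∩ phenyleneQuadrilateral F C D).Nonempty := by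
  obtain ⟨a, b, hab, hCD⟩ := h.exists_inter_eq hC hD hne hn
  have hmem : s(a, b) ∈ C ∩ D := by rw [hCD]; rfl
  let x : PhenyleneVertex F := ⟨(a, C), hC, _, hmem.1, Sym2.mem_mk_left _ _⟩
  let y : PhenyleneVertex F := ⟨(b, C), hC, _, hmem.1, Sym2.mem_mk_right _ _⟩
  have hxy : (phenyleneGraph F).Adj x y := Or.inl ⟨rfl, hab, hmem.1⟩
  refine ⟨s(x, y), ⟨hxy, fun z hz => ?_⟩, ⟨hxy, fun z hz => ?_⟩⟩
  · rcases Sym2.mem_iff.1 hz with rfl | rfl <;> rfl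
  · rcases Sym2.mem_iff.1 hz with rfl | rfl
    · exact ⟨Or.inl rfl, _, hmem, Sym2.mem_mk_left _ _⟩
    · exact ⟨Or.inl rfl, _, hmem, Sym2.mem_mk_right _ _⟩

/-- Hexagons that have been pulled apart share no edge, so the neighbors of a hexagon are the
quadrilaterals replacing its former adjacencies. This lets branched and angular hexagons be
recognized in the squeeze. -/
theorem adjacentFaces_phenylene [Finite V] (h : IsHexSystem G F l k) {C : Set (Sym2 V)}
    (hC : C ∈ F) : adjacentFaces (phenyleneFaces F) (phenyleneHexagon F C) =
      phenyleneQuadrilateral F C '' adjacentFaces F C := by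
  ext B
  constructor
  · rintro ⟨⟨D, hD, rfl⟩ | ⟨D, hD, E, hE, hDE, hn, rfl⟩, hne, hn'⟩
    · exact absurd (by rw [eq_of_inter_phenyleneHexagon hn']) hne
    · obtain ⟨e, he, he'⟩ := hn'
      induction e using Sym2.ind with
      | _ x y =>
        have h1 := he.2 x (Sym2.mem_mk_left _ _)
        rcases (he'.2 x (Sym2.mem_mk_left _ _)).1 with h2 | h2
        · obtain rfl : C = D := h1.symm.trans h2
          exact ⟨E, ⟨hE, hDE.symm, hn⟩, rfl⟩
        · obtain rfl : C = E := h1.symm.trans h2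
          exact ⟨D, ⟨hD, hDE, by rwa [Set.inter_comm]⟩, phenyleneQuadrilateral_comm _ _⟩
  · rintro ⟨D, ⟨hD, hne, hn⟩, rfl⟩
    refine ⟨Or.inr ⟨C, hC, D, hD, hne.symm, hn, rfl⟩, ?_,
      h.inter_quadrilateral_nonempty hC hD hne.symm hn⟩
    intro heq
    apply h.not_isCycleEdges_phenyleneQuadrilateral hC hD hne.symm hn
    rw [heq]
    exact h.isCycleEdges_phenyleneHexagon hC

theorem ncard_adjacentFaces_phenylene [Finite V] (h : IsHexSystem G F l k) {C : Set (Sym2 V)}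
    (hC : C ∈ F) : (adjacentFaces (phenyleneFaces F) (phenyleneHexagon F C)).ncard =
      (adjacentFaces F C).ncard := by
  rw [h.adjacentFaces_phenylene hC, Set.InjOn.ncard_image]
  intro D hD E hE hDE
  obtain ⟨x, y, hx, hy, hxy⟩ := h.exists_mem_quadrilateral hC hD.1 hD.2.1.symm hD.2.2
  have hxy' : s(x, y) ∈ phenyleneQuadrilateral F C E := by
    have h' : phenyleneQuadrilateral F C D = phenyleneQuadrilateral F C E := hDE
    rwa [← h']
  rcases (hxy'.2 y (Sym2.mem_mk_right _ _)).1 with e | e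
  · exact absurd (hy.symm.trans e) hD.2.1
  · exact hy.symm.trans e

theorem ncard_phen_neighborSet_eq_two_iff (h : IsHexSystem G F l k) {c : Fin 6 → V} (hc : c ∈ l)
    (j : Fin 6) : ((phenyleneGraph F).neighborSet (h.vertex c hc j)).ncard = 2 ↔
      ¬ ∃ d ∈ l, d ≠ c ∧ c j ∈ Set.range d := by
  have himg : ((phenyleneGraph F).neighborSet (h.vertex c hc j)).ncard =
      ((phenGraph l).neighborSet (c, j)).ncard := by
    rw [← Set.ncard_image_of_injective _ h.toPhen_injective]
    congr 1
    ext q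
    constructor
    · rintro ⟨y, hy, rfl⟩
      have hy' : (phenyleneGraph F).Adj (h.vertex c hc j) y := hy
      rw [← h.phenyleneGraph_adj, h.toPhen_vertex] at hy'
      exact hy'
    · intro hq
      obtain ⟨y, rfl⟩ := h.mem_range_toPhen _ _ (G := G) ((phenGraph l).adj_symm hq)
      refine ⟨y, ?_, rfl⟩
      rw [mem_neighborSet, ← h.phenyleneGraph_adj, h.toPhen_vertex]
      exact hq
  rw [himg]
  have hinj : Function.Injective (Prod.mk c : Fin 6 → _) := Prod.mk_right_injective c
  constructor
  · intro h2 hs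
    obtain ⟨w, hw, hadj⟩ := h.seq.phenGraph_adj_of_shared hc j hs
    have : (phenGraph l).neighborSet (c, j) = {(c, j + 1), (c, j + 5), w} := by
      ext z; simp [hadj]
    rw [this, Set.ncard_insert_of_notMem, Set.ncard_pair] at h2
    · omega
    · exact fun e => hw ⟨_, e⟩
    · simp only [Set.mem_insert_iff, Set.mem_singleton_iff, not_or]
      exact ⟨hinj.ne (by omega), fun e => hw ⟨_, e⟩⟩
  · intro hs
    have : (phenGraph l).neighborSet (c, j) = {(c, j + 1), (c, j + 5)} := by
      ext z; simp [HexSeq.phenGraph_adj_of_not_shared hc j hs]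
    rw [this, Set.ncard_pair (hinj.ne (by omega))]

theorem isAngular_phenylene_iff [Finite V] (h : IsHexSystem G F l k) {C : Set (Sym2 V)}
    (hC : C ∈ F) : IsAngular (phenyleneGraph F) (phenyleneFaces F) (phenyleneHexagon F C) ↔
      IsAngular G F C := by
  rw [IsAngular, IsAngular, h.ncard_adjacentFaces_phenylene hC, h.vertsOf_phenyleneHexagon hC]
  rw [h.faces] at hC
  obtain ⟨c, hc, rfl⟩ := hC
  refine and_congr_right fun _ => ?_
  rw [vertsOf_hexEdges]
  constructor
  · rintro ⟨x, hx, y, hy, h1, h2, h3⟩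
    obtain ⟨i, rfl⟩ := h.exists_vertex hc x hx
    obtain ⟨j, rfl⟩ := h.exists_vertex hc y hy
    rw [h.ncard_phen_neighborSet_eq_two_iff, ← h.ncard_neighborSet_eq_two_iff hc] at h1 h2
    rw [← h.phenyleneGraph_adj, h.toPhen_vertex, h.toPhen_vertex] at h3
    refine ⟨c i, ⟨i, rfl⟩, c j, ⟨j, rfl⟩, h1, h2, ?_⟩
    rw [h.graph, h.seq.hexGraph_adj_iff hc]
    rcases h3 with ⟨-, -, ⟨-, e | e⟩ | ⟨e, -⟩⟩
    · exact Or.inl (by rw [show j = i + 1 from e])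
    · exact Or.inr (Or.inl (by rw [show i = j + 1 from e]; congr 1; omega))
    · exact absurd rfl e
  · rintro ⟨_, ⟨i, rfl⟩, _, ⟨j, rfl⟩, h1, h2, h3⟩
    refine ⟨h.vertex c hc i, rfl, h.vertex c hc j, rfl, ?_, ?_, ?_⟩
    · rwa [h.ncard_phen_neighborSet_eq_two_iff, ← h.ncard_neighborSet_eq_two_iff hc]
    · rwa [h.ncard_phen_neighborSet_eq_two_iff, ← h.ncard_neighborSet_eq_two_iff hc]
    -- A vertex of degree two has both neighbors on its own hexagon, so the edge survives when the
    -- hexagons are pulled apart.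
    · rw [h.ncard_neighborSet_eq_two_iff hc] at h1
      rw [h.graph, h.seq.hexGraph_adj_of_not_shared hc i h1] at h3
      have hinj := h.seq.injective c hc
      rcases h3 with e | e
      · obtain rfl := hinj e
        exact h.vertex_adj hc i
      · obtain rfl := hinj e
        have := (h.vertex_adj hc (i + 5)).symm
        rwa [show i + 5 + 1 = i by omega] at this

theorem hasLinearHexagons_phenylene_iff [Finite V] (h : IsHexSystem G F l k) :
    HasLinearHexagons (phenyleneGraph F) (phenyleneFaces F) ↔ HasLinearHexagons G F := by
  unfold HasLinearHexagons
  rw [h.hexagons_phenylene, Set.forall_mem_image, h.hexagons_eq]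
  refine forall₂_congr fun C hC => ?_
  rw [h.isAngular_phenylene_iff hC, IsBranched, IsBranched, h.ncard_adjacentFaces_phenylene hC]

end IsHexSystem

/-! ### Transport along graph isomorphisms -/

section Iso

variable {V W : Type*} {G : SimpleGraph V} {H : SimpleGraph W} (φ : G ≃g H)

theorem image_map_injective : Function.Injective fun C : Set (Sym2 V) => Sym2.map φ '' C :=
  Set.image_injective.2 (Sym2.map.injective φ.injective)

theorem image_map_symm (C : Set (Sym2 V)) : Sym2.map φ.symm '' (Sym2.map φ '' C) = C := by
  have h : ∀ e, Sym2.map φ.symm (Sym2.map φ e) = e := fun e => by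
    induction e using Sym2.ind with
    | _ a b => simp
  simp only [Set.image_image, h, Set.image_id']

theorem image_symm_map (D : Set (Sym2 W)) : Sym2.map φ '' (Sym2.map φ.symm '' D) = D := by
  have h : ∀ e, Sym2.map φ (Sym2.map φ.symm e) = e := fun e => by
    induction e using Sym2.ind with
    | _ a b => simp
  simp only [Set.image_image, h, Set.image_id']

theorem IsCycleEdges.map {n : ℕ} {C : Set (Sym2 V)} (h : IsCycleEdges G n C) :
    IsCycleEdges H n (Sym2.map φ '' C) := by
  obtain ⟨v, w, hw, hl, rfl⟩ := h
  refine ⟨φ v, w.map φ.toHom, hw.map φ.injective, by rw [Walk.length_map, hl], ?_⟩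
  ext e
  simp only [Walk.edges_map, List.mem_map, Set.mem_image, Set.mem_ofPred_eq]
  rfl

theorem isCycleEdges_map_iff {n : ℕ} {C : Set (Sym2 V)} :
    IsCycleEdges H n (Sym2.map φ '' C) ↔ IsCycleEdges G n C := by
  refine ⟨fun h => ?_, fun h => h.map φ⟩
  rw [← image_map_symm φ C]
  exact h.map φ.symm

theorem hexagons_map (F : Set (Set (Sym2 V))) :
    hexagons H ((fun C => Sym2.map φ '' C) '' F) = (fun C => Sym2.map φ '' C) '' hexagons G F := by
  ext D
  constructor
  · rintro ⟨⟨C, hC, rfl⟩, hD⟩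
    exact ⟨C, ⟨hC, (isCycleEdges_map_iff φ).1 hD⟩, rfl⟩
  · rintro ⟨C, ⟨hC, hD⟩, rfl⟩
    exact ⟨⟨C, hC, rfl⟩, (isCycleEdges_map_iff φ).2 hD⟩

theorem ncard_hexagons_map (F : Set (Set (Sym2 V))) :
    (hexagons H ((fun C => Sym2.map φ '' C) '' F)).ncard = (hexagons G F).ncard := by
  rw [hexagons_map, Set.ncard_image_of_injective _ (image_map_injective φ)]

theorem adjacentFaces_map (F : Set (Set (Sym2 V))) (C : Set (Sym2 V)) :
    adjacentFaces ((fun C => Sym2.map φ '' C) '' F) (Sym2.map φ '' C) =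
      (fun C => Sym2.map φ '' C) '' adjacentFaces F C := by
  have hinj := Sym2.map.injective φ.injective
  ext D
  constructor
  · rintro ⟨⟨D, hD, rfl⟩, hne, hn⟩
    dsimp only at hne hn
    rw [← Set.image_inter hinj, Set.image_nonempty] at hn
    exact ⟨D, ⟨hD, fun e => hne (by rw [e]), hn⟩, rfl⟩
  · rintro ⟨D, ⟨hD, hne, hn⟩, rfl⟩
    refine ⟨⟨D, hD, rfl⟩, fun e => hne (image_map_injective φ e), ?_⟩
    dsimp only
    rw [← Set.image_inter hinj, Set.image_nonempty]
    exact hn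

theorem vertsOf_map (C : Set (Sym2 V)) : vertsOf (Sym2.map φ '' C) = φ '' vertsOf C := by
  ext v
  constructor
  · rintro ⟨_, ⟨e, he, rfl⟩, hv⟩
    obtain ⟨u, hu, rfl⟩ := Sym2.mem_map.1 hv
    exact ⟨u, ⟨e, he, hu⟩, rfl⟩
  · rintro ⟨u, ⟨e, he, hu⟩, rfl⟩
    exact ⟨_, ⟨e, he, rfl⟩, Sym2.mem_map.2 ⟨u, hu, rfl⟩⟩

theorem ncard_neighborSet_map (u : V) :
    (H.neighborSet (φ u)).ncard = (G.neighborSet u).ncard := by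
  rw [← Set.ncard_image_of_injective _ φ.injective]
  congr 1
  ext w
  constructor
  · intro hw
    refine ⟨φ.symm w, ?_, by simp⟩
    rw [mem_neighborSet, ← φ.map_adj_iff]
    simpa using hw
  · rintro ⟨v, hv, rfl⟩
    exact φ.map_adj_iff.2 hv

theorem hasLinearHexagons_map (F : Set (Set (Sym2 V))) :
    HasLinearHexagons H ((fun C => Sym2.map φ '' C) '' F) ↔ HasLinearHexagons G F := by
  unfold HasLinearHexagons
  rw [hexagons_map, Set.forall_mem_image]
  refine forall₂_congr fun C hC => ?_
  rw [IsBranched, IsBranched, IsAngular, IsAngular, adjacentFaces_map,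
    Set.ncard_image_of_injective _ (image_map_injective φ), vertsOf_map]
  simp only [Set.exists_mem_image, ncard_neighborSet_map, φ.map_adj_iff]

/-- Isomorphic hexagonal squeezes have isomorphic phenylenes. -/
theorem phenyleneGraph_iso (φ : G ≃g H) {F : Set (Set (Sym2 V))} {F' : Set (Set (Sym2 W))}
    (hF : F = {C | IsCycleEdges G 6 C}) (hF' : F' = {C | IsCycleEdges H 6 C}) :
    Nonempty (phenyleneGraph F ≃g phenyleneGraph F') := by
  have hinj := Sym2.map.injective φ.injective
  -- Since the faces are all the 6-cycles, they depend on the graph alone, and an abstract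
  -- isomorphism respects them whatever the embeddings are.
  have hmem : ∀ C, Sym2.map φ '' C ∈ F' ↔ C ∈ F := by
    intro C
    rw [hF, hF']
    exact isCycleEdges_map_iff φ
  let f : PhenyleneVertex F → PhenyleneVertex F' := fun x =>
    ⟨(φ x.1.1, Sym2.map φ '' x.1.2), (hmem _).2 x.2.1, by
      rw [vertsOf_map]; exact ⟨_, x.2.2, rfl⟩⟩
  have hf : Function.Bijective f := by
    constructor
    · intro x y hxy
      have h1 := congrArg (fun z : PhenyleneVertex F' => z.1.1) hxy
      have h2 := congrArg (fun z : PhenyleneVertex F' => z.1.2) hxy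
      exact Subtype.ext (Prod.ext (φ.injective h1) (image_map_injective φ h2))
    · rintro ⟨⟨w, D⟩, hD, hw⟩
      refine ⟨⟨(φ.symm w, Sym2.map φ.symm '' D), ?_, ?_⟩, ?_⟩
      · rw [← hmem, image_symm_map]; exact hD
      · rw [vertsOf_map φ.symm]; exact ⟨w, hw, rfl⟩
      · apply Subtype.ext
        apply Prod.ext
        · simp [f]
        · exact image_symm_map φ D
  refine ⟨Equiv.ofBijective f hf, ?_⟩
  rintro ⟨⟨a, C⟩, hC⟩ ⟨⟨b, D⟩, hD⟩
  have hCD : Sym2.map φ '' C = Sym2.map φ '' D ↔ C = D := (image_map_injective φ).eq_iff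
  have hs : s(φ a, φ b) ∈ Sym2.map φ '' C ↔ s(a, b) ∈ C := by
    rw [← Sym2.map_mk, hinj.mem_set_image]
  simp only [Equiv.ofBijective_apply, f, phenyleneGraph, hCD, ne_eq, φ.injective.eq_iff, hs]
  refine or_congr Iff.rfl (and_congr_right fun _ => and_congr_right fun _ => ?_)
  rw [← Set.image_inter hinj, Set.exists_mem_image]
  refine exists_congr fun e => and_congr_right fun _ => ?_
  rw [Sym2.mem_map]
  constructor
  · rintro ⟨a', ha', h⟩; exact φ.injective h ▸ ha'
  · intro h; exact ⟨a, h, rfl⟩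

end Iso

/-! ### The ladder structure of linear chains -/

/-- Adjacency in the linear chain: two paths (`s` selects the path) joined by rungs at the even
positions. -/
def LadderAdj (s : Bool) (j : ℕ) (s' : Bool) (j' : ℕ) : Prop :=
  (s = s' ∧ (j' = j + 1 ∨ j = j' + 1)) ∨ (s ≠ s' ∧ j = j' ∧ j % 2 = 0)

/-- Up to isolated vertices, `G` is the ladder with `h` hexagons, with `f` as coordinates. -/
structure IsLadder {V : Type*} (G : SimpleGraph V) (h : ℕ) (f : Bool → ℕ → V) : Prop where
  inj : ∀ s j s' j', j ≤ 2 * h → j' ≤ 2 * h → f s j = f s' j' → s = s' ∧ j = j'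
  adj : ∀ a b, G.Adj a b ↔ ∃ s j s' j', j ≤ 2 * h ∧ j' ≤ 2 * h ∧ a = f s j ∧ b = f s' j' ∧
    LadderAdj s j s' j'

namespace IsLadder

variable {V : Type*} {G : SimpleGraph V} {h : ℕ} {f : Bool → ℕ → V}

theorem adj_iff (hf : IsLadder G h f) {s s' : Bool} {j j' : ℕ} (hj : j ≤ 2 * h)
    (hj' : j' ≤ 2 * h) : G.Adj (f s j) (f s' j') ↔ LadderAdj s j s' j' := by
  rw [hf.adj]
  constructor
  · rintro ⟨t, i, t', i', hi, hi', h1, h2, h3⟩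
    obtain ⟨rfl, rfl⟩ := hf.inj _ _ _ _ hj hi h1
    obtain ⟨rfl, rfl⟩ := hf.inj _ _ _ _ hj' hi' h2
    exact h3
  · intro h3
    exact ⟨s, j, s', j', hj, hj', rfl, rfl, h3⟩

theorem flip (hf : IsLadder G h f) : IsLadder G h fun s j => f (!s) j := by
  refine ⟨fun s j s' j' hj hj' e => ?_, fun a b => ?_⟩
  · obtain ⟨h1, h2⟩ := hf.inj _ _ _ _ hj hj' e
    exact ⟨by simpa using h1, h2⟩
  · rw [hf.adj]
    constructor
    · rintro ⟨s, j, s', j', hj, hj', rfl, rfl, hL⟩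
      exact ⟨!s, j, !s', j', hj, hj', by simp, by simp, by simpa [LadderAdj] using hL⟩
    · rintro ⟨s, j, s', j', hj, hj', rfl, rfl, hL⟩
      exact ⟨!s, j, !s', j', hj, hj', rfl, rfl, by simpa [LadderAdj] using hL⟩

/-- Rungs go to rungs because `2 * h` is even. -/
theorem ladderAdj_reverse {s s' : Bool} {j j' : ℕ} (hj : j ≤ 2 * h) (hj' : j' ≤ 2 * h)
    (hL : LadderAdj s j s' j') : LadderAdj s (2 * h - j) s' (2 * h - j') := by
  rcases hL with ⟨h1, h2⟩ | ⟨h1, h2, h3⟩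
  · exact Or.inl ⟨h1, by omega⟩
  · exact Or.inr ⟨h1, by omega, by omega⟩

theorem reverse (hf : IsLadder G h f) : IsLadder G h fun s j => f s (2 * h - j) := by
  refine ⟨fun s j s' j' hj hj' e => ?_, fun a b => ?_⟩
  · obtain ⟨h1, h2⟩ := hf.inj _ _ _ _ (by omega) (by omega) e
    exact ⟨h1, by omega⟩
  · rw [hf.adj]
    constructor
    · rintro ⟨s, j, s', j', hj, hj', rfl, rfl, hL⟩
      exact ⟨s, 2 * h - j, s', 2 * h - j', by omega, by omega, by congr 1; omega,
        by congr 1; omega, ladderAdj_reverse hj hj' hL⟩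
    · rintro ⟨s, j, s', j', hj, hj', rfl, rfl, hL⟩
      exact ⟨s, 2 * h - j, s', 2 * h - j', by omega, by omega, rfl, rfl,
        ladderAdj_reverse hj hj' hL⟩

theorem exists_adj (hf : IsLadder G h f) (hh : 0 < h) (s : Bool) {j : ℕ} (hj : j ≤ 2 * h) :
    ∃ b, G.Adj (f s j) b := by
  by_cases h0 : j = 0
  · exact ⟨f s 1, (hf.adj_iff hj (by omega)).2 (Or.inl ⟨rfl, by omega⟩)⟩
  · exact ⟨f s (j - 1), (hf.adj_iff hj (by omega)).2 (Or.inl ⟨rfl, by omega⟩)⟩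

/-- Vertices with at most two neighbors are at odd positions or at the ends. -/
theorem pos_of_degree_le_two (hf : IsLadder G h f) {s : Bool} {j : ℕ} (hj : j ≤ 2 * h)
    {a b : V} (hab : ∀ z, G.Adj (f s j) z → z = a ∨ z = b) : j % 2 = 1 ∨ j = 0 ∨ j = 2 * h := by
  by_contra! hc
  obtain ⟨h1, h2, h3⟩ := hc
  have e1 := hab (f s (j + 1)) ((hf.adj_iff hj (by omega)).2 (Or.inl ⟨rfl, by omega⟩))
  have e2 := hab (f s (j - 1)) ((hf.adj_iff hj (by omega)).2 (Or.inl ⟨rfl, by omega⟩))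
  have e3 := hab (f (!s) j) ((hf.adj_iff hj hj).2 (Or.inr ⟨by simp, rfl, by omega⟩))
  have n1 : f s (j + 1) ≠ f s (j - 1) := fun e => by
    have := (hf.inj _ _ _ _ (by omega) (by omega) e).2; omega
  have n2 : f s (j + 1) ≠ f (!s) j := fun e => by
    have := (hf.inj _ _ _ _ (by omega) (by omega) e).2; omega
  have n3 : f s (j - 1) ≠ f (!s) j := fun e => by
    have := (hf.inj _ _ _ _ (by omega) (by omega) e).2; omega
  grind

/-- An edge all of whose ends and their neighbors have degree two is the last rung, after a change
of coordinates. -/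
theorem exists_end (hf : IsLadder G h f) (hh : 2 ≤ h) {x y : V} (hxy : G.Adj x y)
    (hx : ∀ z, G.Adj x z → ∃ a b, ∀ w, G.Adj z w → w = a ∨ w = b)
    (hy : ∀ z, G.Adj y z → ∃ a b, ∀ w, G.Adj z w → w = a ∨ w = b) :
    ∃ g, IsLadder G h g ∧ g true (2 * h) = x ∧ g false (2 * h) = y := by
  obtain ⟨s, j, s', j', hj, hj', rfl, rfl, hL⟩ := (hf.adj x y).1 hxy
  have px : ∀ t i, i ≤ 2 * h → LadderAdj s j t i → i % 2 = 1 ∨ i = 0 ∨ i = 2 * h := by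
    intro t i hi hti
    obtain ⟨a, b, hab⟩ := hx (f t i) ((hf.adj_iff hj hi).2 hti)
    exact hf.pos_of_degree_le_two hi hab
  have py : ∀ t i, i ≤ 2 * h → LadderAdj s' j' t i → i % 2 = 1 ∨ i = 0 ∨ i = 2 * h := by
    intro t i hi hti
    obtain ⟨a, b, hab⟩ := hy (f t i) ((hf.adj_iff hj' hi).2 hti)
    exact hf.pos_of_degree_le_two hi hab
  have hL' : LadderAdj s' j' s j := (hf.adj_iff hj' hj).1 hxy.symm
  have q1 := px s' j' hj' hL
  have q2 := py s j hj hL'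
  -- Both ends are themselves at odd or extreme positions. An edge along a path has one end at an
  -- even position, which is then 0 or `2 * h`; the other end is next to position 2 or `2 * h - 2`,
  -- where there is an inner rung as `2 ≤ h`. So the edge is a rung, at one of the two extremes.
  have hend : s ≠ s' ∧ j = j' ∧ (j = 0 ∨ j = 2 * h) := by
    rcases hL with ⟨rfl, e | e⟩ | ⟨e1, e2, e3⟩
    · exfalso
      by_cases hp : j % 2 = 0
      · have := py s (j' + 1) (by omega) (Or.inl ⟨rfl, Or.inl rfl⟩); omega
      · have := px s (j - 1) (by omega) (Or.inl ⟨rfl, by omega⟩); omega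
    · exfalso
      by_cases hp : j' % 2 = 0
      · have := px s (j + 1) (by omega) (Or.inl ⟨rfl, Or.inl rfl⟩); omega
      · have := py s (j' - 1) (by omega) (Or.inl ⟨rfl, by omega⟩); omega
    · exact ⟨e1, e2, by omega⟩
  obtain ⟨hss, rfl, hj0⟩ := hend
  obtain ⟨g, hg, hgx, hgy⟩ : ∃ g, IsLadder G h g ∧ g s (2 * h) = f s j ∧
      g s' (2 * h) = f s' j := by
    rcases hj0 with rfl | rfl
    · exact ⟨_, hf.reverse, by simp, by simp⟩
    · exact ⟨f, hf, rfl, rfl⟩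
  cases s <;> cases s'
  · exact absurd rfl hss
  · exact ⟨_, hg.flip, hgx, hgy⟩
  · exact ⟨g, hg, hgx, hgy⟩
  · exact absurd rfl hss

theorem of_hexagon {c : Fin 6 → V} (hc : Function.Injective c)
    (hG : ∀ a b, G.Adj a b ↔ ∃ j, a = c j ∧ (b = c (j + 1) ∨ b = c (j + 5))) :
    ∃ g, IsLadder G 1 g ∧ g true 2 = c 2 ∧ g false 2 = c 3 := by
  -- One path is `0, 1, 2` and the other `5, 4, 3`; the rungs are the edges `05` and `23`.
  let p : Bool → ℕ → Fin 6 := fun s j => if s then Fin.ofNat 6 j else 5 - Fin.ofNat 6 j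
  have h1 : ∀ s s' : Bool, ∀ j < 3, ∀ j' < 3, p s j = p s' j' → s = s' ∧ j = j' := by decide
  have h2 : ∀ i : Fin 6, ∃ s : Bool, ∃ j < 3, i = p s j := by decide
  have h3 : ∀ s s' : Bool, ∀ j < 3, ∀ j' < 3, (p s' j' = p s j + 1 ∨ p s' j' = p s j + 5) ↔
      ((s = s' ∧ (j' = j + 1 ∨ j = j' + 1)) ∨ (s ≠ s' ∧ j = j' ∧ j % 2 = 0)) := by decide
  refine ⟨fun s j => c (p s j), ⟨fun s j s' j' hj hj' e => ?_, fun a b => ?_⟩, rfl, rfl⟩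
  · exact h1 s s' j (by omega) j' (by omega) (hc e)
  · rw [hG]
    constructor
    · rintro ⟨i, rfl, hb⟩
      obtain ⟨i', rfl, hi'⟩ : ∃ i', b = c i' ∧ (i' = i + 1 ∨ i' = i + 5) := by
        rcases hb with e | e
        exacts [⟨_, e, Or.inl rfl⟩, ⟨_, e, Or.inr rfl⟩]
      obtain ⟨s, j, hj, rfl⟩ := h2 i
      obtain ⟨s', j', hj', rfl⟩ := h2 i'
      exact ⟨s, j, s', j', by omega, by omega, rfl, rfl, (h3 s s' j hj j' hj').1 hi'⟩
    · rintro ⟨s, j, s', j', hj, hj', rfl, rfl, hL⟩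
      refine ⟨_, rfl, ?_⟩
      rcases (h3 s s' j (by omega) j' (by omega)).2 hL with e | e
      exacts [Or.inl (by rw [e]), Or.inr (by rw [e])]

/-- Attaching a hexagon to the last rung. -/
theorem extend {G' : SimpleGraph V} {x y u v p₁ p₂ p₃ p₄ : V} (hf : IsLadder G h f) (hh : 0 < h)
    (hE : HexEar G G' x y u v p₁ p₂ p₃ p₄) (hx : f true (2 * h) = x) (hy : f false (2 * h) = y) :
    ∃ g, IsLadder G' (h + 1) g := by
  let q : Bool → ℕ → V := fun s j =>
    if s then (if j = 2 * h + 1 then p₁ else p₂) else (if j = 2 * h + 1 then p₄ else p₃)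
  let g : Bool → ℕ → V := fun s j => if j ≤ 2 * h then f s j else q s j
  have gold : ∀ s j, j ≤ 2 * h → g s j = f s j := fun s j hj => if_pos hj
  have g1 : g true (2 * h + 1) = p₁ := by simp [g, q]
  have g2 : g true (2 * h + 2) = p₂ := by simp [g, q]
  have g3 : g false (2 * h + 2) = p₃ := by simp [g, q]
  have g4 : g false (2 * h + 1) = p₄ := by simp [g, q]
  have gx : g true (2 * h) = x := by rw [gold _ _ le_rfl, hx]
  have gy : g false (2 * h) = y := by rw [gold _ _ le_rfl, hy]
  have hnew : ∀ s j, j ≤ 2 * h → g s j ≠ p₁ ∧ g s j ≠ p₂ ∧ g s j ≠ p₃ ∧ g s j ≠ p₄ := by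
    intro s j hj
    rw [gold s j hj]
    obtain ⟨b, hb⟩ := hf.exists_adj hh s hj
    exact ⟨fun e => hE.n₁ b (e ▸ hb.symm), fun e => hE.n₂ b (e ▸ hb.symm),
      fun e => hE.n₃ b (e ▸ hb.symm), fun e => hE.n₄ b (e ▸ hb.symm)⟩
  have hnd := hE.nodup
  simp only [List.nodup_cons, List.mem_cons, List.not_mem_nil, or_false, not_or, not_false_eq_true,
    List.nodup_nil, and_true] at hnd
  obtain ⟨⟨d12, d13, d14⟩, ⟨d23, d24⟩, d34⟩ := hnd
  have hcases : ∀ (s : Bool) (j : ℕ), j ≤ 2 * (h + 1) → j ≤ 2 * h ∨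
      (j = 2 * h + 1 ∧ (s = true ∧ g s j = p₁ ∨ s = false ∧ g s j = p₄)) ∨
      (j = 2 * h + 2 ∧ (s = true ∧ g s j = p₂ ∨ s = false ∧ g s j = p₃)) := by
    intro s j hj
    by_cases h1 : j ≤ 2 * h
    · exact Or.inl h1
    · have : j = 2 * h + 1 ∨ j = 2 * h + 2 := by omega
      rcases this with rfl | rfl
      · refine Or.inr (Or.inl ⟨rfl, ?_⟩)
        cases s
        exacts [Or.inr ⟨rfl, g4⟩, Or.inl ⟨rfl, g1⟩]
      · refine Or.inr (Or.inr ⟨rfl, ?_⟩)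
        cases s
        exacts [Or.inr ⟨rfl, g3⟩, Or.inl ⟨rfl, g2⟩]
  refine ⟨g, fun s j s' j' hj hj' e => ?_, fun a b => ?_⟩
  · have n1 := hnew s j
    have n2 := hnew s' j'
    rcases hcases s j hj with h1 | h1 | h1 <;> rcases hcases s' j' hj' with h2 | h2 | h2
    · rw [gold _ _ h1, gold _ _ h2] at e
      exact hf.inj _ _ _ _ h1 h2 e
    all_goals grind
  · rw [hE.adj]
    have mk : ∀ (s : Bool) (j : ℕ) (s' : Bool) (j' : ℕ), j ≤ 2 * (h + 1) → j' ≤ 2 * (h + 1) →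
        LadderAdj s j s' j' → s(a, b) = s(g s j, g s' j') →
        ∃ s j s' j', j ≤ 2 * (h + 1) ∧ j' ≤ 2 * (h + 1) ∧ a = g s j ∧ b = g s' j' ∧
          LadderAdj s j s' j' := by
      intro s j s' j' hj hj' hL e
      rcases Sym2.eq_iff.1 e with ⟨e1, e2⟩ | ⟨e1, e2⟩
      · exact ⟨s, j, s', j', hj, hj', e1, e2, hL⟩
      · refine ⟨s', j', s, j, hj', hj, e1, e2, ?_⟩
        rcases hL with ⟨rfl, h2⟩ | ⟨h1, rfl, h3⟩
        exacts [Or.inl ⟨rfl, h2.symm⟩, Or.inr ⟨h1.symm, rfl, h3⟩]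
    constructor
    · rintro (hab | hab | hab | hab | hab | hab)
      · obtain ⟨s, j, s', j', hj, hj', rfl, rfl, hL⟩ := (hf.adj a b).1 hab
        exact ⟨s, j, s', j', by omega, by omega, (gold _ _ hj).symm, (gold _ _ hj').symm, hL⟩
      · exact mk true (2 * h) true (2 * h + 1) (by omega) (by omega) (Or.inl ⟨rfl, by omega⟩)
          (by rw [hab, gx, g1])
      · exact mk true (2 * h + 1) true (2 * h + 2) (by omega) (by omega) (Or.inl ⟨rfl, by omega⟩)
          (by rw [hab, g1, g2])
      · exact mk true (2 * h + 2) false (2 * h + 2) (by omega) (by omega)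
          (Or.inr ⟨by simp, rfl, by omega⟩) (by rw [hab, g2, g3])
      · exact mk false (2 * h + 2) false (2 * h + 1) (by omega) (by omega)
          (Or.inl ⟨rfl, by omega⟩) (by rw [hab, g3, g4])
      · exact mk false (2 * h + 1) false (2 * h) (by omega) (by omega)
          (Or.inl ⟨rfl, by omega⟩) (by rw [hab, g4, gy])
    · rintro ⟨s, j, s', j', hj, hj', rfl, rfl, hL⟩
      have hold : ∀ (t : Bool) (i : ℕ), i ≤ 2 * h → i + 1 = 2 * h + 1 →
          (t = true → g t i = x) ∧ (t = false → g t i = y) := by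
        intro t i hi hi'
        obtain rfl : i = 2 * h := by omega
        exact ⟨fun e => by rw [e, gx], fun e => by rw [e, gy]⟩
      have o1 := hold s j
      have o2 := hold s' j'
      rcases hcases s j hj with h1 | ⟨h1, h1'⟩ | ⟨h1, h1'⟩ <;>
        rcases hcases s' j' hj' with h2 | ⟨h2, h2'⟩ | ⟨h2, h2'⟩
      · left
        rw [gold _ _ h1, gold _ _ h2]
        exact (hf.adj_iff h1 h2).2 hL
      all_goals
        right
        simp only [Sym2.eq_iff]
        rcases hL with ⟨e1, e2⟩ | ⟨e1, e2, e3⟩ <;> first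
          | (exfalso; omega)
          | grind

end IsLadder

/-- The second clause is what the induction needs. Without a kink, the attaching edge and its
neighbors consist of vertices of degree two, so the edge can be taken as the last rung and the
ladder grows there. In a single hexagon every edge can be the last rung, by symmetry; in a longer
ladder `exists_end` applies. -/
theorem HexSeq.exists_isLadder {V : Type*} {l : List (Fin 6 → V)} {k : ℕ} (h : HexSeq l k)
    (hk : k = 0) : (∃ f, IsLadder (hexGraph l) l.length f) ∧
      ∀ x y, (hexGraph l).Adj x y →
        (∀ z, (hexGraph l).Adj x z → ∃ a b, ∀ w, (hexGraph l).Adj z w → w = a ∨ w = b) →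
        (∀ z, (hexGraph l).Adj y z → ∃ a b, ∀ w, (hexGraph l).Adj z w → w = a ∨ w = b) →
        ∃ f, IsLadder (hexGraph l) l.length f ∧ f true (2 * l.length) = x ∧
          f false (2 * l.length) = y := by
  induction h with
  | single c hc =>
    have hG : ∀ {a b}, (hexGraph [c]).Adj a b ↔
        ∃ j, a = c j ∧ (b = c (j + 1) ∨ b = c (j + 5)) := by
      intro a b
      rw [(HexSeq.single c hc).hexGraph_adj]
      simp
    refine ⟨?_, fun x y hxy _ _ => ?_⟩
    · obtain ⟨g, hg, -⟩ := IsLadder.of_hexagon hc fun a b => hG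
      exact ⟨g, hg⟩
    · obtain ⟨j, rfl, hb⟩ := hG.1 hxy
      rcases hb with rfl | rfl
      · obtain ⟨g, hg, h1, h2⟩ := IsLadder.of_hexagon (G := hexGraph [c])
          (c := fun i => c (j + 4 + i)) (fun a b e => add_left_cancel (hc e)) fun a b => by
          rw [hG]
          constructor
          · rintro ⟨i, rfl, hb⟩
            refine ⟨i - (j + 4), by congr 1; omega, ?_⟩
            rcases hb with rfl | rfl
            exacts [Or.inl (by congr 1; omega), Or.inr (by congr 1; omega)]
          · rintro ⟨i, rfl, hb⟩
            refine ⟨_, rfl, ?_⟩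
            rcases hb with rfl | rfl
            exacts [Or.inl (by congr 1; omega), Or.inr (by congr 1; omega)]
        exact ⟨g, hg, h1.trans (by congr 1; omega), h2.trans (by congr 1; omega)⟩
      · obtain ⟨g, hg, h1, h2⟩ := IsLadder.of_hexagon (G := hexGraph [c])
          (c := fun i => c (j + 2 - i)) (fun a b e => sub_right_injective (hc e)) fun a b => by
          rw [hG]
          constructor
          · rintro ⟨i, rfl, hb⟩
            refine ⟨j + 2 - i, by congr 1; omega, ?_⟩
            rcases hb with rfl | rfl
            exacts [Or.inr (by congr 1; omega), Or.inl (by congr 1; omega)]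
          · rintro ⟨i, rfl, hb⟩
            refine ⟨_, rfl, ?_⟩
            rcases hb with rfl | rfl
            exacts [Or.inr (by congr 1; omega), Or.inl (by congr 1; omega)]
        exact ⟨g, hg, h1.trans (by congr 1; omega), h2.trans (by congr 1; omega)⟩
  | @cons l k c d i hl hcl hd h0 h5 h ih =>
    have hns : ∀ j, sharedCount l c (c j) = 0 → ¬ ∃ c' ∈ l, c' ≠ c ∧ c j ∈ Set.range c' := by
      intro j hj hs
      rw [sharedCount, if_pos hs] at hj
      exact one_ne_zero hj
    have hdeg : ∀ j, (¬ ∃ c' ∈ l, c' ≠ c ∧ c j ∈ Set.range c') →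
        ∃ a b, ∀ w, (hexGraph l).Adj (c j) w → w = a ∨ w = b := fun j hj =>
      ⟨_, _, fun w hw => (hl.hexGraph_adj_of_not_shared hcl j hj w).1 hw⟩
    have hs0 := not_shared_of_attach h0.symm h
    have hs1 := not_shared_of_attach h5.symm h
    have hs5 := hns (i + 5) (by omega)
    have hs2 := hns (i + 2) (by omega)
    have hE := hl.hexEar hcl hd h0 h5 h
    obtain ⟨-, hend⟩ := ih (by omega)
    obtain ⟨f, hf, hfx, hfy⟩ := hend (c i) (c (i + 1)) ((hE.nx _).2 (Or.inl rfl))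
      (fun z hz => by
        rcases (hE.nx z).1 hz with rfl | rfl
        exacts [hdeg _ hs1, hdeg _ hs5])
      (fun z hz => by
        rcases (hE.ny z).1 hz with rfl | rfl
        exacts [hdeg _ hs0, hdeg _ hs2])
    obtain ⟨g, hg⟩ := hf.extend hl.length_pos hE hfx hfy
    refine ⟨⟨g, hg⟩, fun x y hxy hx hy => ?_⟩
    exact hg.exists_end (by have := hl.length_pos; omega) hxy hx hy

/-- The ladder with `h` hexagons. -/
def ladderGraph (h : ℕ) : SimpleGraph {p : Bool × ℕ // p.2 ≤ 2 * h} where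
  Adj p q := LadderAdj p.1.1 p.1.2 q.1.1 q.1.2
  symm := ⟨fun p q hpq => by
    rcases hpq with ⟨h1, h2⟩ | ⟨h1, h2, h3⟩
    exacts [Or.inl ⟨h1.symm, h2.symm⟩, Or.inr ⟨h1.symm, h2.symm, h2 ▸ h3⟩]⟩
  loopless := ⟨fun p hp => by
    rcases hp with ⟨-, h2⟩ | ⟨h1, -⟩
    · omega
    · exact h1 rfl⟩

theorem IsHexSystem.iso_ladderGraph {V : Type*} {G : SimpleGraph V} {F : Set (Set (Sym2 V))}
    {l : List (Fin 6 → V)} (h : IsHexSystem G F l 0) :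
    Nonempty (ladderGraph l.length ≃g G) := by
  obtain ⟨⟨f, hf⟩, -⟩ := h.seq.exists_isLadder rfl
  rw [← h.graph] at hf
  refine ⟨Equiv.ofBijective (fun p => f p.1.1 p.1.2) ⟨?_, ?_⟩, ?_⟩
  · rintro ⟨⟨s, j⟩, hj⟩ ⟨⟨s', j'⟩, hj'⟩ e
    obtain ⟨rfl, rfl⟩ := hf.inj s j s' j' hj hj' e
    rfl
  · intro v
    obtain ⟨c, hc, j, rfl⟩ := h.cover v
    have hadj : G.Adj (c j) (c (j + 1)) := by
      rw [h.graph]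
      exact (h.seq.hexGraph_adj_iff hc j _).2 (Or.inl rfl)
    obtain ⟨s, i, -, -, hi, -, e, -⟩ := (hf.adj _ _).1 hadj
    exact ⟨⟨(s, i), hi⟩, e.symm⟩
  · rintro ⟨⟨s, j⟩, hj⟩ ⟨⟨s', j'⟩, hj'⟩
    exact hf.adj_iff hj hj'

/-! ### Existence of linear chains -/

/-- Adjacency in the linear chain, numbered along its boundary: vertex `i` faces vertex
`4 * h + 1 - i`. -/
def ChainAdj (h i j : ℕ) : Prop :=
  i + 1 = j ∨ j + 1 = i ∨
    (i + j = 4 * h + 1 ∧ (i % 2 = 0 ∧ i ≤ 2 * h ∨ j % 2 = 0 ∧ j ≤ 2 * h))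

/-- The linear chain with `h` hexagons. -/
def chainGraph (h : ℕ) : SimpleGraph (Fin (4 * h + 2)) where
  Adj i j := ChainAdj h i j
  symm := ⟨fun i j hij => by unfold ChainAdj at *; omega⟩
  loopless := ⟨fun i hi => by unfold ChainAdj at *; omega⟩

theorem chainGraph_adj {h : ℕ} {i j : Fin (4 * h + 2)} :
    (chainGraph h).Adj i j ↔ i.1 + 1 = j ∨ j.1 + 1 = i ∨
    (i.1 + j = 4 * h + 1 ∧ (i.1 % 2 = 0 ∧ i.1 ≤ 2 * h ∨ j.1 % 2 = 0 ∧ j.1 ≤ 2 * h)) := Iff.rfl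

/-! ### Arithmetic of the rotation and of the face labels -/

namespace chainGraph

/-- The successor on the boundary. -/
def next (h i : ℕ) : ℕ := if i = 4 * h + 1 then 0 else i + 1

/-- The predecessor on the boundary. -/
def prev (h i : ℕ) : ℕ := if i = 0 then 4 * h + 1 else i - 1

/-- The rotation at the vertex `i`. -/
def turn (h i j : ℕ) : ℕ :=
  -- The cyclic order at a vertex is successor, predecessor, and then the rung if there is an inner
  -- one.
  if j = next h i then prev h i
  else if j = prev h i then
    (if i % 2 = 0 ∧ 0 < i ∧ i < 2 * h ∨ i % 2 = 1 ∧ 2 * h + 1 < i ∧ i < 4 * h + 1 then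
      4 * h + 1 - i else next h i)
  else next h i

/-- The face to the side of the dart from `i` to `j`; the label `h` is that of the outer face. -/
def label (h i j : ℕ) : ℕ :=
  -- Darts running backwards along the boundary belong to the outer face. Forward darts and inner
  -- rungs belong to a hexagon, which is read off from the position of `i`.
  if i = next h j then h
  else if j = next h i then
    if i < 2 * h then i / 2 else if i = 2 * h then h - 1
    else if i < 4 * h + 1 then (4 * h - i) / 2 else 0
  else if i < 2 * h then i / 2 - 1 else (4 * h + 1 - i) / 2

variable {h : ℕ}

theorem turn_adj (hh : 1 ≤ h) {i : ℕ} (hi : i < 4 * h + 2) (j : ℕ) :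
    turn h i j < 4 * h + 2 ∧ ChainAdj h i (turn h i j) := by
  unfold ChainAdj turn next prev
  split_ifs <;> omega

theorem turn_injective (hh : 1 ≤ h) {i j j' : ℕ} (hi : i < 4 * h + 2) (hj : j < 4 * h + 2)
    (hj' : j' < 4 * h + 2) (hij : ChainAdj h i j) (hij' : ChainAdj h i j')
    (e : turn h i j = turn h i j') : j = j' := by
  unfold ChainAdj turn next prev at *
  split_ifs at e <;> omega

theorem turn_next {i j : ℕ} (hij : i = next h j) :
    turn h j i = prev h j := by
  unfold turn
  rw [if_pos hij]

theorem label_of_eq_next {i j : ℕ} (hij : i = next h j) : label h i j = h := if_pos hij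

theorem turn_prev_of_chord (hh : 1 ≤ h) {i : ℕ} (hi : i < 4 * h + 2)
    (hc : i % 2 = 0 ∧ 0 < i ∧ i < 2 * h ∨ i % 2 = 1 ∧ 2 * h + 1 < i ∧ i < 4 * h + 1) :
    turn h i (i - 1) = 4 * h + 1 - i := by
  unfold turn
  rw [if_neg (by unfold next; split_ifs <;> omega), if_pos (by unfold prev; split_ifs <;> omega),
    if_pos hc]

theorem turn_eq_next {i j : ℕ} (hij : i ≠ next h j)
    (hc : i = prev h j →
      ¬ (j % 2 = 0 ∧ 0 < j ∧ j < 2 * h ∨ j % 2 = 1 ∧ 2 * h + 1 < j ∧ j < 4 * h + 1)) :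
    turn h j i = next h j := by
  unfold turn
  rw [if_neg hij]
  split_ifs with h1 h2
  exacts [absurd h2 (hc h1), rfl, rfl]

theorem label_next (hh : 1 ≤ h) (i : ℕ) : label h i (next h i) =
    if i < 2 * h then i / 2 else if i = 2 * h then h - 1
    else if i < 4 * h + 1 then (4 * h - i) / 2 else 0 := by
  unfold label
  rw [if_neg (by unfold next; split_ifs <;> omega), if_pos rfl]

theorem label_chord {i j : ℕ} (hij : i ≠ next h j)
    (hji : j ≠ next h i) :
    label h i j = if i < 2 * h then i / 2 - 1 else (4 * h + 1 - i) / 2 := by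
  unfold label
  rw [if_neg hij, if_neg hji]

theorem next_lt {i : ℕ} (hi : i < 4 * h + 2) : next h i < 4 * h + 2 := by
  unfold next; split_ifs <;> omega

theorem next_prev {i : ℕ} (hi : i < 4 * h + 2) : next h (prev h i) = i := by
  unfold prev next; split_ifs <;> omega

/-- The dart from `i` to `j` is followed on its face by the one from `j` to `turn h j i`, so this is
the invariance of the label along faces. -/
theorem label_turn (hh : 1 ≤ h) {i j : ℕ} (hi : i < 4 * h + 2) (hj : j < 4 * h + 2)
    (hij : ChainAdj h i j) : label h j (turn h j i) = label h i j := by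
  by_cases h1 : i = next h j
  · rw [turn_next h1, label_of_eq_next h1, label_of_eq_next (next_prev hj).symm]
  by_cases h2 : j = next h i
  · by_cases hc : j % 2 = 0 ∧ 0 < j ∧ j < 2 * h ∨ j % 2 = 1 ∧ 2 * h + 1 < j ∧ j < 4 * h + 1
    · have hi' : i = j - 1 := by unfold next at h2; split_ifs at h2 <;> omega
      rw [h2, label_next hh i, ← h2, hi', turn_prev_of_chord hh hj hc,
        label_chord (by unfold next; split_ifs <;> omega)
          (by unfold next; split_ifs <;> omega)]
      split_ifs <;> omega
    · rw [turn_eq_next h1 fun _ => hc, label_next hh j, h2, label_next hh i]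
      unfold next at *
      split_ifs at * <;> omega
  · have h3 : i ≠ prev h j := fun e => h2 (by rw [e, next_prev hj])
    rw [turn_eq_next h1 fun e => absurd e h3, label_next hh j, label_chord h1 h2]
    unfold next at *
    unfold ChainAdj at hij
    split_ifs at * <;> omega

end chainGraph

theorem Equiv.Perm.SameCycle.eq_of_invariant {α β : Type*} [Finite α] {f : Equiv.Perm α}
    {a : α → β} (ha : ∀ x, a (f x) = a x) {x y : α} (h : f.SameCycle x y) : a x = a y := by
  obtain ⟨n, -, rfl⟩ := h.exists_pow_eq'
  clear h
  induction n with
  | zero => rfl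
  | succ n ih => rw [pow_succ', Equiv.Perm.mul_apply, ha, ← ih]

/-! ### The rotation on darts and the corners of the hexagons -/

namespace chainGraph

variable {h : ℕ}

instance : Finite (chainGraph h).Dart :=
  Finite.of_injective Dart.toProd Dart.toProd_injective

/-- The dart from `i` to `j`. -/
def dart {i j : ℕ} (hi : i < 4 * h + 2) (hj : j < 4 * h + 2) (hij : ChainAdj h i j) :
    (chainGraph h).Dart := ⟨(⟨i, hi⟩, ⟨j, hj⟩), hij⟩

theorem dart_ext {d e : (chainGraph h).Dart} (h1 : d.fst.1 = e.fst.1) (h2 : d.snd.1 = e.snd.1) :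
    d = e := Dart.toProd_injective (Prod.ext (Fin.ext h1) (Fin.ext h2))

/-- The rotation of the darts. -/
noncomputable def rotation (hh : 1 ≤ h) : Equiv.Perm (chainGraph h).Dart :=
  Equiv.ofBijective
    (fun d => dart d.fst.2 (turn_adj hh d.fst.2 d.snd).1
      (turn_adj hh d.fst.2 d.snd).2)
    (Finite.injective_iff_bijective.1 fun d e hde => by
      have h1 : d.fst.1 = e.fst.1 := by
        simpa [dart] using congrArg (fun x : (chainGraph h).Dart => x.fst.1) hde
      have h2 : turn h d.fst.1 d.snd.1 = turn h e.fst.1 e.snd.1 := by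
        simpa [dart] using congrArg (fun x : (chainGraph h).Dart => x.snd.1) hde
      rw [← h1] at h2
      exact dart_ext h1 (turn_injective hh d.fst.2 d.snd.2 e.snd.2 d.adj (h1 ▸ e.adj) h2))

theorem rotation_apply (hh : 1 ≤ h) (d : (chainGraph h).Dart) :
    (rotation hh d).fst.1 = d.fst ∧ (rotation hh d).snd.1 = turn h d.fst d.snd := ⟨rfl, rfl⟩

theorem adj_next (h i : ℕ) : ChainAdj h i (next h i) := by
  unfold ChainAdj next; split_ifs <;> omega

theorem adj_next' (h i : ℕ) : ChainAdj h (next h i) i := by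
  unfold ChainAdj next; split_ifs <;> omega

theorem adj_cases (hh : 1 ≤ h) {i j : ℕ} (hi : i < 4 * h + 2) (hj : j < 4 * h + 2)
    (hij : ChainAdj h i j) : j = next h i ∨ j = prev h i ∨
      (i % 2 = 0 ∧ 0 < i ∧ i < 2 * h ∨ i % 2 = 1 ∧ 2 * h + 1 < i ∧ i < 4 * h + 1) ∧
        j = 4 * h + 1 - i := by
  unfold ChainAdj at hij
  unfold next prev
  split_ifs <;> omega

/-- Every dart at a vertex is reached from the dart to the boundary successor in at most two turns.
-/
theorem rotation_cyclic (hh : 1 ≤ h) (d e : (chainGraph h).Dart) (hde : d.fst = e.fst) :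
    (rotation hh).SameCycle d e := by
  have key : ∀ d : (chainGraph h).Dart, (rotation hh).SameCycle
      (dart d.fst.2 (next_lt d.fst.2) (adj_next h d.fst)) d := by
    intro d
    set d₀ := dart d.fst.2 (next_lt d.fst.2) (adj_next h d.fst)
    rcases adj_cases hh d.fst.2 d.snd.2 d.adj with h1 | h1 | ⟨h1, h2⟩
    · rw [show d = d₀ from dart_ext rfl h1]
    · rw [show d = rotation hh d₀ from dart_ext rfl (h1.trans (turn_next rfl).symm)]
      exact Equiv.Perm.SameCycle.rfl.apply_right
    · rw [show d = rotation hh (rotation hh d₀) from dart_ext rfl ?_]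
      · exact Equiv.Perm.SameCycle.rfl.apply_right.apply_right
      · rw [h2, (rotation_apply hh _).2, (rotation_apply hh _).1, (rotation_apply hh _).2]
        change 4 * h + 1 - d.fst.1 = turn h d.fst (turn h d.fst (next h d.fst))
        rw [turn_next rfl, show prev h d.fst.1 = d.fst.1 - 1 from if_neg (by omega),
          turn_prev_of_chord hh d.fst.2 h1]
  refine (key d).symm.trans ?_
  rw [show dart d.fst.2 (next_lt d.fst.2) (adj_next h d.fst) =
    dart e.fst.2 (next_lt e.fst.2) (adj_next h e.fst) from
      dart_ext (congrArg Fin.val hde) (congrArg (fun x : Fin _ => next h x) hde)]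
  exact key e

/-- The label of the face to the side of a dart. -/
def faceLabel (d : (chainGraph h).Dart) : ℕ := label h d.fst d.snd

theorem faceLabel_facePerm (hh : 1 ≤ h) (d : (chainGraph h).Dart) :
    faceLabel (facePerm (rotation hh) d) = faceLabel d :=
  label_turn hh d.fst.2 d.snd.2 d.adj

theorem faceLabel_eq (hh : 1 ≤ h) {d e : (chainGraph h).Dart}
    (hde : (facePerm (rotation hh)).SameCycle d e) : faceLabel d = faceLabel e :=
  hde.eq_of_invariant (faceLabel_facePerm hh)

/-- The corners of the `k`-th hexagon. -/
def corner (h k : ℕ) : Fin 6 → ℕ :=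
  ![2 * k, 2 * k + 1, 2 * k + 2, 4 * h - 1 - 2 * k, 4 * h - 2 * k, 4 * h + 1 - 2 * k]

theorem corner_lt {k : ℕ} (hk : k < h) (i : Fin 6) : corner h k i < 4 * h + 2 := by
  fin_cases i <;> simp [corner] <;> omega

theorem corner_adj {k : ℕ} (hk : k < h) (i : Fin 6) :
    ChainAdj h (corner h k i) (corner h k (i + 1)) := by
  fin_cases i <;> simp [corner, ChainAdj] <;> omega

theorem corner_injective {k : ℕ} (hk : k < h) : Function.Injective (corner h k) := by
  intro i j hij
  fin_cases i <;> fin_cases j <;> simp [corner] at hij ⊢ <;> omega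

theorem label_corner (hh : 1 ≤ h) {k : ℕ} (hk : k < h) (i : Fin 6) :
    label h (corner h k i) (corner h k (i + 1)) = k := by
  have fwd : ∀ i j, j = next h i → (i < 2 * h → i / 2 = k) → (i = 2 * h → h - 1 = k) →
      (2 * h < i → i < 4 * h + 1 → (4 * h - i) / 2 = k) → (4 * h + 1 ≤ i → k = 0) →
      label h i j = k := by
    rintro i _ rfl h1 h2 h3 h4
    rw [label_next hh]
    split_ifs <;> omega
  have hn : ∀ i j, (i = 4 * h + 1 → j = 0) → (i ≠ 4 * h + 1 → j = i + 1) → j = next h i := by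
    intro i j h1 h2
    unfold next
    split_ifs <;> omega
  fin_cases i
  · exact fwd (2 * k) (2 * k + 1) (hn _ _ (by omega) (by omega)) (by omega) (by omega) (by omega)
      (by omega)
  · exact fwd (2 * k + 1) (2 * k + 2) (hn _ _ (by omega) (by omega)) (by omega) (by omega)
      (by omega) (by omega)
  · change label h (2 * k + 2) (4 * h - 1 - 2 * k) = k
    by_cases hk' : k + 1 = h
    · exact fwd _ _ (hn _ _ (by omega) (by omega)) (by omega) (by omega) (by omega) (by omega)
    · rw [label_chord (by unfold next; split_ifs <;> omega) (by unfold next; split_ifs <;> omega),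
        if_pos (by omega)]
      omega
  · exact fwd (4 * h - 1 - 2 * k) (4 * h - 2 * k) (hn _ _ (by omega) (by omega)) (by omega)
      (by omega) (by omega) (by omega)
  · exact fwd (4 * h - 2 * k) (4 * h + 1 - 2 * k) (hn _ _ (by omega) (by omega)) (by omega)
      (by omega) (by omega) (by omega)
  · change label h (4 * h + 1 - 2 * k) (2 * k) = k
    by_cases hk' : k = 0
    · exact fwd _ _ (hn _ _ (by omega) (by omega)) (by omega) (by omega) (by omega) (by omega)
    · rw [label_chord (by unfold next; split_ifs <;> omega) (by unfold next; split_ifs <;> omega),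
        if_neg (by omega)]
      omega

/-- The face permutation visits the corners of a hexagon in order, so the darts with its label form
a single face. -/
theorem turn_corner (hh : 1 ≤ h) {k : ℕ} (hk : k < h) (i : Fin 6) :
    turn h (corner h k (i + 1)) (corner h k i) = corner h k (i + 2) := by
  have fwd : ∀ u v w, (v = 4 * h + 1 → w = 0) → (v ≠ 4 * h + 1 → w = v + 1) → u ≠ w →
      (u + 1 = v → v = 2 * h ∨ v = 2 * h + 1 ∨ v = 4 * h + 1 ∨ v % 2 = 1 ∧ v < 2 * h ∨
        v % 2 = 0 ∧ 2 * h < v) → turn h v u = w := by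
    intro u v w h1 h2 h3 h4
    have hw : w = next h v := by unfold next; split_ifs <;> omega
    rw [hw, turn_eq_next (hw ▸ h3)]
    unfold prev
    split_ifs <;> omega
  fin_cases i
  · exact fwd (2 * k) (2 * k + 1) (2 * k + 2) (by omega) (by omega) (by omega) (by omega)
  · change turn h (2 * k + 2) (2 * k + 1) = 4 * h - 1 - 2 * k
    by_cases hk' : k + 1 = h
    · exact fwd _ _ _ (by omega) (by omega) (by omega) (by omega)
    · exact (turn_prev_of_chord hh (i := 2 * k + 2) (by omega) (by omega)).trans (by omega)
  · exact fwd (2 * k + 2) (4 * h - 1 - 2 * k) (4 * h - 2 * k) (by omega) (by omega) (by omega)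
      (by omega)
  · exact fwd (4 * h - 1 - 2 * k) (4 * h - 2 * k) (4 * h + 1 - 2 * k) (by omega) (by omega)
      (by omega) (by omega)
  · change turn h (4 * h + 1 - 2 * k) (4 * h - 2 * k) = 2 * k
    by_cases hk' : k = 0
    · exact fwd _ _ _ (by omega) (by omega) (by omega) (by omega)
    · exact (congrArg _ (by omega)).trans
        ((turn_prev_of_chord hh (i := 4 * h + 1 - 2 * k) (by omega) (by omega)).trans (by omega))
  · exact fwd (4 * h + 1 - 2 * k) (2 * k) (2 * k + 1) (by omega) (by omega) (by omega) (by omega)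

/-- The darts with label `k` are those around the `k`-th hexagon. -/
theorem exists_corner (hh : 1 ≤ h) {i j : ℕ} (hi : i < 4 * h + 2) (hj : j < 4 * h + 2)
    (hij : ChainAdj h i j) {k : ℕ} (hk : k < h) (hl : label h i j = k) :
    ∃ t : Fin 6, i = corner h k t ∧ j = corner h k (t + 1) := by
  by_cases h1 : i = next h j
  · rw [label_of_eq_next h1] at hl
    omega
  by_cases h2 : j = next h i
  · rw [h2, label_next hh] at hl
    clear hij h1
    have hj' : (i = 4 * h + 1 → j = 0) ∧ (i ≠ 4 * h + 1 → j = i + 1) := by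
      unfold next at h2
      split_ifs at h2 <;> omega
    clear h2
    split_ifs at hl with c1 c2 c3
    · rcases Nat.even_or_odd' i with ⟨m, rfl | rfl⟩
      · obtain rfl : m = k := by omega
        exact ⟨0, rfl, hj'.2 (by omega)⟩
      · obtain rfl : m = k := by omega
        exact ⟨1, rfl, hj'.2 (by omega)⟩
    · refine ⟨2, ?_, (hj'.2 (by omega)).trans ?_⟩
      · change i = 2 * k + 2
        omega
      · change i + 1 = 4 * h - 1 - 2 * k
        omega
    · by_cases he : i % 2 = 0
      · refine ⟨4, ?_, (hj'.2 (by omega)).trans ?_⟩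
        · change i = 4 * h - 2 * k
          omega
        · change i + 1 = 4 * h + 1 - 2 * k
          omega
      · refine ⟨3, ?_, (hj'.2 (by omega)).trans ?_⟩
        · change i = 4 * h - 1 - 2 * k
          omega
        · change i + 1 = 4 * h - 2 * k
          omega
    · refine ⟨5, ?_, (hj'.1 (by omega)).trans ?_⟩
      · change i = 4 * h + 1 - 2 * k
        omega
      · change 0 = 2 * k
        omega
  · rw [label_chord h1 h2] at hl
    have hij' : i + j = 4 * h + 1 ∧ (i % 2 = 0 ∧ i ≤ 2 * h ∨ j % 2 = 0 ∧ j ≤ 2 * h) := by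
      unfold ChainAdj at hij
      unfold next at h1 h2
      split_ifs at h1 h2 <;> omega
    have h0 : i ≠ 0 := fun e => h1 (by unfold next; split_ifs <;> omega)
    clear hij h1 h2
    split_ifs at hl with c
    · refine ⟨2, ?_, ?_⟩
      · change i = 2 * k + 2
        omega
      · change j = 4 * h - 1 - 2 * k
        omega
    · refine ⟨5, ?_, ?_⟩
      · change i = 4 * h + 1 - 2 * k
        omega
      · change j = 2 * k
        omega

/-- The darts with label `h` are those along the boundary. -/
theorem eq_next_of_label (hh : 1 ≤ h) {i j : ℕ} (hi : i < 4 * h + 2) (hj : j < 4 * h + 2)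
    (hij : ChainAdj h i j) (hl : label h i j = h) : i = next h j := by
  by_contra hc
  unfold ChainAdj at hij
  by_cases h2 : j = next h i
  · rw [h2, label_next hh] at hl
    split_ifs at hl <;> omega
  · rw [label_chord hc h2] at hl
    unfold next at *
    split_ifs at * <;> omega

theorem label_le (hh : 1 ≤ h) {i j : ℕ} (hi : i < 4 * h + 2) : label h i j ≤ h := by
  unfold label
  split_ifs <;> omega

end chainGraph

/-! ### Euler's formula, 2-connectedness and the embedding of the chain -/

namespace chainGraph

variable {h : ℕ}

theorem sameCycle_of_faceLabel_lt (hh : 1 ≤ h) {k : ℕ} (hk : k < h) {d : (chainGraph h).Dart}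
    (hd : faceLabel d = k) : (facePerm (rotation hh)).SameCycle
      (dart (corner_lt hk 0) (corner_lt hk (0 + 1)) (corner_adj hk 0)) d := by
  let D : Fin 6 → (chainGraph h).Dart := fun t =>
    dart (corner_lt hk t) (corner_lt hk (t + 1)) (corner_adj hk t)
  have step : ∀ t, facePerm (rotation hh) (D t) = D (t + 1) := fun t =>
    dart_ext rfl ((turn_corner hh hk t).trans
      (congrArg (corner h k) (show t + 2 = t + 1 + 1 by rw [add_assoc]; rfl)))
  have all : ∀ t, (facePerm (rotation hh)).SameCycle (D 0) (D t) := by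
    intro t
    induction t using Fin.induction with
    | zero => exact Equiv.Perm.SameCycle.rfl
    | succ t ih =>
      have := ih.apply_right
      rw [step] at this
      convert this using 2
      simp
  obtain ⟨t, h1, h2⟩ := exists_corner hh d.fst.2 d.snd.2 d.adj hk hd
  rw [show d = D t from dart_ext h1 h2]
  exact all t

theorem sameCycle_of_faceLabel_eq (hh : 1 ≤ h) {d : (chainGraph h).Dart} (hd : faceLabel d = h) :
    (facePerm (rotation hh)).SameCycle
      (dart (next_lt (Nat.succ_pos _)) (Nat.succ_pos _) (adj_next' h 0)) d := by
  have all : ∀ (i : ℕ) (hi : i < 4 * h + 2), (facePerm (rotation hh)).SameCycle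
      (dart (next_lt (Nat.succ_pos _)) (Nat.succ_pos _) (adj_next' h 0))
      (dart (next_lt hi) hi (adj_next' h i)) := by
    intro i hi
    induction i with
    | zero => exact Equiv.Perm.SameCycle.rfl
    | succ i ih =>
      refine (ih (by omega)).trans (Equiv.Perm.SameCycle.symm ?_)
      have e : facePerm (rotation hh) (dart (next_lt hi) hi (adj_next' h (i + 1))) =
          dart (next_lt (by omega)) (by omega) (adj_next' h i) :=
        dart_ext (if_neg (by omega)).symm ((turn_next rfl).trans (if_neg (by omega)))
      rw [← e]
      exact Equiv.Perm.SameCycle.rfl.apply_right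
  rw [show d = dart (next_lt d.snd.2) d.snd.2 (adj_next' h d.snd) from
    dart_ext (eq_next_of_label hh d.fst.2 d.snd.2 d.adj hd) rfl]
  exact all _ _

/-- The faces are exactly the fibers of the label, which reduces counting and recognizing faces to
arithmetic. -/
theorem sameCycle_iff (hh : 1 ≤ h) {d e : (chainGraph h).Dart} :
    (facePerm (rotation hh)).SameCycle d e ↔ faceLabel d = faceLabel e := by
  refine ⟨faceLabel_eq hh, fun hde => ?_⟩
  rcases (label_le hh (j := d.snd.1) d.fst.2).lt_or_eq with hk | hk
  · exact (sameCycle_of_faceLabel_lt hh hk rfl).symm.trans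
      (sameCycle_of_faceLabel_lt hh hk hde.symm)
  · exact (sameCycle_of_faceLabel_eq hh hk).symm.trans
      (sameCycle_of_faceLabel_eq hh (hde.symm.trans hk))

theorem card_faces (hh : 1 ≤ h) :
    Nat.card (Quotient (Equiv.Perm.SameCycle.setoid (facePerm (rotation hh)))) = h + 1 := by
  let f : Quotient (Equiv.Perm.SameCycle.setoid (facePerm (rotation hh))) → Fin (h + 1) :=
    Quotient.lift (fun d => ⟨faceLabel d, Nat.lt_succ_of_le (label_le hh d.fst.2)⟩)
      fun d e hde => Fin.ext (faceLabel_eq hh hde)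
  rw [Nat.card_congr (Equiv.ofBijective f ⟨?_, ?_⟩), Nat.card_fin]
  · intro x y
    induction x, y using Quotient.inductionOn₂ with
    | _ d e => exact fun hde => Quotient.sound ((sameCycle_iff hh).2 (congrArg Fin.val hde))
  · rintro ⟨k, hk⟩
    rcases (Nat.lt_succ_iff.1 hk).lt_or_eq with hk' | hk'
    · exact ⟨Quotient.mk _ (dart (corner_lt hk' 0) (corner_lt hk' (0 + 1)) (corner_adj hk' 0)),
        Fin.ext (label_corner hh hk' 0)⟩
    · exact ⟨Quotient.mk _ (dart (next_lt (Nat.succ_pos _)) (Nat.succ_pos _) (adj_next' h 0)),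
        Fin.ext ((label_of_eq_next (i := next h 0) rfl).trans hk'.symm)⟩

theorem card_edgeSet (hh : 1 ≤ h) : Nat.card (chainGraph h).edgeSet = 5 * h + 1 := by
  -- The edges are listed as the `4 * h + 2` boundary edges, the last of which closes up, followed
  -- by the `h - 1` inner rungs starting at `2, 4, …, 2 * h - 2`.
  let a : ℕ → ℕ := fun t => if t < 4 * h + 2 then t else 2 * (t - (4 * h + 2)) + 2
  let b : ℕ → ℕ := fun t =>
    if t < 4 * h + 1 then t + 1 else if t = 4 * h + 1 then 0
    else 4 * h - 1 - 2 * (t - (4 * h + 2))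
  have key : ∀ t < 5 * h + 1, a t < 4 * h + 2 ∧ b t < 4 * h + 2 ∧ ChainAdj h (a t) (b t) := by
    intro t ht
    unfold ChainAdj
    simp only [a, b]
    split_ifs <;> omega
  let f : Fin (5 * h + 1) → (chainGraph h).edgeSet := fun t =>
    ⟨s(⟨a t, (key t t.2).1⟩, ⟨b t, (key t t.2).2.1⟩), (key t t.2).2.2⟩
  have hf : Function.Bijective f := by
    constructor
    · intro t t' e
      have ht := t.2
      have ht' := t'.2
      have e' := congrArg Subtype.val e
      simp only [f, Sym2.eq_iff, Fin.mk.injEq, a, b] at e'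
      apply Fin.ext
      split_ifs at e' <;> omega
    · rintro ⟨e, he⟩
      induction e using Sym2.ind with
      | _ x y =>
        have main : ∀ x y : Fin (4 * h + 2), ChainAdj h x y → x < y → ∃ t, (f t).1 = s(x, y) := by
          intro x y hxy hlt
          have hx := x.2
          have hy := y.2
          have hlt' : x.1 < y.1 := hlt
          have mk : ∀ t (ht : t < 5 * h + 1), (a t = x ∧ b t = y ∨ a t = y ∧ b t = x) →
              ∃ t, (f t).1 = s(x, y) := fun t ht e => ⟨⟨t, ht⟩, by
            simpa only [f, Sym2.eq_iff, Fin.ext_iff] using e⟩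
          unfold ChainAdj at hxy
          by_cases h1 : x.1 + 1 = y
          · refine mk x (by omega) (Or.inl ⟨if_pos (by omega), ?_⟩)
            rw [← h1]
            exact if_pos (by omega)
          · by_cases h2 : x.1 = 0
            · refine mk (4 * h + 1) (by omega) (Or.inr ⟨?_, ?_⟩)
              · simp only [a]; split_ifs <;> omega
              · simp only [b]; split_ifs <;> omega
            · refine mk (4 * h + 2 + (x.1 / 2 - 1)) (by omega) (Or.inl ⟨?_, ?_⟩)
              · simp only [a]; split_ifs <;> omega
              · simp only [b]; split_ifs <;> omega
        have hxy : (chainGraph h).Adj x y := he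
        rcases lt_or_gt_of_ne hxy.ne with hlt | hlt
        · obtain ⟨t, ht⟩ := main x y hxy hlt
          exact ⟨t, Subtype.ext ht⟩
        · obtain ⟨t, ht⟩ := main y x hxy.symm hlt
          exact ⟨t, Subtype.ext (ht.trans Sym2.eq_swap)⟩
  rw [← Nat.card_congr (Equiv.ofBijective f hf), Nat.card_fin]

theorem connected (h : ℕ) : (chainGraph h).Connected := by
  have key : ∀ (i : ℕ) (hi : i < 4 * h + 2), (chainGraph h).Reachable 0 ⟨i, hi⟩ := by
    intro i hi
    induction i with
    | zero => exact Reachable.refl _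
    | succ i ih =>
      exact (ih (by omega)).trans (Adj.reachable (chainGraph_adj.2 (Or.inl rfl)))
  exact (connected_iff_exists_forall_reachable _).2 ⟨0, fun i => key i.1 i.2⟩

theorem isTwoConnected (hh : 1 ≤ h) : IsTwoConnected (chainGraph h) := by
  refine ⟨by rw [Nat.card_fin]; omega, connected h, fun v => ?_⟩
  have hv := v.2
  -- The boundary cycle is listed starting just after `v`, so that the removal of `v` leaves a path.
  let p : ℕ → ℕ := fun t => if v.1 + 1 + t < 4 * h + 2 then v.1 + 1 + t
    else v.1 + 1 + t - (4 * h + 2)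
  have hp : ∀ t < 4 * h + 1, p t < 4 * h + 2 ∧ p t ≠ v.1 := by
    intro t ht
    simp only [p]
    split_ifs <;> omega
  let q : ∀ t, t < 4 * h + 1 → ({v}ᶜ : Set (Fin (4 * h + 2))) := fun t ht =>
    ⟨⟨p t, (hp t ht).1⟩, fun e => (hp t ht).2 (congrArg Fin.val e)⟩
  have key : ∀ t ht, ((chainGraph h).induce {v}ᶜ).Reachable (q 0 (by omega)) (q t ht) := by
    intro t ht
    induction t with
    | zero => exact Reachable.refl _
    | succ t ih =>
      refine (ih (by omega)).trans (Adj.reachable ?_)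
      change ChainAdj h (p t) (p (t + 1))
      unfold ChainAdj
      simp only [p]
      split_ifs <;> omega
  refine (connected_iff_exists_forall_reachable _).2 ⟨q 0 (by omega), ?_⟩
  rintro ⟨w, hw⟩
  have hw' : w.1 ≠ v.1 := fun e => hw (Fin.ext e)
  have hw2 := w.2
  obtain ⟨t, ht, e⟩ : ∃ t, t < 4 * h + 1 ∧ p t = w := by
    rcases lt_or_gt_of_ne hw' with hlt | hlt
    · exact ⟨w + (4 * h + 1 - v), by omega, by simp only [p]; split_ifs <;> omega⟩
    · exact ⟨w - v - 1, by omega, by simp only [p]; split_ifs <;> omega⟩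
  rw [show (⟨w, hw⟩ : ({v}ᶜ : Set (Fin (4 * h + 2)))) = q t ht from Subtype.ext (Fin.ext e.symm)]
  exact key t ht

/-- The plane embedding of the linear chain. -/
noncomputable def embedding (hh : 1 ≤ h) : PlaneEmbedding (chainGraph h) where
  rot := rotation hh
  rot_fst _ := rfl
  rot_cyclic := rotation_cyclic hh
  connected := connected h
  euler := by
    rw [card_faces, card_edgeSet hh, Nat.card_fin]
    omega
  outer := dart (next_lt (Nat.succ_pos _)) (Nat.succ_pos _) (adj_next' h 0)

/-- The boundary of the `k`-th hexagon. -/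
def hexagon (k : Fin h) : Set (Sym2 (Fin (4 * h + 2))) :=
  hexEdges fun i => ⟨corner h k i, corner_lt k.2 i⟩

theorem isCycleEdges_hexagon (k : Fin h) : IsCycleEdges (chainGraph h) 6 (hexagon k) :=
  isCycleEdges_hexEdges (fun _ _ e => corner_injective k.2 (congrArg Fin.val e))
    fun i => corner_adj k.2 i

theorem innerFaces_embedding (hh : 1 ≤ h) :
    (embedding hh).innerFaces = Set.range (hexagon (h := h)) := by
  have hb : ∀ (k : Fin h) (d : (chainGraph h).Dart), faceLabel d = k →
      (embedding hh).boundary d = hexagon k := by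
    intro k d hd
    ext e
    constructor
    · rintro ⟨d', hd', rfl⟩
      obtain ⟨t, h1, h2⟩ := exists_corner hh d'.fst.2 d'.snd.2 d'.adj k.2
        ((faceLabel_eq hh hd').symm.trans hd)
      exact ⟨t, Sym2.eq_iff.2 (Or.inl ⟨Fin.ext h1.symm, Fin.ext h2.symm⟩)⟩
    · rintro ⟨t, rfl⟩
      exact ⟨dart (corner_lt k.2 t) (corner_lt k.2 (t + 1)) (corner_adj k.2 t),
        (sameCycle_iff hh).2 (hd.trans (label_corner hh k.2 t).symm), rfl⟩
  have ho : faceLabel (embedding hh).outer = h := label_of_eq_next rfl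
  ext C
  constructor
  · rintro ⟨d, hd, rfl⟩
    have hne : faceLabel d ≠ h := fun e => hd ((sameCycle_iff hh).2 (ho.trans e.symm))
    have hlt : faceLabel d < h := lt_of_le_of_ne (label_le hh d.fst.2) hne
    exact ⟨⟨_, hlt⟩, (hb ⟨_, hlt⟩ d rfl).symm⟩
  · rintro ⟨k, rfl⟩
    refine ⟨dart (corner_lt k.2 0) (corner_lt k.2 (0 + 1)) (corner_adj k.2 0), fun hd => ?_,
      (hb k (dart (corner_lt k.2 0) (corner_lt k.2 (0 + 1)) (corner_adj k.2 0))
        (label_corner hh k.2 0)).symm⟩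
    have := faceLabel_eq hh hd
    rw [ho] at this
    have h2 : h = k := this.trans (label_corner hh k.2 0)
    have := k.2
    omega

end chainGraph

theorem hexEdges_rotate {V : Type*} (c : Fin 6 → V) (j : Fin 6) :
    hexEdges (fun i => c (j + i)) = hexEdges c := by
  ext e
  constructor
  · rintro ⟨i, rfl⟩
    exact ⟨j + i, by simp only [add_assoc]⟩
  · rintro ⟨i, rfl⟩
    exact ⟨i - j, by simp only [← add_assoc, add_sub_cancel]⟩

theorem hexEdges_reflect {V : Type*} (c : Fin 6 → V) :
    hexEdges (fun i => c (-i)) = hexEdges c := by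
  have h1 : ∀ i : Fin 6, -(i + 1) + 1 = -i := by decide
  have h2 : ∀ i : Fin 6, -(-(i + 1) + 1) = i := by decide
  ext e
  constructor
  · rintro ⟨i, rfl⟩
    refine ⟨-(i + 1), ?_⟩
    dsimp only
    rw [Sym2.eq_swap, h1]
  · rintro ⟨i, rfl⟩
    refine ⟨-(i + 1), ?_⟩
    dsimp only
    rw [Sym2.eq_swap, neg_neg, h2]

/-! ### The 6-cycles of the chain and its linearity -/

namespace chainGraph

variable {h : ℕ}

/-- The vertex `v` belongs to the `k`-th hexagon. -/
def InHexagon (h k v : ℕ) : Prop :=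
  2 * k ≤ v ∧ v ≤ 2 * k + 2 ∨ 4 * h ≤ v + 1 + 2 * k ∧ v + 2 * k ≤ 4 * h + 1

theorem inHexagon_iff {k : ℕ} (hk : k < h) {v : ℕ} :
    InHexagon h k v ↔ ∃ t, v = corner h k t := by
  constructor
  · intro hv
    have : v = 2 * k ∨ v = 2 * k + 1 ∨ v = 2 * k + 2 ∨ v = 4 * h - 1 - 2 * k ∨
        v = 4 * h - 2 * k ∨ v = 4 * h + 1 - 2 * k := by
      rcases hv with hv | hv <;> omega
    rcases this with e | e | e | e | e | e
    exacts [⟨0, e⟩, ⟨1, e⟩, ⟨2, e⟩, ⟨3, e⟩, ⟨4, e⟩, ⟨5, e⟩]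
  · rintro ⟨t, rfl⟩
    unfold InHexagon
    fin_cases t <;> simp [corner] <;> omega

theorem eq_succ_of_corner_adj {k : ℕ} (hk : k < h) {t t' : Fin 6}
    (hadj : ChainAdj h (corner h k t) (corner h k t')) : t' = t + 1 ∨ t = t' + 1 := by
  unfold ChainAdj at hadj
  fin_cases t <;> fin_cases t' <;> first
    | exact Or.inl rfl
    | exact Or.inr rfl
    | (exfalso; simp only [corner, Fin.zero_eta, Fin.mk_one, Fin.reduceFinMk, Matrix.cons_val] at hadj
       omega)

theorem mem_vertsOf_hexagon {k : Fin h} {v : Fin (4 * h + 2)} :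
    v ∈ vertsOf (hexagon k) ↔ InHexagon h k v := by
  rw [hexagon, vertsOf_hexEdges, inHexagon_iff k.2]
  exact exists_congr fun t => by rw [Fin.ext_iff, eq_comm]

/-- Each hexagon is an induced subgraph, so questions about its edges become inequalities between
positions. -/
theorem mem_hexagon {k : Fin h} {a b : Fin (4 * h + 2)} :
    s(a, b) ∈ hexagon k ↔ ChainAdj h a b ∧ InHexagon h k a ∧ InHexagon h k b := by
  constructor
  · rintro ⟨t, ht⟩
    have h1 := (inHexagon_iff k.2).2 ⟨t, rfl⟩
    have h2 := (inHexagon_iff k.2).2 ⟨t + 1, rfl⟩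
    have h3 := corner_adj k.2 t
    rcases Sym2.eq_iff.1 ht with ⟨rfl, rfl⟩ | ⟨rfl, rfl⟩
    · exact ⟨h3, h1, h2⟩
    · exact ⟨(chainGraph h).symm.symm _ _ h3, h2, h1⟩
  · rintro ⟨h1, h2, h3⟩
    obtain ⟨t, ht⟩ := (inHexagon_iff k.2).1 h2
    obtain ⟨t', ht'⟩ := (inHexagon_iff k.2).1 h3
    rw [ht, ht'] at h1
    rcases eq_succ_of_corner_adj k.2 h1 with rfl | rfl
    · exact ⟨t, Sym2.eq_iff.2 (Or.inl ⟨Fin.ext ht.symm, Fin.ext ht'.symm⟩)⟩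
    · exact ⟨t', Sym2.eq_iff.2 (Or.inr ⟨Fin.ext ht'.symm, Fin.ext ht.symm⟩)⟩

theorem hexagon_injective : Function.Injective (hexagon (h := h)) := by
  intro k k' e
  have hk := k.2
  have hk' := k'.2
  have h1 : (⟨2 * k + 1, by omega⟩ : Fin (4 * h + 2)) ∈ vertsOf (hexagon k') := by
    rw [← e, mem_vertsOf_hexagon]
    left
    simp
  rw [mem_vertsOf_hexagon] at h1
  unfold InHexagon at h1
  apply Fin.ext
  dsimp only at h1
  omega

/-- A 6-cycle starting along the upper path at its leftmost position is a hexagon. -/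
theorem exists_eq_corner {c : Fin 6 → Fin (4 * h + 2)} (hc : Function.Injective c)
    (hG : ∀ i, (chainGraph h).Adj (c i) (c (i + 1)))
    (hmin : ∀ i, (c 0).1 ≤ c i ∧ (c 0).1 + c i ≤ 4 * h + 1) (h1 : (c 1).1 = c 0 + 1) :
    ∃ k : Fin h, ∀ i, (c i).1 = corner h k i := by
  have hne : ∀ i j : Fin 6, i ≠ j → (c i).1 ≠ c j := fun i j hij e => hij (hc (Fin.ext e))
  have a1 := chainGraph_adj.1 (hG 1)
  have a2 := chainGraph_adj.1 (hG 2)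
  have a3 := chainGraph_adj.1 (hG 3)
  have a4 := chainGraph_adj.1 (hG 4)
  have a5 := chainGraph_adj.1 (hG 5)
  rw [show (1 : Fin 6) + 1 = 2 from rfl] at a1
  rw [show (2 : Fin 6) + 1 = 3 from rfl] at a2
  rw [show (3 : Fin 6) + 1 = 4 from rfl] at a3
  rw [show (4 : Fin 6) + 1 = 5 from rfl] at a4
  rw [show (5 : Fin 6) + 1 = 0 from rfl] at a5
  have m1 := hmin 1
  have m2 := hmin 2
  have m3 := hmin 3
  have m4 := hmin 4
  have m5 := hmin 5
  have n02 := hne 0 2 (by decide)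
  have n04 := hne 0 4 (by decide)
  have n13 := hne 1 3 (by decide)
  have n15 := hne 1 5 (by decide)
  have n24 := hne 2 4 (by decide)
  have n35 := hne 3 5 (by decide)
  have b := (c 0).2
  have e5 : (c 0).1 + c 5 = 4 * h + 1 ∧ (c 0).1 % 2 = 0 := by clear a1 a2 a3 a4; omega
  have e4 : (c 4).1 + 1 = c 5 := by clear a1 a2 a3 a5; omega
  have e2 : (c 2).1 = c 1 + 1 := by clear a2 a3 a4 a5; omega
  have e3 : (c 3).1 + 1 = c 4 := by clear a1 a2 a4 a5; omega
  have e6 : (c 2).1 + c 3 = 4 * h + 1 := by omega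
  have hk : (c 0).1 / 2 < h := by clear a1 a2 a3 a4 a5; omega
  refine ⟨⟨(c 0).1 / 2, hk⟩, fun i => ?_⟩
  clear a1 a2 a3 a4 a5
  fin_cases i
  · change (c 0).1 = 2 * ((c 0).1 / 2)
    omega
  · change (c 1).1 = 2 * ((c 0).1 / 2) + 1
    omega
  · change (c 2).1 = 2 * ((c 0).1 / 2) + 2
    omega
  · change (c 3).1 = 4 * h - 1 - 2 * ((c 0).1 / 2)
    omega
  · change (c 4).1 = 4 * h - 2 * ((c 0).1 / 2)
    omega
  · change (c 5).1 = 4 * h + 1 - 2 * ((c 0).1 / 2)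
    omega

theorem exists_hexagon_of_min {c : Fin 6 → Fin (4 * h + 2)} (hc : Function.Injective c)
    (hG : ∀ i, (chainGraph h).Adj (c i) (c (i + 1)))
    (hmin : ∀ i, (c 0).1 ≤ c i ∧ (c 0).1 + c i ≤ 4 * h + 1) :
    ∃ k : Fin h, hexEdges c = hexagon k := by
  have main : ∀ c : Fin 6 → Fin (4 * h + 2), Function.Injective c →
      (∀ i, (chainGraph h).Adj (c i) (c (i + 1))) →
      (∀ i, (c 0).1 ≤ c i ∧ (c 0).1 + c i ≤ 4 * h + 1) → (c 1).1 = c 0 + 1 →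
      ∃ k : Fin h, hexEdges c = hexagon k := by
    intro c hc hG hmin h1
    obtain ⟨k, hk⟩ := exists_eq_corner hc hG hmin h1
    exact ⟨k, congrArg hexEdges (funext fun i => Fin.ext (hk i))⟩
  by_cases h1 : (c 1).1 = c 0 + 1
  · exact main c hc hG hmin h1
  -- If the cycle does not leave its leftmost upper vertex along the path, then it returns along it,
  -- and the reversed cycle is of the required form.
  · obtain ⟨k, hk⟩ := main (fun i => c (-i)) (fun i j e => neg_injective (hc e)) (fun i => by
      have := (hG (-(i + 1))).symm
      rwa [(by decide : ∀ i : Fin 6, -(i + 1) + 1 = -i) i] at this) (fun i => hmin (-i)) (by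
      change (c 5).1 = c 0 + 1
      have a0 := chainGraph_adj.1 (hG 0)
      have a5 := chainGraph_adj.1 (hG 5)
      rw [show (0 : Fin 6) + 1 = 1 from rfl] at a0
      rw [show (5 : Fin 6) + 1 = 0 from rfl] at a5
      have n15 : (c 1).1 ≠ c 5 := fun e => absurd (hc (Fin.ext e)) (by decide)
      have m1 := hmin 1
      have m5 := hmin 5
      have m0 := hmin 0
      omega)
    rw [hexEdges_reflect] at hk
    exact ⟨k, hk⟩

/-- The column of a vertex `i` is `min i (4 * h + 1 - i)`. In the leftmost column of a 6-cycle there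
is a vertex of the upper path: a lower vertex there cannot have both cycle neighbors further along
its own path, so one of them is across the rung. Numbering the cycle from that upper vertex reduces
to `exists_hexagon_of_min`. -/
theorem exists_hexagon {C : Set (Sym2 (Fin (4 * h + 2)))} (hC : IsCycleEdges (chainGraph h) 6 C) :
    ∃ k : Fin h, C = hexagon k := by
  obtain ⟨c, hc, hG, rfl⟩ := hC.exists_hexEdges
  have rot : ∀ j, (∀ i, (c j).1 ≤ c i ∧ (c j).1 + c i ≤ 4 * h + 1) →
      ∃ k : Fin h, hexEdges c = hexagon k := by
    intro j hj
    rw [← hexEdges_rotate c j]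
    refine exists_hexagon_of_min (fun a b e => add_left_cancel (hc e)) (fun i => ?_) fun i => ?_
    · rw [← add_assoc]
      exact hG _
    · rw [add_zero]
      exact hj _
  obtain ⟨j, hj⟩ := Finite.exists_min fun i => min (c i).1 (4 * h + 1 - c i)
  by_cases htop : (c j).1 ≤ 2 * h
  · refine rot j fun i => ?_
    have := hj i
    have := (c i).2
    omega
  have b := (c j).2
  obtain ⟨j', hj'⟩ : ∃ j', (c j').1 + c j = 4 * h + 1 := by
    have a0 := chainGraph_adj.1 (hG j)
    have a5 := chainGraph_adj.1 (hG (j - 1))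
    rw [sub_add_cancel] at a5
    have n : (c (j + 1)).1 ≠ c (j - 1) := fun e =>
      absurd (hc (Fin.ext e)) (by clear * -; revert j; decide)
    have m1 := hj (j + 1)
    have m5 := hj (j - 1)
    have b1 := (c (j + 1)).2
    have b5 := (c (j - 1)).2
    by_cases e : (c (j + 1)).1 + c j = 4 * h + 1
    · exact ⟨_, e⟩
    · refine ⟨j - 1, ?_⟩
      omega
  refine rot j' fun i => ?_
  have := hj i
  have := (c i).2
  omega

theorem no_common_vertex {k₁ k₂ k₃ : Fin h} (h12 : hexagon k₁ ≠ hexagon k₂)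
    (h13 : hexagon k₁ ≠ hexagon k₃) (h23 : hexagon k₂ ≠ hexagon k₃) {v : ℕ}
    (h1 : InHexagon h k₁ v) (h2 : InHexagon h k₂ v) (h3 : InHexagon h k₃ v) : False := by
  have n12 : k₁.1 ≠ k₂ := fun e => h12 (congrArg _ (Fin.ext e))
  have n13 : k₁.1 ≠ k₃ := fun e => h13 (congrArg _ (Fin.ext e))
  have n23 : k₂.1 ≠ k₃ := fun e => h23 (congrArg _ (Fin.ext e))
  unfold InHexagon at *
  have := k₁.2
  have := k₂.2
  have := k₃.2
  omega

theorem isBenzenoid_embedding (hh : 1 ≤ h) : (embedding hh).IsBenzenoid where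
  twoConnected := isTwoConnected hh
  face_hexagon := by
    rw [innerFaces_embedding]
    rintro _ ⟨k, rfl⟩
    exact isCycleEdges_hexagon k
  hexagon_face := by
    intro C hC
    obtain ⟨k, rfl⟩ := exists_hexagon hC
    rw [innerFaces_embedding]
    exact ⟨k, rfl⟩
  pair := by
    have hdis : ∀ k k' : Fin h, k.1 + 1 < k' →
        Disjoint (vertsOf (hexagon k)) (vertsOf (hexagon k')) := by
      intro k k' hlt
      rw [Set.disjoint_left]
      intro v h1 h2
      rw [mem_vertsOf_hexagon] at h1 h2
      unfold InHexagon at h1 h2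
      have := k.2
      have := k'.2
      omega
    have hadj : ∀ k k' : Fin h, k.1 + 1 = k' → (hexagon k ∩ hexagon k').ncard = 1 := by
      intro k k' hlt
      have hk := k.2
      have hk' := k'.2
      rw [Set.ncard_eq_one]
      refine ⟨s(⟨2 * k'.1, by omega⟩, ⟨4 * h + 1 - 2 * k'.1, by omega⟩), ?_⟩
      ext e
      induction e using Sym2.ind with
      | _ a b =>
        have ha := a.2
        have hb := b.2
        rw [Set.mem_inter_iff, mem_hexagon, mem_hexagon, Set.mem_singleton_iff, Sym2.eq_iff]
        simp only [Fin.ext_iff]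
        constructor
        · rintro ⟨⟨h0, h1, h2⟩, -, h3, h4⟩
          have e1 : a.1 = 2 * k' ∨ a.1 = 4 * h + 1 - 2 * k' := by
            unfold InHexagon at h1 h3
            omega
          have e2 : b.1 = 2 * k' ∨ b.1 = 4 * h + 1 - 2 * k' := by
            unfold InHexagon at h2 h4
            omega
          clear h1 h2 h3 h4
          unfold ChainAdj at h0
          omega
        · rintro (⟨h1, h2⟩ | ⟨h1, h2⟩) <;> rw [h1, h2] <;>
            (unfold ChainAdj InHexagon; refine ⟨⟨?_, ?_, ?_⟩, ?_, ?_, ?_⟩ <;> omega)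
    intro C D hC hD hCD
    obtain ⟨k, rfl⟩ := exists_hexagon hC
    obtain ⟨k', rfl⟩ := exists_hexagon hD
    have hne : k.1 ≠ k' := fun e => hCD (congrArg _ (Fin.ext e))
    by_cases h1 : k.1 + 1 = k'
    · exact Or.inr (hadj _ _ h1)
    by_cases h2 : k'.1 + 1 = k
    · rw [Set.inter_comm]
      exact Or.inr (hadj _ _ h2)
    left
    rcases lt_or_gt_of_ne hne with h3 | h3
    · exact hdis _ _ (by omega)
    · exact (hdis _ _ (by omega)).symm
  triple := by
    intro C₁ C₂ C₃ h1 h2 h3 h12 h13 h23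
    obtain ⟨k₁, rfl⟩ := exists_hexagon h1
    obtain ⟨k₂, rfl⟩ := exists_hexagon h2
    obtain ⟨k₃, rfl⟩ := exists_hexagon h3
    rw [Set.eq_empty_iff_forall_notMem]
    intro e
    induction e using Sym2.ind with
    | _ a b =>
      rintro ⟨⟨e1, e2⟩, e3⟩
      exact no_common_vertex h12 h13 h23 (mem_vertsOf_hexagon.1 ⟨_, e1, Sym2.mem_mk_left a b⟩)
        (mem_vertsOf_hexagon.1 ⟨_, e2, Sym2.mem_mk_left a b⟩)
        (mem_vertsOf_hexagon.1 ⟨_, e3, Sym2.mem_mk_left a b⟩)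

theorem isCatacondensed (hh : 1 ≤ h) :
    IsCatacondensed (chainGraph h) (Set.range (hexagon (h := h))) := by
  refine ⟨embedding hh, isBenzenoid_embedding hh, (innerFaces_embedding hh).symm, ?_⟩
  rintro ⟨v, _, ⟨k₁, rfl⟩, _, ⟨k₂, rfl⟩, _, ⟨k₃, rfl⟩, h12, h13, h23, h1, h2, h3⟩
  exact no_common_vertex h12 h13 h23 (mem_vertsOf_hexagon.1 h1) (mem_vertsOf_hexagon.1 h2)
    (mem_vertsOf_hexagon.1 h3)

theorem hexagons_eq : hexagons (chainGraph h) (Set.range (hexagon (h := h))) =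
    Set.range (hexagon (h := h)) := by
  ext C
  exact ⟨fun hC => hC.1, fun ⟨k, hk⟩ => ⟨⟨k, hk⟩, hk ▸ isCycleEdges_hexagon k⟩⟩

theorem ncard_hexagons :
    (hexagons (chainGraph h) (Set.range (hexagon (h := h)))).ncard = h := by
  rw [hexagons_eq, ← Set.image_univ, Set.ncard_image_of_injective _ hexagon_injective,
    Set.ncard_univ, Nat.card_fin]

theorem adjacent_of_mem {k : Fin h} {D : Set (Sym2 (Fin (4 * h + 2)))}
    (hD : D ∈ adjacentFaces (Set.range (hexagon (h := h))) (hexagon k)) :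
    ∃ k' : Fin h, D = hexagon k' ∧ (k'.1 + 1 = k ∨ k.1 + 1 = k') := by
  obtain ⟨⟨k', rfl⟩, hne, e, he⟩ := hD
  refine ⟨k', rfl, ?_⟩
  have hkk : k'.1 ≠ k := fun e => hne (congrArg _ (Fin.ext e))
  induction e using Sym2.ind with
  | _ a b =>
    have h1 := (mem_hexagon.1 he.1).2.1
    have h2 := (mem_hexagon.1 he.2).2.1
    unfold InHexagon at h1 h2
    have := k.2
    have := k'.2
    omega

/-- A bound on the number of neighbors is sufficient: at most two rules out branched hexagons, and
at most one at the ends of the chain rules out angular hexagons there. -/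
theorem adjacentFaces_subset (k : Fin h) :
    ∃ S T, adjacentFaces (Set.range (hexagon (h := h))) (hexagon k) ⊆ {S, T} ∧
      ((k.1 = 0 ∨ k.1 + 1 = h) → S = T) := by
  have hk := k.2
  by_cases h0 : k.1 = 0
  · by_cases h1 : k.1 + 1 = h
    · refine ⟨∅, ∅, fun D hD => ?_, fun _ => rfl⟩
      obtain ⟨k', rfl, hk'⟩ := adjacent_of_mem hD
      omega
    · refine ⟨hexagon ⟨k + 1, by omega⟩, hexagon ⟨k + 1, by omega⟩, fun D hD => ?_, fun _ => rfl⟩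
      obtain ⟨k', rfl, hk'⟩ := adjacent_of_mem hD
      exact Or.inl (congrArg _ (Fin.ext (by dsimp only; omega)))
  · by_cases h1 : k.1 + 1 = h
    · refine ⟨hexagon ⟨k - 1, by omega⟩, hexagon ⟨k - 1, by omega⟩, fun D hD => ?_, fun _ => rfl⟩
      obtain ⟨k', rfl, hk'⟩ := adjacent_of_mem hD
      exact Or.inl (congrArg _ (Fin.ext (by dsimp only; omega)))
    · refine ⟨hexagon ⟨k - 1, by omega⟩, hexagon ⟨k + 1, by omega⟩, fun D hD => ?_, by omega⟩
      obtain ⟨k', rfl, hk'⟩ := adjacent_of_mem hD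
      rcases hk' with hk' | hk'
      · exact Or.inl (congrArg _ (Fin.ext (by dsimp only; omega)))
      · exact Or.inr (congrArg _ (Fin.ext (by dsimp only; omega)))

/-- The vertices of degree two are those at odd positions and the four at the ends. -/
theorem pos_of_ncard_neighborSet {v : Fin (4 * h + 2)}
    (hv : ((chainGraph h).neighborSet v).ncard = 2) :
    ¬ (v.1 % 2 = 0 ∧ 0 < v.1 ∧ v.1 < 2 * h ∨
      v.1 % 2 = 1 ∧ 2 * h + 1 < v.1 ∧ v.1 < 4 * h + 1) := by
  intro hc
  have hlt := v.2
  obtain ⟨x, y, -, hxy⟩ := Set.ncard_eq_two.1 hv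
  have key : ∀ w : ℕ, ∀ hw : w < 4 * h + 2, ChainAdj h v w → w = x.1 ∨ w = y.1 := by
    intro w hw hvw
    have : (⟨w, hw⟩ : Fin (4 * h + 2)) ∈ (chainGraph h).neighborSet v := hvw
    rw [hxy] at this
    exact this.imp (congrArg Fin.val) (congrArg Fin.val)
  have k1 := key (v + 1) (by omega) (Or.inl rfl)
  have k2 := key (v - 1) (by omega) (Or.inr (Or.inl (by omega)))
  have k3 := key (4 * h + 1 - v) (by omega) (Or.inr (Or.inr (by omega)))
  omega

/-- In an inner hexagon the vertices of degree two can only be `2 * k + 1` and `4 * h - 2 * k`, the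
middles of its two path segments, and these are not adjacent. -/
theorem hasLinearHexagons :
    HasLinearHexagons (chainGraph h) (Set.range (hexagon (h := h))) := by
  rw [HasLinearHexagons, hexagons_eq]
  rintro _ ⟨k, rfl⟩
  obtain ⟨S, T, hsub, hST⟩ := adjacentFaces_subset k
  have hle := Set.ncard_le_ncard hsub (Set.toFinite _)
  have hk := k.2
  constructor
  · rintro ⟨h2, u, hu, v, hv, hu2, hv2, huv⟩
    have hmid : ¬ (k.1 = 0 ∨ k.1 + 1 = h) := by
      intro e
      rw [hST e, Set.pair_eq_singleton, Set.ncard_singleton] at hle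
      omega
    have d1 := pos_of_ncard_neighborSet hu2
    have d2 := pos_of_ncard_neighborSet hv2
    have e1 : u.1 = 2 * k + 1 ∨ u.1 = 4 * h - 2 * k := by
      rw [mem_vertsOf_hexagon] at hu
      unfold InHexagon at hu
      omega
    have e2 : v.1 = 2 * k + 1 ∨ v.1 = 4 * h - 2 * k := by
      rw [mem_vertsOf_hexagon] at hv
      unfold InHexagon at hv
      omega
    have := chainGraph_adj.1 huv
    omega
  · intro h3
    have := (Set.ncard_insert_le S {T}).trans_eq (by rw [Set.ncard_singleton])
    rw [IsBranched] at h3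
    omega

end chainGraph

/-! ### Assembling the proposition -/

theorem exists_linearChain {h : ℕ} (hh : 1 ≤ h) :
    ∃ (n : ℕ) (L : SimpleGraph (Fin n)) (F : Set (Set (Sym2 (Fin n)))),
      IsCatacondensed L F ∧ (hexagons L F).ncard = h ∧ HasLinearHexagons L F :=
  ⟨_, chainGraph h, _, chainGraph.isCatacondensed hh, chainGraph.ncard_hexagons,
    chainGraph.hasLinearHexagons⟩

/-- Hexagonal squeezes of a phenylene. -/
theorem IsPhenylene.exists_isHexSystem {V : Type*} {G : SimpleGraph V} {F : Set (Set (Sym2 V))}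
    (h : IsPhenylene G F) :
    ∃ (n : ℕ) (B : SimpleGraph (Fin n)) (F₀ : Set (Set (Sym2 (Fin n))))
      (l : List (Fin 6 → Fin n)) (k : ℕ), IsHexSystem B F₀ l k ∧
      Nonempty (phenyleneGraph F₀ ≃g G) ∧ (hexagons G F).ncard = l.length ∧
      wienerPolarity G + 10 = 13 * l.length + k ∧ (HasLinearHexagons G F → k = 0) := by
  obtain ⟨n, B, F₀, hB, -, φ, rfl⟩ := h
  obtain ⟨-, l, k, hl⟩ := hB.exists_isHexSystem
  refine ⟨n, B, F₀, l, k, hl, ⟨φ⟩, ?_, ?_, fun hlin => ?_⟩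
  · rw [ncard_hexagons_map φ, hl.ncard_hexagons_phenylene]
  · rw [← wienerPolarity_iso φ, hl.wienerPolarity_phenyleneGraph]
  · rw [hasLinearHexagons_map φ, hl.hasLinearHexagons_phenylene_iff] at hlin
    exact hl.kinks_eq_zero hlin

theorem IsHexSystem.nonempty_iso {V W : Type*} {G : SimpleGraph V} {H : SimpleGraph W}
    {F : Set (Set (Sym2 V))} {F' : Set (Set (Sym2 W))} {l : List (Fin 6 → V)}
    {l' : List (Fin 6 → W)} (h : IsHexSystem G F l 0) (h' : IsHexSystem H F' l' 0)
    (hl : l.length = l'.length) : Nonempty (G ≃g H) := by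
  obtain ⟨φ⟩ := h.iso_ladderGraph
  obtain ⟨ψ⟩ := h'.iso_ladderGraph
  rw [hl] at φ
  exact ⟨φ.symm.trans ψ⟩

/-- Pulling apart a catacondensed benzenoid linear chain gives a phenylene linear chain. -/
theorem IsCatacondensed.exists_phenylene {n : ℕ} {B : SimpleGraph (Fin n)}
    {F₀ : Set (Set (Sym2 (Fin n)))} (hB : IsCatacondensed B F₀)
    (h2 : 2 ≤ (hexagons B F₀).ncard) (hlin : HasLinearHexagons B F₀) :
    ∃ (m : ℕ) (L : SimpleGraph (Fin m)) (F : Set (Set (Sym2 (Fin m)))),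
      IsPhenylene L F ∧ (hexagons L F).ncard = (hexagons B F₀).ncard ∧
      HasLinearHexagons L F := by
  obtain ⟨-, l, k, hl⟩ := hB.exists_isHexSystem
  obtain ⟨m, ⟨e⟩⟩ := Finite.exists_equiv_fin (PhenyleneVertex F₀)
  let φ : phenyleneGraph F₀ ≃g (phenyleneGraph F₀).map e.toEmbedding := Iso.map e _
  refine ⟨m, _, (fun C => Sym2.map φ '' C) '' phenyleneFaces F₀,
    ⟨n, B, F₀, hB, h2, φ, rfl⟩, ?_, ?_⟩
  · rw [ncard_hexagons_map φ, hl.ncard_hexagons_phenylene, hl.ncard_hexagons]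
  · rwa [hasLinearHexagons_map φ, hl.hasLinearHexagons_phenylene_iff]

/-- Uniqueness of the linear chain is contained in the minimizer clauses: if `G` is also a linear
chain, the inequality holds in both directions, so the indices agree and the graphs are isomorphic.
-/
theorem mainTheorem3 (h : ℕ) :
    -- catacondensed benzenoid graphs: the linear chain exists
    (1 ≤ h → ∃ (n : ℕ) (L : SimpleGraph (Fin n)) (F : Set (Set (Sym2 (Fin n)))),
      IsCatacondensed L F ∧ (hexagons L F).ncard = h ∧ HasLinearHexagons L F) ∧
    -- and is the unique minimizer
    (∀ (V : Type*) (W : Type*) [Finite V] [Finite W]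
      (G : SimpleGraph V) (F : Set (Set (Sym2 V)))
      (L : SimpleGraph W) (F' : Set (Set (Sym2 W))),
      IsCatacondensed G F → (hexagons G F).ncard = h →
      IsCatacondensed L F' → (hexagons L F').ncard = h → HasLinearHexagons L F' →
      wienerPolarity L ≤ wienerPolarity G ∧
        (wienerPolarity G = wienerPolarity L ↔ Nonempty (G ≃g L))) ∧
    -- phenylenes: the linear chain exists
    (2 ≤ h → ∃ (n : ℕ) (L : SimpleGraph (Fin n)) (F : Set (Set (Sym2 (Fin n)))),
      IsPhenylene L F ∧ (hexagons L F).ncard = h ∧ HasLinearHexagons L F) ∧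
    -- and is the unique minimizer
    (∀ (V : Type*) (W : Type*) [Finite V] [Finite W]
      (G : SimpleGraph V) (F : Set (Set (Sym2 V)))
      (L : SimpleGraph W) (F' : Set (Set (Sym2 W))),
      IsPhenylene G F → (hexagons G F).ncard = h →
      IsPhenylene L F' → (hexagons L F').ncard = h → HasLinearHexagons L F' →
      wienerPolarity L ≤ wienerPolarity G ∧
        (wienerPolarity G = wienerPolarity L ↔ Nonempty (G ≃g L))) := by
  refine ⟨exists_linearChain, ?_, fun hh => ?_, ?_⟩
  · intro V W _ _ G F L F' hG hGh hL hLh hlin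
    obtain ⟨-, l, k, hl⟩ := hG.exists_isHexSystem
    obtain ⟨-, l', k', hl'⟩ := hL.exists_isHexSystem
    obtain rfl : k' = 0 := hl'.kinks_eq_zero hlin
    have e := hl.wienerPolarity_eq
    have e' := hl'.wienerPolarity_eq
    rw [hl.ncard_hexagons] at hGh
    rw [hl'.ncard_hexagons] at hLh
    refine ⟨by omega, fun hW => ?_, fun ⟨φ⟩ => wienerPolarity_iso φ⟩
    obtain rfl : k = 0 := by omega
    exact hl.nonempty_iso hl' (by omega)
  · obtain ⟨n, B, F₀, hB, hBh, hlin⟩ := exists_linearChain (h := h) (by omega)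
    obtain ⟨m, L, F, hL, hLh, hlin'⟩ := hB.exists_phenylene (by omega) hlin
    exact ⟨m, L, F, hL, by omega, hlin'⟩
  · intro V W _ _ G F L F' hG hGh hL hLh hlin
    obtain ⟨n, B, F₀, l, k, hl, ⟨φ⟩, e1, e2, -⟩ := hG.exists_isHexSystem
    obtain ⟨n', B', F₀', l', k', hl', ⟨φ'⟩, e1', e2', e3'⟩ := hL.exists_isHexSystem
    obtain rfl : k' = 0 := e3' hlin
    refine ⟨by omega, fun hW => ?_, fun ⟨ψ⟩ => wienerPolarity_iso ψ⟩
    obtain rfl : k = 0 := by omega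
    -- Both squeezes are free of kinks and have `h` hexagons, so they are isomorphic, and the
    -- isomorphism passes to the phenylenes.
    obtain ⟨ψ⟩ := hl.nonempty_iso hl' (by omega)
    obtain ⟨χ⟩ := phenyleneGraph_iso ψ hl.cycles hl'.cycles
    exact ⟨φ.symm.trans (χ.trans φ')⟩
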